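/- Let $K=\mathrm{SU}(3)\times\mathrm{SU}(3)$ and consider the closed subgroups $$K_p=\{(\bar X,X)\mid X\in\mathrm{SU}(3)\},\qquad K_q=\Bigl\{\bigl(Y_1,\begin{pmatrix}Y_2&0\\0&y\end{pmatrix}\bigr)\in K\ \Big|\ Y_1\in\mathrm{SU}(3),\ Y_2\in\mathrm U(2),\ y\in\mathrm U(1)\Bigr\},$$ $$K_d=\Bigl\{\bigl(\begin{pmatrix}\bar z&0\\0&Z_2\end{pmatrix},\begin{pmatrix}z&0\\0&Z_1\end{pmatrix}\bigr)\in K\ \Big|\ z\in\mathrm U(1),\ Z_1,Z_2\in\mathrm U(2)\Bigr\}$$ (where $\bar X$ is the entrywise complex conjugate). Let $Z=K_p\cap K_d\cap K_q\cap\mathrm{Cen}(K)$, let $G=K/Z$ with the quotient topology, and let $G_p,G_d,G_q$ be the images of $K_p,K_d,K_q$ in $G$. Let $\Delta$ be the simplicial complex whose vertices are the cosets of $G_p$, $G_d$ and $G_q$ in $G$, a finite set of cosets being a simplex if the cosets have a common element; a vertex has type $p$, $d$ or $q$ according to which subgroup it is a coset of, and $G$ acts on $\Delta$ by left translation. (1)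 $(G,\Delta)$ is a homogeneous compact geometry of type $\mathsf C_3$. That is: $\Delta$ is a flag complex and a thick chamber complex of rank $3$, every simplex contains at most one vertex of each type, and the link of every nonmaximal simplex is a chamber complex; the links of the vertices of type $p$, $q$, $d$ are generalized triangles, quadrangles and digons, respectively (a generalized $n$-gon being a rank $2$ geometry of girth $2n$ and diameter $n$); the locally compact group $G$ acts by type-preserving automorphisms, transitively on the chambers, with closed and cocompact simplex stabilizers; and with the topology of the disjoint union $G/G_p\sqcup G/G_d\sqcup G/G_q$ the vertex set $V$ is compact Hausdorff, and for every set $J$ of types the set of simplices of type $J$, viewed as a subset of $V^J$, is closed. (2) $\Delta$ is not a building (i.e. it admits no system of apartments: thin chamber subcomplexes such that any two simplices of $\Delta$ lie in a common apartment, and such that for any two apartments containing simplices $\alpha$ and $\beta$ there is an isomorphism between them fixing $\alpha$, $\beta$ and all their faces). (3) Let $|\Delta|_K$ be the geometric realization of $\Delta$ with the coarse topology, i.e. the quotient topology with respect to the map $\mathrm{Cham}(\Delta)\times|2^I|\to|\Delta|$, $(\gamma,\sum_i i\cdot\xi(i))\mapsto\sum_i\gamma(i)\cdot\xi(i)$,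 where $I=\{p,d,q\}$, $|2^I|$ is the standard simplex on $I$, $\gamma(i)$ is the vertex of type $i$ of the chamber $\gamma$, and $\mathrm{Cham}(\Delta)$ has the subspace topology from $V^I$. Then $|\Delta|_K$ is homeomorphic to the Cayley plane $\mathbb{O}\mathrm P^2$, the space of idempotent hermitian $3\times3$-matrices of trace $1$ over the octonions $\mathbb O$. -/

import Mathlib

open scoped Pointwise Quaternion

/-! ### Simplicial complexes, chamber complexes, geometries -/

/-- A simplicial complex in an ambient set `V`: a down-closed set of finite subsets of `V`, containing
the empty simplex. Its vertices are the `v` with `{v}` a simplex; they need not exhaust `V`, so that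
links live in the same ambient set. -/
@[ext]
structure SComplex (V : Type*) where
  simplices : Set (Finset V)
  empty_mem : ∅ ∈ simplices
  down_closed : ∀ ⦃α β : Finset V⦄, α ⊆ β → β ∈ simplices → α ∈ simplices

namespace SComplex

variable {V I : Type*}

def vertexSet (Δ : SComplex V) : Set V := {v | {v} ∈ Δ.simplices}

/-- Two vertices are joined if some simplex contains both of them (a vertex is joined to itself). -/
def Joined (Δ : SComplex V) (u v : V) : Prop := ∃ α ∈ Δ.simplices, u ∈ α ∧ v ∈ α

/-- Every finite set of pairwise adjacent vertices is a simplex. -/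
def IsFlagComplex (Δ : SComplex V) : Prop :=
  ∀ s : Finset V, (∀ u ∈ s, ∀ v ∈ s, Δ.Joined u v) → s ∈ Δ.simplices

/-- The link of `α`: all simplices `β` disjoint from `α` such that `α ∪ β` is a simplex. -/
def link (Δ : SComplex V) (α : Finset V) (hα : α ∈ Δ.simplices) : SComplex V where
  simplices := {β | ∃ h : Disjoint α β, α.disjUnion β h ∈ Δ.simplices}
  empty_mem := ⟨Finset.disjoint_empty_right α, by simpa using hα⟩
  down_closed := by
    rintro β γ hβγ ⟨h, hγ⟩
    refine ⟨Finset.disjoint_of_subset_right hβγ h, Δ.down_closed ?_ hγ⟩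
    intro x hx
    rw [Finset.mem_disjUnion] at hx ⊢
    exact hx.imp id (fun hx => hβγ hx)

def IsMaximalSimplex (Δ : SComplex V) (α : Finset V) : Prop :=
  Maximal (fun β => β ∈ Δ.simplices) α

/-- Pure of rank `n`. -/
def IsPure (Δ : SComplex V) (n : ℕ) : Prop :=
  (∀ α ∈ Δ.simplices, ∃ β, Δ.IsMaximalSimplex β ∧ α ⊆ β) ∧
    ∀ β, Δ.IsMaximalSimplex β → β.card = n

/-- The chambers of a pure complex of rank `n` are the simplices of rank `n`. -/
def chambers (Δ : SComplex V) (n : ℕ) : Set (Finset V) := {γ ∈ Δ.simplices | γ.card = n}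

/-- Consecutive chambers of a gallery: their intersection has corank at most `1`. -/
def GalleryStep (Δ : SComplex V) (n : ℕ) (γ γ' : Finset V) : Prop :=
  γ ∈ Δ.chambers n ∧ γ' ∈ Δ.chambers n ∧ ∃ α, α ⊆ γ ∧ α ⊆ γ' ∧ n ≤ α.card + 1

/-- A chamber complex of rank `n`: pure, and any two chambers are connected by a gallery. -/
def IsChamberComplex (Δ : SComplex V) (n : ℕ) : Prop :=
  Δ.IsPure n ∧ ∀ γ ∈ Δ.chambers n, ∀ γ' ∈ Δ.chambers n,
    Relation.ReflTransGen (Δ.GalleryStep n) γ γ'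

/-- Every simplex of corank `1` is in at least three chambers. -/
def IsThick (Δ : SComplex V) (n : ℕ) : Prop :=
  ∀ α ∈ Δ.simplices, α.card + 1 = n → 3 ≤ {γ ∈ Δ.chambers n | α ⊆ γ}.encard

/-- Every simplex of corank `1` is in exactly two chambers. -/
def IsThin (Δ : SComplex V) (n : ℕ) : Prop :=
  ∀ α ∈ Δ.simplices, α.card + 1 = n → {γ ∈ Δ.chambers n | α ⊆ γ}.encard = 2

/-- `(Δ, t)` is a (thick, residually connected) geometry over the finite set of types `J`. -/
structure IsGeometry (Δ : SComplex V) (t : V → I) (J : Finset I) : Prop where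
  chamberComplex : Δ.IsChamberComplex J.card
  thick : Δ.IsThick J.card
  type_mem : ∀ v ∈ Δ.vertexSet, t v ∈ J
  type_injOn : ∀ α ∈ Δ.simplices, Set.InjOn t (α : Set V)
  flag : Δ.IsFlagComplex
  link_chamberComplex : ∀ (α : Finset V) (hα : α ∈ Δ.simplices), ¬ Δ.IsMaximalSimplex α →
    (Δ.link α hα).IsChamberComplex (J.card - α.card)

/-- The `1`-skeleton, as a graph on the set of vertices. -/
def skeleton (Δ : SComplex V) : SimpleGraph Δ.vertexSet where
  Adj u v := u ≠ v ∧ Δ.Joined u v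
  symm := ⟨fun _ _ ⟨h, α, hα, hu, hv⟩ => ⟨h.symm, α, hα, hv, hu⟩⟩
  loopless := ⟨fun _ h => h.1 rfl⟩

/-- A generalized `m`-gon: a geometry of rank `2`, of girth `2m` and diameter `m`, with `m ≥ 2`. -/
structure IsGeneralizedPolygon (Δ : SComplex V) (t : V → I) (J : Finset I) (m : ℕ) : Prop where
  geometry : Δ.IsGeometry t J
  rank_two : J.card = 2
  two_le : 2 ≤ m
  girth : Δ.skeleton.egirth = ((2 * m : ℕ) : ℕ∞)
  diam : Δ.skeleton.ediam = (m : ℕ∞)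

/-- A geometry of type `M` with vertex set `V` over the finite type set `I`: the link of every simplex
of cotype `{i, j}`, `i ≠ j`, is a generalized `M i j`-gon. -/
structure IsGeometryOfType [Fintype I] [DecidableEq I] (Δ : SComplex V) (t : V → I)
    (M : CoxeterMatrix I) : Prop where
  vertices : Δ.vertexSet = Set.univ
  geometry : Δ.IsGeometry t Finset.univ
  links : ∀ (i j : I), i ≠ j → ∀ (α : Finset V) (hα : α ∈ Δ.simplices),
    α.image t = Finset.univ \ {i, j} →
      (Δ.link α hα).IsGeneralizedPolygon t {i, j} (M i j)

/-! ### Buildings -/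

/-- `Σ₁` and `Σ₂` are isomorphic by an isomorphism that fixes all the vertices in `s`. -/
def IsoFixing (A B : SComplex V) (s : Set V) : Prop :=
  ∃ φ : A.vertexSet ≃ B.vertexSet,
    (∀ σ : Finset A.vertexSet,
      σ.map (Function.Embedding.subtype _) ∈ A.simplices ↔
        (σ.map φ.toEmbedding).map (Function.Embedding.subtype _) ∈ B.simplices) ∧
    ∀ v : A.vertexSet, (v : V) ∈ s → (φ v : V) = v

/-- `Δ` is a (thick) building: a thick chamber complex that admits a system `𝒜` of subcomplexes, the
apartments, which are thin chamber complexes, such that any two simplices lie in a common apartment,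
and such that for any two apartments containing the simplices `α` and `β` there is an isomorphism
between them fixing `α`, `β` and all their faces. -/
def IsBuilding (Δ : SComplex V) : Prop :=
  ∃ n : ℕ, Δ.IsChamberComplex n ∧ Δ.IsThick n ∧ ∃ 𝒜 : Set (SComplex V),
    (∀ A ∈ 𝒜, A.simplices ⊆ Δ.simplices ∧ A.IsChamberComplex n ∧ A.IsThin n) ∧
    (∀ α ∈ Δ.simplices, ∀ β ∈ Δ.simplices, ∃ A ∈ 𝒜, α ∈ A.simplices ∧ β ∈ A.simplices) ∧
    ∀ A ∈ 𝒜, ∀ B ∈ 𝒜, ∀ α β : Finset V,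
      α ∈ A.simplices → β ∈ A.simplices → α ∈ B.simplices → β ∈ B.simplices →
        IsoFixing A B ((α : Set V) ∪ (β : Set V))

/-! ### Compact geometries and the coarse realization -/

/-- The flag variety of type `J`: the simplices of type `J`, viewed as `J`-tuples of vertices. -/
def flagVariety (Δ : SComplex V) (t : V → I) (J : Finset I) : Set (J → V) :=
  {f | (∀ j, t (f j) = j) ∧ ∃ α ∈ Δ.simplices, (α : Set V) = Set.range f}

/-- The chambers of a geometry over `I`, viewed as `I`-tuples of vertices. -/
def chamberTuples (Δ : SComplex V) (t : V → I) : Set (I → V) :=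
  {f | (∀ i, t (f i) = i) ∧ ∃ α ∈ Δ.simplices, (α : Set V) = Set.range f}

structure IsCompactGeometry [Fintype I] [DecidableEq I] [TopologicalSpace V]
    (Δ : SComplex V) (t : V → I) (M : CoxeterMatrix I) : Prop where
  ofType : Δ.IsGeometryOfType t M
  compact : CompactSpace V
  hausdorff : T2Space V
  closed : ∀ J : Finset I, IsClosed (Δ.flagVariety t J)

/-- `(G, Δ)` is a homogeneous compact geometry of type `M`: a locally compact group `G` acts by
type-preserving automorphisms on the geometry `Δ` of type `M`, transitively on the chambers, with closed
and cocompact simplex stabilizers. The vertex set carries the topology of the disjoint union of the coset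
spaces `G / G_v`, and with this topology `Δ` is a compact geometry. -/
structure IsHomogeneousCompactGeometry (G : Type*) [Group G] [TopologicalSpace G] [MulAction G V]
    [Fintype I] [DecidableEq I] [TopologicalSpace V]
    (Δ : SComplex V) (t : V → I) (M : CoxeterMatrix I) : Prop where
  topologicalGroup : IsTopologicalGroup G
  locallyCompact : LocallyCompactSpace G
  hausdorff : T2Space G
  ofType : Δ.IsGeometryOfType t M
  simplicial : ∀ (g : G), ∀ α ∈ Δ.simplices,
    α.map (MulAction.toPerm g).toEmbedding ∈ Δ.simplices
  type_smul : ∀ (g : G) (v : V), t (g • v) = t v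
  transitive : ∀ γ ∈ Δ.chambers (Fintype.card I), ∀ γ' ∈ Δ.chambers (Fintype.card I),
    ∃ g : G, γ.map (MulAction.toPerm g).toEmbedding = γ'
  stabilizer_closed : ∀ α ∈ Δ.simplices,
    IsClosed (MulAction.stabilizer G (α : Set V) : Set G)
  stabilizer_cocompact : ∀ α ∈ Δ.simplices,
    CompactSpace (G ⧸ MulAction.stabilizer G (α : Set V))
  isOpen_iff : ∀ U : Set V, IsOpen U ↔ ∀ v : V, IsOpen {g : G | g • v ∈ U}
  compactGeometry : Δ.IsCompactGeometry t M

/-- The set `|Δ|`: all `ξ : V → [0, 1]` whose support is a simplex and whose values sum to `1`, with the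
topology `|Δ|_K`, the quotient topology with respect to the map
`Cham(Δ) × |2^I| → |Δ|`, `(γ, ξ) ↦ ∑ i, ξ i · γ i`, defined below. -/
def CoarseRealization (Δ : SComplex V) (_t : V → I) : Type _ :=
  {ξ : V →₀ ℝ // (∀ v, 0 ≤ ξ v) ∧ ξ.support ∈ Δ.simplices ∧ ξ.sum (fun _ x => x) = 1}

noncomputable def coarseMap [Fintype I] (Δ : SComplex V) (t : V → I)
    (x : Δ.chamberTuples t × stdSimplex ℝ I) : CoarseRealization Δ t :=
  ⟨∑ i, Finsupp.single (x.1.1 i) (x.2.1 i), by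
    obtain ⟨⟨f, hf, α, hα, hαf⟩, ⟨c, hc0, hc1⟩⟩ := x
    refine ⟨fun v => ?_, ?_, ?_⟩
    · rw [Finsupp.finsetSum_apply]
      refine Finset.sum_nonneg fun i _ => ?_
      exact (Finsupp.single_nonneg.2 (hc0 i)) v
    · refine Δ.down_closed (fun v hv => ?_) hα
      rw [Finsupp.mem_support_iff, Finsupp.finsetSum_apply] at hv
      obtain ⟨i, -, hi⟩ := Finset.exists_ne_zero_of_sum_ne_zero hv
      have hv' : f i = v := by
        by_contra hne
        exact hi (Finsupp.single_eq_of_ne (Ne.symm hne))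
      have : v ∈ (α : Set V) := hαf ▸ ⟨i, hv'⟩
      exact this
    · rw [← Finsupp.sum_finsetSum_index (fun _ => rfl) (fun _ _ _ => rfl)]
      simpa using hc1⟩

noncomputable instance [Fintype I] [TopologicalSpace V] (Δ : SComplex V) (t : V → I) :
    TopologicalSpace (CoarseRealization Δ t) :=
  TopologicalSpace.coinduced (coarseMap Δ t) inferInstance

end SComplex

/-- The nerve of the covering of `G` by the cosets of the subgroups `H i`: the vertices are the cosets, a
finite set of cosets is a simplex if the cosets have a common element. -/
def cosetNerve {G ι : Type*} [Group G] (H : ι → Subgroup G) : SComplex (Σ i, G ⧸ H i) where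
  simplices := {s | (⋂ v ∈ s, {g : G | (g : G ⧸ H v.1) = v.2}).Nonempty}
  empty_mem := by simp
  down_closed := fun _ _ h ⟨g, hg⟩ =>
    ⟨g, Set.mem_iInter₂.2 fun v hv => Set.mem_iInter₂.1 hg v (h hv)⟩

/-! ### The group `G = (SU(3) × SU(3)) / Z` and its subgroups -/

abbrev SU3 : Type := Matrix.specialUnitaryGroup (Fin 3) ℂ

namespace ExceptionalC3

/-- The pairs `(Y₁, diag(Y₂, y))` with `Y₁ ∈ SU(3)`, `Y₂ ∈ U(2)`, `y ∈ U(1)`, `y det Y₂ = 1`. -/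
def Kq : Subgroup (SU3 × SU3) where
  carrier := {k | k.2.1 0 2 = 0 ∧ k.2.1 1 2 = 0 ∧ k.2.1 2 0 = 0 ∧ k.2.1 2 1 = 0}
  one_mem' := by simp
  mul_mem' := by
    rintro a b ⟨h1, h2, h3, h4⟩ ⟨h5, h6, h7, h8⟩
    simp [Matrix.mul_apply, Fin.sum_univ_three, *]
  inv_mem' := by
    rintro a ⟨h1, h2, h3, h4⟩
    simp [← Matrix.star_eq_inv, Matrix.star_apply, *]

/-- The pairs `(diag(z̄, Z₂), diag(z, Z₁))` in `SU(3) × SU(3)` with `z ∈ U(1)`, `Z₁, Z₂ ∈ U(2)`. -/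
def Kd : Subgroup (SU3 × SU3) where
  carrier := {k | (k.1.1 0 1 = 0 ∧ k.1.1 0 2 = 0 ∧ k.1.1 1 0 = 0 ∧ k.1.1 2 0 = 0) ∧
    (k.2.1 0 1 = 0 ∧ k.2.1 0 2 = 0 ∧ k.2.1 1 0 = 0 ∧ k.2.1 2 0 = 0) ∧
    k.1.1 0 0 = star (k.2.1 0 0)}
  one_mem' := by simp
  mul_mem' := by
    rintro a b ⟨⟨h1, h2, h3, h4⟩, ⟨h5, h6, h7, h8⟩, h⟩ ⟨⟨h1', h2', h3', h4'⟩, ⟨h5', h6', h7', h8'⟩, h'⟩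
    simp [Matrix.mul_apply, Fin.sum_univ_three, *]
  inv_mem' := by
    rintro a ⟨⟨h1, h2, h3, h4⟩, ⟨h5, h6, h7, h8⟩, h⟩
    simp [← Matrix.star_eq_inv, Matrix.star_apply, *]

/-- The pairs `(X̄, X)` with `X ∈ SU(3)`, where `X̄` is the entrywise conjugate of `X`. -/
def Kp : Subgroup (SU3 × SU3) where
  carrier := {k | ∀ i j, k.1.1 i j = star (k.2.1 i j)}
  one_mem' := by
    intro i j
    by_cases h : i = j <;> simp [h]
  mul_mem' := by
    intro a b ha hb i j
    simp [Matrix.mul_apply, Fin.sum_univ_three, ha _ _, hb _ _]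
  inv_mem' := by
    intro a ha i j
    simp [← Matrix.star_eq_inv, Matrix.star_apply, ha _ _]

/-- The stabilizers, indexed by the types `0 = q`, `1 = d`, `2 = p`. -/
def K : Fin 3 → Subgroup (SU3 × SU3) := ![Kq, Kd, Kp]

/-- The intersection of the center of `SU(3) × SU(3)` with the chamber stabilizer; it is `ℤ/3`. -/
def Z : Subgroup (SU3 × SU3) := Subgroup.center (SU3 × SU3) ⊓ ⨅ i, K i

instance : Z.Normal where
  conj_mem z hz g := by
    have h : g * z * g⁻¹ = z := by rw [Subgroup.mem_center_iff.1 hz.1 g]; group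
    rwa [h]

abbrev G : Type := (SU3 × SU3) ⧸ Z

/-- The images `G_q`, `G_d`, `G_p` of the subgroups `K_q`, `K_d`, `K_p` in `G`. -/
def stab (i : Fin 3) : Subgroup G := (K i).map (QuotientGroup.mk' Z)

/-- The coset nerve of `G` with respect to `G_q`, `G_d`, `G_p`. -/
def Delta : SComplex (Σ i, G ⧸ stab i) := cosetNerve stab

/-- The type of a coset of `G_q`, `G_d`, `G_p` is `0`, `1`, `2`, respectively. -/
def vertexType : (Σ i, G ⧸ stab i) → Fin 3 := Sigma.fst

end ExceptionalC3

/-! ### The Cayley plane -/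

/-- The real Cayley division algebra, as the Cayley-Dickson double of the quaternions. -/
def Octonion : Type := ℍ[ℝ] × ℍ[ℝ]

namespace Octonion

noncomputable instance : AddCommGroup Octonion := inferInstanceAs (AddCommGroup (ℍ[ℝ] × ℍ[ℝ]))

noncomputable instance : TopologicalSpace Octonion :=
  inferInstanceAs (TopologicalSpace (ℍ[ℝ] × ℍ[ℝ]))

noncomputable instance : One Octonion := ⟨((1, 0) : ℍ[ℝ] × ℍ[ℝ])⟩

noncomputable instance : Mul Octonion :=
  ⟨fun x y => ((x.1 * y.1 - star y.2 * x.2, y.2 * x.1 + x.2 * star y.1) : ℍ[ℝ] × ℍ[ℝ])⟩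

noncomputable instance : Star Octonion := ⟨fun x => ((star x.1, -x.2) : ℍ[ℝ] × ℍ[ℝ])⟩

end Octonion

/-- The Cayley plane `OP²`: the idempotent hermitian `3 × 3`-matrices over the octonions of trace `1`. -/
def CayleyPlane : Type :=
  {X : Matrix (Fin 3) (Fin 3) Octonion // X.conjTranspose = X ∧ X * X = X ∧ X.trace = 1}

noncomputable instance : TopologicalSpace CayleyPlane :=
  inferInstanceAs (TopologicalSpace
    {X : Matrix (Fin 3) (Fin 3) Octonion // X.conjTranspose = X ∧ X * X = X ∧ X.trace = 1})

/-!
Every vertex `g G_i` is encoded by a matrix. For `g = (A, B)`, with first columns `a`, `b` of `A`, `B` and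
last column `w` of `B`, a coset of `G_q` (a point) is determined by the projector `w w*`, a coset of
`G_d` (a line) by `a bᵀ`, and a coset of `G_p` (a plane) by `P = A Bᵀ` (`vtx_eq_vtx_iff`). In these terms
a point is on a line if `w ⟂ b`, a plane contains a line if `P b̄ = a`, and every point is in every plane.
So the points and lines of a plane form the complex projective plane, and the flags on a point form a
generalized quadrangle: given a line and a plane on the point that are not incident, the connecting
flag is the solution of a small linear system. These incidence properties are collected in
`SComplex.IsFlatC3`; girth and diameter of the links, connectedness, thickness and flagness follow from
them combinatorially (`SComplex.IsFlatC3.isGeometryOfType`). Since everything is a continuous image of the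
compact group `SU(3) × SU(3)`, the topological requirements follow from compactness.

The geometry is not a building because it is flat but has planes without a common line
(`SComplex.IsFlatC3.not_isBuilding`). Apartments are closed under joining points in a plane and under
projections in the quadrangle of a point. If an apartment contains planes `p`, `p'` without a common line,
then it contains a triangle in `p` and, on a vertex `q` of this triangle, an ordinary quadrangle. Both `p'`
and the other plane of the apartment on the side of the triangle opposite to `q` are opposite to `p` in
this quadrangle, hence they agree, and `p'` shares a line with `p` after all.

For the coarse realization, write octonions as `ℂ ⊕ ℂ³`. A hermitian octonionic matrix is then a pair
`(H, x)` of complex matrices with `H` hermitian, and the Cayley plane becomes the set of pairs with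
`tr H = 1`, `H² + tr(x x*) - x x* = H`, `H x = adj(x)*` (`Octonion.ofPair_mul_self_eq_iff`). It is
invariant under `(H, x) ↦ (B H B*, B x Aᵀ)`, and by the spectral theorem every orbit contains exactly one
pair of diagonal matrices with entries `λ₀ ≤ λ₁ ≤ λ₂` and `√(λ₁λ₂), √(λ₀λ₂), √(λ₀λ₁)`, where `λ₀ ≥ 0` and
`∑ λᵢ = 1`. These `λ` form a simplex with barycentric coordinates `3λ₀, 2(λ₁ - λ₀), λ₂ - λ₁`, and the
part of `g = (A, B)` that matters for a pair consists of the vertices whose coordinates do not vanish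
(`herm_mixed_congr`, `eq_of_herm_mixed_eq`). Hence the coarse realization and the Cayley plane are
quotients of the compact space `(SU(3) × SU(3)) × simplex` by the same equivalence relation.
-/

/-! ### Girth and diameter of bipartite graphs -/

lemma Bool.eq_of_ne_of_ne {x y z : Bool} (h : x ≠ y) (h' : y ≠ z) : x = z := by
  revert x y z; decide

namespace SimpleGraph

variable {W : Type*} {G : SimpleGraph W}

lemma egirth_le_of_injective {n : ℕ} (f : Fin (n + 3) → W) (hf : Function.Injective f)
    (h : ∀ k, G.Adj (f k) (f (k + 1))) : G.egirth ≤ ((n + 3 : ℕ) : ℕ∞) := by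
  have hc : cycleGraph (n + 3) ⊑ G := by
    refine ⟨⟨⟨f, fun {a b} hab => ?_⟩, hf⟩⟩
    rcases cycleGraph_adj.1 hab with h' | h'
    · rw [sub_eq_iff_eq_add.1 h', add_comm]
      exact (h b).symm
    · rw [sub_eq_iff_eq_add.1 h', add_comm]
      exact h a
  obtain ⟨v, p, hp, hl⟩ := (cycleGraph_isContained_iff (by omega)).1 hc
  exact hl ▸ egirth_le_length hp

/-- Cycles in a bipartite graph have even length, so a lower bound for the girth amounts to the
absence of short even cycles. -/
lemma Coloring.two_mul_le_egirth (c : G.Coloring Bool) (m : ℕ)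
    (h : ∀ k, 2 ≤ k → k < m → ∀ f : Fin (2 * k) → W, Function.Injective f →
      ¬ ∀ a b : Fin (2 * k), (cycleGraph (2 * k)).Adj a b → G.Adj (f a) (f b)) :
    ((2 * m : ℕ) : ℕ∞) ≤ G.egirth := by
  rw [le_egirth]
  intro a w hw
  by_contra hlt
  rw [not_le, Nat.cast_lt] at hlt
  obtain ⟨k, hk⟩ := (c.even_length_iff_congr w).2 Iff.rfl
  have h3 := hw.three_le_length
  obtain ⟨φ⟩ := (cycleGraph_isContained_iff (G := G) (n := 2 * k) (by omega)).2
    ⟨a, w, hw, by omega⟩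
  exact h k (by omega) (by omega) φ φ.injective fun a b hab => φ.toHom.map_adj hab

lemma two_le_edist {u v : W} (huv : u ≠ v) (h : ¬ G.Adj u v) : 2 ≤ G.edist u v := by
  refine le_iInf fun w => ?_
  match w with
  | .nil => exact absurd rfl huv
  | .cons h' .nil => exact absurd h' h
  | .cons h₁ (.cons h₂ w) =>
    have : 2 ≤ ((Walk.cons h₁ (.cons h₂ w)).length) := by simp
    exact_mod_cast this

lemma Coloring.three_le_edist (c : G.Coloring Bool) {u v : W} (huv : c u ≠ c v)
    (h : ¬ G.Adj u v) : 3 ≤ G.edist u v := by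
  refine le_iInf fun w => ?_
  have ho : ¬ Even w.length := by
    rw [c.even_length_iff_congr w, ← Bool.eq_iff_iff]; exact huv
  have h1 : w.length ≠ 1 := fun h1 => h (Walk.adj_of_length_eq_one h1)
  have : 3 ≤ w.length := by
    rcases Nat.lt_or_ge w.length 3 with hl | hl
    · interval_cases w.length <;> simp_all
    · exact hl
  exact_mod_cast this

lemma Coloring.four_le_edist (c : G.Coloring Bool) {u v : W} (huv : u ≠ v) (hc : c u = c v)
    (h : ∀ w, G.Adj u w → ¬ G.Adj w v) : 4 ≤ G.edist u v := by
  refine le_iInf fun w => ?_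
  have he : Even w.length := by
    rw [c.even_length_iff_congr w, hc]
  have h0 : w.length ≠ 0 := fun h0 => huv (Walk.eq_of_length_eq_zero h0)
  have h2 : w.length ≠ 2 := by
    match w with
    | .nil => simp
    | .cons _ .nil => simp
    | .cons h₁ (.cons h₂ .nil) => exact absurd h₂ (h _ h₁)
    | .cons _ (.cons _ (.cons _ w)) => simp
  have : 4 ≤ w.length := by
    rcases Nat.lt_or_ge w.length 4 with hl | hl
    · interval_cases w.length <;> simp_all +decide
    · exact hl
  exact_mod_cast this

lemma edist_le_two {u v w : W} (h₁ : G.Adj u v) (h₂ : G.Adj v w) : G.edist u w ≤ 2 := by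
  simpa using (Walk.cons h₁ (.cons h₂ .nil)).edist_le

lemma edist_le_three {u v w x : W} (h₁ : G.Adj u v) (h₂ : G.Adj v w) (h₃ : G.Adj w x) :
    G.edist u x ≤ 3 := by
  simpa using (Walk.cons h₁ (.cons h₂ (.cons h₃ .nil))).edist_le

variable (c : G.Coloring Bool) (thick : ∀ u, ∃ v w, v ≠ w ∧ G.Adj u v ∧ G.Adj u w)

include thick

/-- A complete bipartite graph with at least two vertices on each side is a generalized digon. -/
theorem Coloring.girth_diam_digon [Nonempty W]
    (complete : ∀ u v, c u ≠ c v → G.Adj u v) :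
    G.egirth = ((2 * 2 : ℕ) : ℕ∞) ∧ G.ediam = ((2 : ℕ) : ℕ∞) := by
  obtain ⟨u⟩ := ‹Nonempty W›
  obtain ⟨v, w, hvw, hv, hw⟩ := thick u
  obtain ⟨u', hu', hne⟩ : ∃ u', G.Adj v u' ∧ u' ≠ u := by
    obtain ⟨x, y, hxy, hx, hy⟩ := thick v
    by_cases h : x = u
    · exact ⟨y, hy, fun h' => hxy (h.trans h'.symm)⟩
    · exact ⟨x, hx, h⟩
  have c1 := c.valid hv
  have c2 := c.valid hw
  have c3 := c.valid hu'
  have hwu' : G.Adj u' w := complete _ _ fun h =>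
    c3 (Bool.eq_of_ne_of_ne c1.symm c2 |>.trans h.symm)
  refine ⟨le_antisymm ?_ (c.two_mul_le_egirth 2 (by omega)), le_antisymm ?_ ?_⟩
  · refine egirth_le_of_injective (n := 1) ![u, v, u', w] ?_ ?_
    · have := hv.ne; have := hw.ne; have := hu'.ne; have := hwu'.ne
      clear complete thick
      simp only [← List.nodup_ofFn, List.ofFn_succ, List.ofFn_zero, List.nodup_cons]
      simp
      grind
    · intro k
      fin_cases k
      exacts [hv, hu', hwu', hw.symm]
  · refine ediam_le_of_edist_le fun x y => ?_
    by_cases hxy : c x = c y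
    · obtain ⟨z, -, -, hz, -⟩ := thick x
      have c4 := c.valid hz
      exact edist_le_two hz (complete z y (by rw [← hxy]; exact c4.symm))
    · have := (Walk.cons (complete x y hxy) .nil).edist_le
      exact this.trans (by simp)
  · refine le_trans ?_ (edist_le_ediam (u := v) (v := w))
    exact two_le_edist hvw fun h => (c.valid h) (Bool.eq_of_ne_of_ne c1.symm c2)

/-- The incidence graph of a projective plane is a generalized triangle. -/
theorem Coloring.girth_diam_triangle [Nonempty W]
    (join : ∀ u v, c u = c v → u ≠ v → ∃ w, G.Adj u w ∧ G.Adj w v)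
    (uniq : ∀ u v w w', u ≠ v → G.Adj u w → G.Adj w v → G.Adj u w' → G.Adj w' v → w = w') :
    G.egirth = ((2 * 3 : ℕ) : ℕ∞) ∧ G.ediam = ((3 : ℕ) : ℕ∞) := by
  have hbool : ∀ x y z : W, c x ≠ c y → c y ≠ c z → c x = c z := fun _ _ _ => Bool.eq_of_ne_of_ne
  obtain ⟨a⟩ := ‹Nonempty W›
  obtain ⟨v, y, hvy, hv, hy⟩ := thick a
  obtain ⟨x, hx, hne⟩ : ∃ u', G.Adj v u' ∧ u' ≠ a := by
    obtain ⟨x, y, hxy, hx, hy⟩ := thick v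
    by_cases h : x = a
    · exact ⟨y, hy, fun h' => hxy (h.trans h'.symm)⟩
    · exact ⟨x, hx, h⟩
  -- `x` and `y` have different colors and are not adjacent
  have hxy : ¬ G.Adj x y := fun h => hvy (uniq a x v y hne.symm hv hx hy h.symm)
  have hcxy : c x ≠ c y := by
    rw [← hbool _ _ _ (c.valid hv) (c.valid hx)]; exact c.valid hy
  obtain ⟨v₁, v₂, h12, h1, h2⟩ := thick y
  obtain ⟨d₁, hd₁, hd₁'⟩ := join x v₁ (hbool _ _ _ hcxy (c.valid h1)) (by rintro rfl; exact hxy h1.symm)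
  obtain ⟨d₂, hd₂, hd₂'⟩ := join x v₂ (hbool _ _ _ hcxy (c.valid h2)) (by rintro rfl; exact hxy h2.symm)
  have hd1y : d₁ ≠ y := by rintro rfl; exact hxy hd₁
  have hd2y : d₂ ≠ y := by rintro rfl; exact hxy hd₂
  have hd12 : d₁ ≠ d₂ := by
    rintro rfl
    exact hd1y (uniq v₁ v₂ d₁ y h12 hd₁'.symm hd₂' h1.symm h2)
  refine ⟨le_antisymm ?_ (c.two_mul_le_egirth 3 ?_), le_antisymm ?_ ?_⟩
  · refine egirth_le_of_injective (n := 3) ![x, d₁, v₁, y, v₂, d₂] ?_ ?_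
    · have := hd₁.ne; have := hd₂.ne; have := hd₁'.ne; have := hd₂'.ne; have := h1.ne
      have := h2.ne
      have hxy' : x ≠ y := by rintro rfl; exact hcxy rfl
      have hxv1 : x ≠ v₁ := by rintro rfl; exact hxy h1.symm
      have hxv2 : x ≠ v₂ := by rintro rfl; exact hxy h2.symm
      have hd1v2 : d₁ ≠ v₂ := by
        rintro rfl; exact c.valid hd₁ (hbool _ _ _ hcxy (c.valid h2))
      have hd2v1 : d₂ ≠ v₁ := by
        rintro rfl; exact c.valid hd₂ (hbool _ _ _ hcxy (c.valid h1))
      clear hbool join uniq thick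
      simp only [← List.nodup_ofFn, List.ofFn_succ, List.ofFn_zero, List.nodup_cons]
      simp
      grind
    · intro k
      fin_cases k
      exacts [hd₁, hd₁', h1.symm, h2, hd₂'.symm, hd₂.symm]
  · intro k hk1 hk2 f hf hadj
    obtain rfl : k = 2 := by omega
    have := uniq (f 0) (f 2) (f 1) (f 3) (hf.ne (by decide)) (hadj _ _ (by decide))
      (hadj _ _ (by decide)) (hadj _ _ (by decide)) (hadj _ _ (by decide))
    exact absurd (hf this) (by decide)
  · refine ediam_le_of_edist_le fun u w => ?_
    by_cases huw : c u = c w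
    · by_cases h : u = w
      · subst h; simp
      · obtain ⟨z, hz, hz'⟩ := join u w huw h
        exact (edist_le_two hz hz').trans (by norm_cast)
    · obtain ⟨z, -, -, hz, -⟩ := thick w
      by_cases h : u = z
      · subst h
        have := (Walk.cons hz.symm .nil).edist_le
        exact this.trans (by simp)
      · obtain ⟨t, ht, ht'⟩ := join u z (hbool _ _ _ huw (c.valid hz)) h
        exact edist_le_three ht ht' hz.symm
  · exact le_trans (c.three_le_edist hcxy hxy) edist_le_ediam

/-- The incidence graph of a generalized quadrangle, given by its projection axiom. -/
theorem Coloring.girth_diam_quadrangle [Nonempty W]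
    (proj : ∀ u v, c u ≠ c v → ¬ G.Adj u v → ∃ w x, G.Adj u w ∧ G.Adj w x ∧ G.Adj x v)
    (uniq : ∀ u v w x w' x', ¬ G.Adj u v → G.Adj u w → G.Adj w x → G.Adj x v →
      G.Adj u w' → G.Adj w' x' → G.Adj x' v → w = w')
    (four : ∀ u v w w', u ≠ v → G.Adj u w → G.Adj w v → G.Adj u w' → G.Adj w' v → w = w') :
    G.egirth = ((2 * 4 : ℕ) : ℕ∞) ∧ G.ediam = ((4 : ℕ) : ℕ∞) := by
  have hbool : ∀ x y z : W, c x ≠ c y → c y ≠ c z → c x = c z := fun _ _ _ => Bool.eq_of_ne_of_ne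
  have other : ∀ v a, ∃ u', G.Adj v u' ∧ u' ≠ a := fun v a => by
    obtain ⟨x, y, hxy, hx, hy⟩ := thick v
    by_cases h : x = a
    · exact ⟨y, hy, fun h' => hxy (h.trans h'.symm)⟩
    · exact ⟨x, hx, h⟩
  -- two vertices `p`, `q` of the same color without a common neighbor
  obtain ⟨p, q, hcpq, hpq, hno⟩ : ∃ p q, c p = c q ∧ p ≠ q ∧ ∀ w, G.Adj p w → ¬ G.Adj w q := by
    obtain ⟨p⟩ := ‹Nonempty W›
    obtain ⟨d, -, -, hd, -⟩ := thick p
    obtain ⟨p₁, hp₁, hne₁⟩ := other d p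
    obtain ⟨d', hd', hned⟩ := other p₁ d
    obtain ⟨q, hq, hne₂⟩ := other d' p₁
    have hdq : ¬ G.Adj d q := fun h =>
      hned (four p₁ q d' d hne₂.symm hd' hq hp₁.symm h)
    refine ⟨p, q, ?_, ?_, fun e he he' => ?_⟩
    · exact (hbool _ _ _ (c.valid hd) (c.valid hp₁)).trans (hbool _ _ _ (c.valid hd') (c.valid hq))
    · rintro rfl; exact hdq hd.symm
    · exact hne₁ (uniq d q p₁ d' p e hdq hp₁ hd' hq hd.symm he he')
  obtain ⟨d₁, d₂, hd12, hd₁, hd₂⟩ := thick p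
  have hd1q := hno d₁ hd₁
  have hd2q := hno d₂ hd₂
  obtain ⟨a₁, e₁, ha₁, he₁, hq₁⟩ := proj d₁ q (by rw [← hcpq]; exact (c.valid hd₁).symm) hd1q
  obtain ⟨a₂, e₂, ha₂, he₂, hq₂⟩ := proj d₂ q (by rw [← hcpq]; exact (c.valid hd₂).symm) hd2q
  have ha1p : a₁ ≠ p := by rintro rfl; exact hno _ he₁ hq₁
  have ha2p : a₂ ≠ p := by rintro rfl; exact hno _ he₂ hq₂
  have ha12 : a₁ ≠ a₂ := by
    rintro rfl; exact hd12 (four p a₁ d₁ d₂ ha1p.symm hd₁ ha₁ hd₂ ha₂)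
  have he12 : e₁ ≠ e₂ := by
    rintro rfl
    have hd2a1 : ¬ G.Adj d₁ e₁ := fun h => by
      exact c.valid h (hbool _ _ _ (c.valid ha₁) (c.valid he₁))
    have hda : ¬ G.Adj d₁ a₂ := fun h =>
      hd12 (four p a₂ d₁ d₂ ha2p.symm hd₁ h hd₂ ha₂)
    exact ha1p (uniq d₁ a₂ a₁ e₁ p d₂ hda ha₁ he₁ he₂.symm hd₁.symm hd₂ ha₂)
  refine ⟨le_antisymm ?_ (c.two_mul_le_egirth 4 ?_), le_antisymm ?_ ?_⟩
  · refine egirth_le_of_injective (n := 5) ![p, d₁, a₁, e₁, q, e₂, a₂, d₂] ?_ ?_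
    · have hcd : c d₁ = c d₂ := hbool _ _ _ (c.valid hd₁).symm (c.valid hd₂)
      have hca1 : c p = c a₁ := hbool _ _ _ (c.valid hd₁) (c.valid ha₁)
      have hca2 : c p = c a₂ := hbool _ _ _ (c.valid hd₂) (c.valid ha₂)
      have hce1 : c d₁ = c e₁ := hbool _ _ _ (c.valid ha₁) (c.valid he₁)
      have hce2 : c d₁ = c e₂ := hcd.trans (hbool _ _ _ (c.valid ha₂) (c.valid he₂))
      have hcpd := c.valid hd₁
      have key : ∀ x y : W, c p = c x → c d₁ = c y → x ≠ y := fun x y hx hy h => by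
        subst h; exact hcpd (hx.trans hy.symm)
      have hdq1 : d₁ ≠ e₁ := by rintro rfl; exact hd1q hq₁
      have hdq2 : d₁ ≠ e₂ := by rintro rfl; exact hd1q hq₂
      have hdq3 : d₂ ≠ e₁ := by rintro rfl; exact hd2q hq₁
      have hdq4 : d₂ ≠ e₂ := by rintro rfl; exact hd2q hq₂
      have haq1 : a₁ ≠ q := by rintro rfl; exact hd1q ha₁
      have haq2 : a₂ ≠ q := by rintro rfl; exact hd2q ha₂
      have k1 := key p d₁ rfl rfl
      have k2 := key p d₂ rfl hcd
      have k3 := key p e₁ rfl hce1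
      have k4 := key p e₂ rfl hce2
      have k5 := key q d₁ hcpq rfl
      have k6 := key q d₂ hcpq hcd
      have k7 := key q e₁ hcpq hce1
      have k8 := key q e₂ hcpq hce2
      have k9 := key a₁ d₁ hca1 rfl
      have l1 := key a₁ d₂ hca1 hcd
      have l2 := key a₁ e₁ hca1 hce1
      have l3 := key a₁ e₂ hca1 hce2
      have l4 := key a₂ d₁ hca2 rfl
      have l5 := key a₂ d₂ hca2 hcd
      have l6 := key a₂ e₁ hca2 hce1
      have l7 := key a₂ e₂ hca2 hce2
      clear key hbool other proj uniq four thick hno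
      simp only [← List.nodup_ofFn, List.ofFn_succ, List.ofFn_zero, List.nodup_cons]
      simp
      grind
    · intro k
      fin_cases k
      exacts [hd₁, ha₁, he₁, hq₁, hq₂.symm, he₂.symm, ha₂.symm, hd₂.symm]
  · intro k hk1 hk2 f hf hadj
    obtain rfl | rfl : k = 2 ∨ k = 3 := by omega
    · have := four (f 0) (f 2) (f 1) (f 3) (hf.ne (by decide)) (hadj _ _ (by decide))
        (hadj _ _ (by decide)) (hadj _ _ (by decide)) (hadj _ _ (by decide))
      exact absurd (hf this) (by decide)
    · have h03 : ¬ G.Adj (f 0) (f 3) := fun h => by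
        have := four (f 0) (f 2) (f 1) (f 3) (hf.ne (by decide)) (hadj _ _ (by decide))
          (hadj _ _ (by decide)) h (hadj _ _ (by decide))
        exact absurd (hf this) (by decide)
      have := uniq (f 0) (f 3) (f 1) (f 2) (f 5) (f 4) h03 (hadj _ _ (by decide))
        (hadj _ _ (by decide)) (hadj _ _ (by decide)) (hadj _ _ (by decide))
        (hadj _ _ (by decide)) (hadj _ _ (by decide))
      exact absurd (hf this) (by decide)
  · have hdiff : ∀ u w, c u ≠ c w → G.edist u w ≤ 3 := fun u w h => by
      by_cases ha : G.Adj u w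
      · exact (Walk.cons ha .nil).edist_le.trans (by simp)
      · obtain ⟨x, y, h1, h2, h3⟩ := proj u w h ha
        exact edist_le_three h1 h2 h3
    refine ediam_le_of_edist_le fun u w => ?_
    by_cases huw : c u = c w
    · obtain ⟨z, -, -, hz, -⟩ := thick u
      have h1 := (Walk.cons hz .nil).edist_le
      have h2 := hdiff z w (by rw [← huw]; exact (c.valid hz).symm)
      refine (G.edist_triangle (v := z)).trans ((add_le_add h1 h2).trans ?_)
      norm_num
    · exact (hdiff u w huw).trans (by norm_cast)
  · exact le_trans (c.four_le_edist hpq hcpq hno) edist_le_ediam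

end SimpleGraph

/-! ### Complexes of rank one and two, and links -/

namespace SComplex

variable {V I : Type*}

lemma Joined.symm {Δ : SComplex V} {u v : V} (h : Δ.Joined u v) : Δ.Joined v u := by
  obtain ⟨α, hα, hu, hv⟩ := h
  exact ⟨α, hα, hv, hu⟩

lemma mem_vertexSet_of_mem {Δ : SComplex V} {α : Finset V} (hα : α ∈ Δ.simplices) {v : V}
    (hv : v ∈ α) : v ∈ Δ.vertexSet :=
  Δ.down_closed (Finset.singleton_subset_iff.2 hv) hα

lemma Joined.left_mem {Δ : SComplex V} {u v : V} (h : Δ.Joined u v) : u ∈ Δ.vertexSet := by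
  obtain ⟨α, hα, hu, -⟩ := h
  exact mem_vertexSet_of_mem hα hu

lemma joined_self {Δ : SComplex V} {u : V} (h : u ∈ Δ.vertexSet) : Δ.Joined u u :=
  ⟨{u}, h, by simp, by simp⟩

lemma Joined.pair_mem [DecidableEq V] {Δ : SComplex V} {u v : V} (h : Δ.Joined u v) :
    {u, v} ∈ Δ.simplices := by
  obtain ⟨α, hα, hu, hv⟩ := h
  exact Δ.down_closed (by simp [Finset.insert_subset_iff, hu, hv]) hα

lemma joined_of_pair_mem [DecidableEq V] {Δ : SComplex V} {u v : V}
    (h : {u, v} ∈ Δ.simplices) : Δ.Joined u v :=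
  ⟨_, h, by simp, by simp⟩

lemma link_empty (Δ : SComplex V) (h : ∅ ∈ Δ.simplices) : Δ.link ∅ h = Δ := by
  ext β
  simp [link]

lemma mem_link [DecidableEq V] {Δ : SComplex V} {α β : Finset V} {hα : α ∈ Δ.simplices} :
    β ∈ (Δ.link α hα).simplices ↔ Disjoint α β ∧ α ∪ β ∈ Δ.simplices := by
  constructor
  · rintro ⟨h, h'⟩
    exact ⟨h, by rwa [Finset.disjUnion_eq_union] at h'⟩
  · rintro ⟨h, h'⟩
    exact ⟨h, by rwa [Finset.disjUnion_eq_union]⟩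

lemma isMaximalSimplex_of_card {Δ : SComplex V} {n : ℕ} (hcard : ∀ α ∈ Δ.simplices, α.card ≤ n)
    {α : Finset V} (hα : α ∈ Δ.simplices) (h : α.card = n) : Δ.IsMaximalSimplex α :=
  ⟨hα, fun β hβ hαβ => (Finset.eq_of_subset_of_card_le hαβ (h ▸ hcard β hβ)).ge⟩

lemma isPure_of_exists_card {Δ : SComplex V} {n : ℕ} (hcard : ∀ α ∈ Δ.simplices, α.card ≤ n)
    (hex : ∀ α ∈ Δ.simplices, ∃ β ∈ Δ.simplices, α ⊆ β ∧ β.card = n) : Δ.IsPure n := by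
  refine ⟨fun α hα => ?_, fun β hβ => ?_⟩
  · obtain ⟨β, hβ, hαβ, hc⟩ := hex α hα
    exact ⟨β, isMaximalSimplex_of_card hcard hβ hc, hαβ⟩
  · obtain ⟨γ, hγ, hβγ, hc⟩ := hex β hβ.prop
    rw [← hc, (hβγ.antisymm (hβ.2 hγ hβγ) : β = γ)]

/-- A nonempty complex without edges is a chamber complex of rank `1`: any two of its chambers share
the empty simplex. -/
lemma isChamberComplex_one {Δ : SComplex V} (hcard : ∀ α ∈ Δ.simplices, α.card ≤ 1)
    (hne : Δ.vertexSet.Nonempty) : Δ.IsChamberComplex 1 := by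
  refine ⟨isPure_of_exists_card hcard fun α hα => ?_, fun γ hγ γ' hγ' => ?_⟩
  · obtain ⟨v, hv⟩ := hne
    rcases Nat.le_one_iff_eq_zero_or_eq_one.1 (hcard α hα) with h | h
    · rw [Finset.card_eq_zero] at h
      exact ⟨{v}, hv, by simp [h], by simp⟩
    · exact ⟨α, hα, subset_rfl, h⟩
  · exact .single ⟨hγ, hγ', ∅, by simp, by simp, by simp⟩

/-- In a complex of rank at most `n`, the link of a nonmaximal simplex of rank `n - 1` is a chamber
complex of rank `1`. -/
lemma link_isChamberComplex_one {Δ : SComplex V} {n : ℕ}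
    (hcard : ∀ α ∈ Δ.simplices, α.card ≤ n) {α : Finset V} (hα : α ∈ Δ.simplices)
    (h : α.card + 1 = n) (hmax : ¬ Δ.IsMaximalSimplex α) :
    (Δ.link α hα).IsChamberComplex 1 := by
  classical
  refine isChamberComplex_one (fun β hβ => ?_) ?_
  · obtain ⟨hd, hu⟩ := mem_link.1 hβ
    have := hcard _ hu
    rw [Finset.card_union_of_disjoint hd] at this
    omega
  · obtain ⟨β, hβ, hlt⟩ := (not_maximal_iff hα).1 hmax
    obtain ⟨x, hx, hxα⟩ := Finset.exists_of_ssubset hlt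
    refine ⟨x, (mem_link (hα := hα)).2 ⟨by simpa using hxα, Δ.down_closed ?_ hβ⟩⟩
    exact Finset.union_subset hlt.1 (by simpa using hx)

/-- The data of a thick bipartite incidence structure with vertices of the types `i` and `j`. -/
structure IsIncidence (Λ : SComplex V) (t : V → I) (i j : I) : Prop where
  ne : i ≠ j
  type_eq : ∀ v ∈ Λ.vertexSet, t v = i ∨ t v = j
  injOn : ∀ α ∈ Λ.simplices, Set.InjOn t (α : Set V)
  nonempty : Λ.vertexSet.Nonempty
  thick : ∀ v ∈ Λ.vertexSet, ∃ f : Fin 3 → V, Function.Injective f ∧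
    ∀ m, f m ≠ v ∧ Λ.Joined v (f m)

namespace IsIncidence

variable {Λ : SComplex V} {t : V → I} {i j : I}

lemma type_ne (h : IsIncidence Λ t i j) {u v : V} (huv : Λ.Joined u v) (hne : u ≠ v) :
    t u ≠ t v := by
  obtain ⟨α, hα, hu, hv⟩ := huv
  exact fun e => hne (h.injOn α hα hu hv e)

lemma card_le (h : IsIncidence Λ t i j) [DecidableEq I] {s : Finset V}
    (hs : ∀ v ∈ s, v ∈ Λ.vertexSet) (hinj : Set.InjOn t (s : Set V)) : s.card ≤ 2 := by
  rw [← Finset.card_pair h.ne]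
  refine Finset.card_le_card_of_injOn t (fun v hv => ?_) hinj
  simpa using h.type_eq v (hs v hv)

lemma card_le_of_mem (h : IsIncidence Λ t i j) {α : Finset V} (hα : α ∈ Λ.simplices) :
    α.card ≤ 2 := by
  classical
  exact h.card_le (fun v hv => mem_vertexSet_of_mem hα hv) (h.injOn α hα)

lemma isFlagComplex (h : IsIncidence Λ t i j) : Λ.IsFlagComplex := by
  classical
  intro s hs
  have hinj : Set.InjOn t (s : Set V) := fun u hu v hv e => by
    by_contra hne
    exact h.type_ne (hs u hu v hv) hne e
  have hcard := h.card_le (fun v hv => (hs v hv v hv).left_mem) hinj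
  interval_cases hc : s.card
  · rw [Finset.card_eq_zero] at hc
    exact hc ▸ Λ.empty_mem
  · obtain ⟨u, rfl⟩ := Finset.card_eq_one.1 hc
    exact (hs u (by simp) u (by simp)).left_mem
  · obtain ⟨u, v, -, rfl⟩ := Finset.card_eq_two.1 hc
    exact (hs u (by simp) v (by simp)).pair_mem

lemma isPure (h : IsIncidence Λ t i j) : Λ.IsPure 2 := by
  classical
  refine isPure_of_exists_card (fun α hα => h.card_le_of_mem hα) fun α hα => ?_
  have edge : ∀ v ∈ Λ.vertexSet, ∃ β ∈ Λ.simplices, {v} ⊆ β ∧ β.card = 2 := fun v hv => by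
    obtain ⟨f, -, hf⟩ := h.thick v hv
    exact ⟨{v, f 0}, (hf 0).2.pair_mem, by simp, Finset.card_pair (hf 0).1.symm⟩
  have := h.card_le_of_mem hα
  interval_cases hc : α.card
  · rw [Finset.card_eq_zero] at hc
    obtain ⟨v, hv⟩ := h.nonempty
    obtain ⟨β, hβ, -, hc'⟩ := edge v hv
    exact ⟨β, hβ, by simp [hc], hc'⟩
  · obtain ⟨u, rfl⟩ := Finset.card_eq_one.1 hc
    exact edge u hα
  · exact ⟨α, hα, subset_rfl, hc⟩

lemma isChamberComplex (h : IsIncidence Λ t i j) (hconn : Λ.skeleton.Preconnected) :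
    Λ.IsChamberComplex 2 := by
  classical
  refine ⟨h.isPure, ?_⟩
  have key : ∀ (u v : Λ.vertexSet), Λ.skeleton.Walk u v → ∀ γ ∈ Λ.chambers 2,
      ∀ γ' ∈ Λ.chambers 2, (u : V) ∈ γ → (v : V) ∈ γ' →
        Relation.ReflTransGen (Λ.GalleryStep 2) γ γ' := by
    intro u v w
    induction w with
    | @nil u =>
      intro γ hγ γ' hγ' hu hv
      exact .single ⟨hγ, hγ', {(u : V)}, by simpa using hu, by simpa using hv, by simp⟩
    | @cons u v w huv p ih =>
      intro γ hγ γ' hγ' hu hw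
      obtain ⟨hne, hj⟩ := huv
      have hδ : {(u : V), (v : V)} ∈ Λ.chambers 2 :=
        ⟨hj.pair_mem, Finset.card_pair fun e => hne (Subtype.ext e)⟩
      refine .head ⟨hγ, hδ, {(u : V)}, by simpa using hu, by simp, by simp⟩ ?_
      exact ih _ hδ _ hγ' (by simp) hw
  intro γ hγ γ' hγ'
  obtain ⟨u, hu⟩ : γ.Nonempty := Finset.card_pos.1 (by rw [hγ.2]; norm_num)
  obtain ⟨v, hv⟩ : γ'.Nonempty := Finset.card_pos.1 (by rw [hγ'.2]; norm_num)
  obtain ⟨w⟩ := hconn ⟨u, mem_vertexSet_of_mem hγ.1 hu⟩ ⟨v, mem_vertexSet_of_mem hγ'.1 hv⟩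
  exact key _ _ w γ hγ γ' hγ' hu hv

lemma isThick (h : IsIncidence Λ t i j) : Λ.IsThick 2 := by
  classical
  intro α hα hc
  obtain ⟨v, rfl⟩ := Finset.card_eq_one.1 (by omega : α.card = 1)
  obtain ⟨f, hf, hf'⟩ := h.thick v hα
  have hinj : Function.Injective fun m => ({v, f m} : Finset V) := fun m m' e => by
    have : f m ∈ ({v, f m'} : Finset V) := by
      rw [← show ({v, f m} : Finset V) = {v, f m'} from e]; simp
    rcases Finset.mem_insert.1 this with h' | h'
    · exact absurd h' (hf' m).1
    · exact hf (Finset.mem_singleton.1 h')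
  calc (3 : ℕ∞) = (Set.range fun m => ({v, f m} : Finset V)).encard := by
        rw [← Set.image_univ, hinj.encard_image, Set.encard_univ]; simp
    _ ≤ _ := Set.encard_le_encard (by
        rintro _ ⟨m, rfl⟩
        exact ⟨⟨(hf' m).2.pair_mem, Finset.card_pair (hf' m).1.symm⟩, by simp⟩)

theorem isGeometry [DecidableEq I] (h : IsIncidence Λ t i j)
    (hconn : Λ.skeleton.Preconnected) : Λ.IsGeometry t {i, j} := by
  have hc : ({i, j} : Finset I).card = 2 := Finset.card_pair h.ne
  refine ⟨?_, ?_, fun v hv => ?_, h.injOn, h.isFlagComplex, fun α hα hmax => ?_⟩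
  · rw [hc]; exact h.isChamberComplex hconn
  · rw [hc]; exact h.isThick
  · simpa using h.type_eq v hv
  · rw [hc]
    have := h.card_le_of_mem hα
    interval_cases hα' : α.card
    · rw [Finset.card_eq_zero] at hα'
      subst hα'
      rw [link_empty]
      exact h.isChamberComplex hconn
    · exact link_isChamberComplex_one (fun β hβ => h.card_le_of_mem hβ) hα (by omega) hmax
    · exact absurd (isMaximalSimplex_of_card (fun β hβ => h.card_le_of_mem hβ) hα hα') hmax

open Classical in
/-- The coloring of the incidence graph by the two types. -/
noncomputable def coloring (h : IsIncidence Λ t i j) : Λ.skeleton.Coloring Bool :=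
  SimpleGraph.Coloring.mk (fun v => decide (t v = i)) fun {u v} huv => by
    have h1 := h.type_ne huv.2 fun e => huv.1 (Subtype.ext e)
    have h2 := h.type_eq u u.2
    have h3 := h.type_eq v v.2
    have := h.ne
    rw [Ne, decide_eq_decide]
    grind

lemma coloring_eq_iff (h : IsIncidence Λ t i j) (u v : Λ.vertexSet) :
    h.coloring u = h.coloring v ↔ t u = t v := by
  have h2 := h.type_eq u u.2
  have h3 := h.type_eq v v.2
  have := h.ne
  classical
  refine (decide_eq_decide (p := t u = i) (q := t v = i)).trans ?_
  grind

lemma adj_iff (h : IsIncidence Λ t i j) (u v : Λ.vertexSet) :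
    Λ.skeleton.Adj u v ↔ t u ≠ t v ∧ Λ.Joined u v :=
  ⟨fun ⟨h1, h2⟩ => ⟨h.type_ne h2 fun e => h1 (Subtype.ext e), h2⟩,
    fun ⟨h1, h2⟩ => ⟨fun e => h1 (by rw [e]), h2⟩⟩

lemma two_neighbors (h : IsIncidence Λ t i j) (u : Λ.vertexSet) :
    ∃ v w, v ≠ w ∧ Λ.skeleton.Adj u v ∧ Λ.skeleton.Adj u w := by
  obtain ⟨f, hf, hf'⟩ := h.thick u u.2
  refine ⟨⟨f 0, (hf' 0).2.symm.left_mem⟩, ⟨f 1, (hf' 1).2.symm.left_mem⟩, fun e => ?_,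
    ⟨fun e => (hf' 0).1 (congrArg Subtype.val e).symm, (hf' 0).2⟩,
    ⟨fun e => (hf' 1).1 (congrArg Subtype.val e).symm, (hf' 1).2⟩⟩
  exact absurd (hf (congrArg Subtype.val e)) (by decide)

lemma isGeneralizedPolygon [DecidableEq I] (h : IsIncidence Λ t i j) {m : ℕ} (hm : 2 ≤ m)
    (hgd : Λ.skeleton.egirth = ((2 * m : ℕ) : ℕ∞) ∧ Λ.skeleton.ediam = (m : ℕ∞)) :
    Λ.IsGeneralizedPolygon t {i, j} m where
  geometry := h.isGeometry
    (SimpleGraph.preconnected_of_ediam_ne_top (by rw [hgd.2]; exact ENat.natCast_ne_top m))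
  rank_two := Finset.card_pair h.ne
  two_le := hm
  girth := hgd.1
  diam := hgd.2

theorem isGeneralizedDigon [DecidableEq I] (h : IsIncidence Λ t i j)
    (complete : ∀ u ∈ Λ.vertexSet, ∀ v ∈ Λ.vertexSet, t u ≠ t v → Λ.Joined u v) :
    Λ.IsGeneralizedPolygon t {i, j} 2 := by
  have := h.nonempty.to_subtype
  refine h.isGeneralizedPolygon le_rfl
    (h.coloring.girth_diam_digon h.two_neighbors fun u v huv => ?_)
  rw [Ne, h.coloring_eq_iff] at huv
  exact (h.adj_iff u v).2 ⟨huv, complete u u.2 v v.2 huv⟩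

theorem isGeneralizedTriangle [DecidableEq I] (h : IsIncidence Λ t i j)
    (join : ∀ u ∈ Λ.vertexSet, ∀ v ∈ Λ.vertexSet, t u = t v → u ≠ v →
      ∃ w, t w ≠ t u ∧ Λ.Joined u w ∧ Λ.Joined w v)
    (uniq : ∀ u v w w', t u = t v → u ≠ v → t w ≠ t u → t w' ≠ t u → Λ.Joined u w →
      Λ.Joined w v → Λ.Joined u w' → Λ.Joined w' v → w = w') :
    Λ.IsGeneralizedPolygon t {i, j} 3 := by
  have := h.nonempty.to_subtype
  refine h.isGeneralizedPolygon (by norm_num)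
    (h.coloring.girth_diam_triangle h.two_neighbors ?_ ?_)
  · intro u v huv hne
    rw [h.coloring_eq_iff] at huv
    obtain ⟨w, h1, h2, h3⟩ := join u u.2 v v.2 huv fun e => hne (Subtype.ext e)
    exact ⟨⟨w, h3.left_mem⟩, (h.adj_iff _ _).2 ⟨h1.symm, h2⟩,
      (h.adj_iff _ _).2 ⟨huv ▸ h1, h3⟩⟩
  · intro u v w w' hne h1 h2 h3 h4
    rw [h.adj_iff] at h1 h2 h3 h4
    refine Subtype.ext (uniq u v w w' ?_ (fun e => hne (Subtype.ext e)) h1.1.symm h3.1.symm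
      h1.2 h2.2 h3.2 h4.2)
    have a1 := h.type_eq u u.2
    have a2 := h.type_eq v v.2
    have a3 := h.type_eq w w.2
    grind

theorem isGeneralizedQuadrangle [DecidableEq I] (h : IsIncidence Λ t i j)
    (proj : ∀ u ∈ Λ.vertexSet, ∀ v ∈ Λ.vertexSet, t u ≠ t v → ¬ Λ.Joined u v →
      ∃ w x, t w = t v ∧ t x = t u ∧ Λ.Joined u w ∧ Λ.Joined w x ∧ Λ.Joined x v)
    (uniq : ∀ u v w x w' x', t u ≠ t v → t w = t v → t x = t u → t w' = t v → t x' = t u →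
      ¬ Λ.Joined u v → Λ.Joined u w → Λ.Joined w x → Λ.Joined x v →
      Λ.Joined u w' → Λ.Joined w' x' → Λ.Joined x' v → w = w')
    (four : ∀ u v w w', t u = t v → u ≠ v → t w ≠ t u → t w' ≠ t u → Λ.Joined u w →
      Λ.Joined w v → Λ.Joined u w' → Λ.Joined w' v → w = w') :
    Λ.IsGeneralizedPolygon t {i, j} 4 := by
  have := h.nonempty.to_subtype
  have two : ∀ u v w : Λ.vertexSet, t u ≠ t v → t v ≠ t w → t u = t w := fun u v w h1 h2 => by
    have a1 := h.type_eq u u.2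
    have a2 := h.type_eq v v.2
    have a3 := h.type_eq w w.2
    grind
  refine h.isGeneralizedPolygon (by norm_num)
    (h.coloring.girth_diam_quadrangle h.two_neighbors ?_ ?_ ?_)
  · intro u v huv hne
    rw [Ne, h.coloring_eq_iff] at huv
    obtain ⟨w, x, hw, hx, h1, h2, h3⟩ := proj u u.2 v v.2 huv fun e =>
      hne ((h.adj_iff _ _).2 ⟨huv, e⟩)
    exact ⟨⟨w, h2.left_mem⟩, ⟨x, h3.left_mem⟩, (h.adj_iff _ _).2 ⟨by simpa [hw] using huv, h1⟩,
      (h.adj_iff _ _).2 ⟨by simpa [hw, hx] using Ne.symm huv, h2⟩,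
      (h.adj_iff _ _).2 ⟨by simpa [hx] using huv, h3⟩⟩
  · intro u v w x w' x' hne h1 h2 h3 h4 h5 h6
    rw [h.adj_iff] at h1 h2 h3 h4 h5 h6
    have e1 := two _ _ _ h1.1 h2.1
    have e2 := two _ _ _ h4.1 h5.1
    have huv : t u ≠ t v := by rw [e1]; exact h3.1
    refine Subtype.ext (uniq u v w x w' x' huv (two _ _ _ h2.1 h3.1) e1.symm
      (two _ _ _ h5.1 h6.1) e2.symm (fun e => hne ((h.adj_iff _ _).2 ⟨huv, e⟩))
      h1.2 h2.2 h3.2 h4.2 h5.2 h6.2)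
  · intro u v w w' hne h1 h2 h3 h4
    rw [h.adj_iff] at h1 h2 h3 h4
    exact Subtype.ext (four u v w w' (two _ _ _ h1.1 h2.1) (fun e => hne (Subtype.ext e))
      h1.1.symm h3.1.symm h1.2 h2.2 h3.2 h4.2)

end IsIncidence

end SComplex

/-! ### Geometries of type `C₃` in which all points and planes are incident -/

namespace SComplex

variable {V : Type*}

/-- The incidence properties of the exceptional geometry: a thick flag complex with points (type `0`),
lines (type `1`) and planes (type `2`), in which every plane is incident with every point. The lines
in a plane form a projective plane with the points, and the lines and planes on a point form a
generalized quadrangle, given by its projections (`proj`, `proj_unique`) and by the fact that distinct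
planes share at most one line (`plane_unique`). Some planes do not share a line (`far`). -/
structure IsFlatC3 (Δ : SComplex V) (t : V → Fin 3) : Prop where
  nonempty : Nonempty V
  vertices : Δ.vertexSet = Set.univ
  injOn : ∀ α ∈ Δ.simplices, Set.InjOn t (α : Set V)
  flag : Δ.IsFlagComplex
  neighbor : ∀ v k, k ≠ t v → ∃ u, t u = k ∧ Δ.Joined v u
  thick : ∀ u v, Δ.Joined u v → t u ≠ t v → ∀ k, k ≠ t u → k ≠ t v →
    ∃ f : Fin 3 → V, Function.Injective f ∧ ∀ m, t (f m) = k ∧ Δ.Joined u (f m) ∧ Δ.Joined v (f m)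
  flat : ∀ p q, t p = 2 → t q = 0 → Δ.Joined p q
  line : ∀ p q q', t p = 2 → t q = 0 → t q' = 0 → q ≠ q' →
    ∃ d, t d = 1 ∧ Δ.Joined p d ∧ Δ.Joined q d ∧ Δ.Joined q' d
  line_unique : ∀ p q q' d d', t p = 2 → t q = 0 → t q' = 0 → t d = 1 → t d' = 1 → q ≠ q' →
    Δ.Joined p d → Δ.Joined p d' → Δ.Joined q d → Δ.Joined q' d → Δ.Joined q d' → Δ.Joined q' d' →
    d = d'
  meet : ∀ p d d', t p = 2 → t d = 1 → t d' = 1 → d ≠ d' → Δ.Joined p d → Δ.Joined p d' →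
    ∃ q, t q = 0 ∧ Δ.Joined q d ∧ Δ.Joined q d'
  proj : ∀ q p d, t q = 0 → t p = 2 → t d = 1 → Δ.Joined q d → ¬ Δ.Joined p d →
    ∃ p' d', t p' = 2 ∧ t d' = 1 ∧ Δ.Joined p' d ∧ Δ.Joined p' d' ∧ Δ.Joined p d' ∧ Δ.Joined q d'
  proj_unique : ∀ q p d p' d' p'' d'', t q = 0 → t p = 2 → t d = 1 → t p' = 2 → t d' = 1 →
    t p'' = 2 → t d'' = 1 → Δ.Joined q d → ¬ Δ.Joined p d →
    Δ.Joined p' d → Δ.Joined p' d' → Δ.Joined p d' → Δ.Joined q d' →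
    Δ.Joined p'' d → Δ.Joined p'' d'' → Δ.Joined p d'' → Δ.Joined q d'' → p' = p'' ∧ d' = d''
  plane_unique : ∀ p p' d d', t p = 2 → t p' = 2 → t d = 1 → t d' = 1 → p ≠ p' →
    Δ.Joined p d → Δ.Joined p d' → Δ.Joined p' d → Δ.Joined p' d' → d = d'
  far : ∃ p p', t p = 2 ∧ t p' = 2 ∧ ∀ d, t d = 1 → Δ.Joined p d → ¬ Δ.Joined p' d

namespace IsFlatC3

variable {Δ : SComplex V} {t : V → Fin 3}

lemma joined_self (h : IsFlatC3 Δ t) (v : V) : Δ.Joined v v :=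
  SComplex.joined_self (h.vertices ▸ Set.mem_univ v)

lemma type_ne (h : IsFlatC3 Δ t) {u v : V} (huv : Δ.Joined u v) (hne : u ≠ v) :
    t u ≠ t v := by
  obtain ⟨α, hα, hu, hv⟩ := huv
  exact fun e => hne (h.injOn α hα hu hv e)

lemma triple_mem (h : IsFlatC3 Δ t) [DecidableEq V] {u v w : V} (h1 : Δ.Joined u v)
    (h2 : Δ.Joined u w) (h3 : Δ.Joined v w) : {u, v, w} ∈ Δ.simplices := by
  refine h.flag _ fun x hx y hy => ?_
  simp only [Finset.mem_insert, Finset.mem_singleton] at hx hy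
  rcases hx with rfl | rfl | rfl <;> rcases hy with rfl | rfl | rfl <;>
    first | exact h.joined_self _ | assumption | (apply Joined.symm; assumption)

lemma card_le (h : IsFlatC3 Δ t) {α : Finset V} (hα : α ∈ Δ.simplices) : α.card ≤ 3 := by
  have := Finset.card_le_card_of_injOn (t := Finset.univ) t (fun _ _ => Finset.mem_univ _)
    (h.injOn α hα)
  simpa using this

lemma exists_insert (h : IsFlatC3 Δ t) [DecidableEq V] {α : Finset V} (hα : α ∈ Δ.simplices)
    (hc : α.card < 3) : ∃ x ∉ α, insert x α ∈ Δ.simplices := by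
  have third : ∀ a b : Fin 3, ∃ k, k ≠ a ∧ k ≠ b := by decide
  interval_cases hc' : α.card
  · obtain ⟨v⟩ := h.nonempty
    rw [Finset.card_eq_zero] at hc'
    subst hc'
    exact ⟨v, by simp, (h.joined_self v).left_mem⟩
  · obtain ⟨v, rfl⟩ := Finset.card_eq_one.1 hc'
    obtain ⟨k, hk, -⟩ := third (t v) (t v)
    obtain ⟨u, hu, huv⟩ := h.neighbor v k hk
    refine ⟨u, ?_, huv.symm.pair_mem⟩
    rw [Finset.mem_singleton]
    rintro rfl
    exact hk hu.symm
  · obtain ⟨u, v, huv, rfl⟩ := Finset.card_eq_two.1 hc'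
    have hj := joined_of_pair_mem hα
    obtain ⟨k, hk, hk'⟩ := third (t u) (t v)
    obtain ⟨f, -, hf⟩ := h.thick u v hj (h.type_ne hj huv) k hk hk'
    obtain ⟨h1, h2, h3⟩ := hf 0
    refine ⟨f 0, ?_, h.triple_mem h2.symm h3.symm hj⟩
    simp only [Finset.mem_insert, Finset.mem_singleton, not_or]
    exact ⟨fun e => hk (by rw [← h1, e]), fun e => hk' (by rw [← h1, e])⟩

lemma exists_chamber (h : IsFlatC3 Δ t) {α : Finset V} (hα : α ∈ Δ.simplices) :
    ∃ β ∈ Δ.simplices, α ⊆ β ∧ β.card = 3 := by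
  classical
  induction hn : 3 - α.card generalizing α with
  | zero => exact ⟨α, hα, subset_rfl, le_antisymm (h.card_le hα) (by omega)⟩
  | succ n ih =>
    obtain ⟨x, hx, hx'⟩ := h.exists_insert hα (by omega)
    obtain ⟨β, hβ, hs, hc⟩ := ih hx' (by rw [Finset.card_insert_of_notMem hx]; omega)
    exact ⟨β, hβ, (Finset.subset_insert x α).trans hs, hc⟩

lemma isPure (h : IsFlatC3 Δ t) : Δ.IsPure 3 :=
  isPure_of_exists_card (fun _ hα => h.card_le hα) fun _ hα => h.exists_chamber hα

lemma exists_type (h : IsFlatC3 Δ t) {γ : Finset V} (hγ : γ ∈ Δ.chambers 3) (k : Fin 3) :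
    ∃ v ∈ γ, t v = k := by
  have hi : γ.image t = Finset.univ := by
    rw [← Finset.card_eq_iff_eq_univ, Finset.card_image_of_injOn (h.injOn γ hγ.1), hγ.2]; rfl
  simpa using (hi ▸ Finset.mem_univ k : k ∈ γ.image t)

lemma mem_link_vertexSet (h : IsFlatC3 Δ t) {v : V} (hv : {v} ∈ Δ.simplices) {u : V} :
    u ∈ (Δ.link {v} hv).vertexSet ↔ t u ≠ t v ∧ Δ.Joined u v := by
  classical
  refine (mem_link (hα := hv)).trans ⟨fun ⟨h1, h2⟩ => ?_, fun ⟨h1, h2⟩ => ⟨?_, h2.symm.pair_mem⟩⟩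
  · have hj := (joined_of_pair_mem h2).symm
    exact ⟨h.type_ne hj (by simpa [eq_comm] using h1), hj⟩
  · rw [Finset.disjoint_singleton]
    rintro rfl
    exact h1 rfl

lemma link_joined_iff (h : IsFlatC3 Δ t) {v : V} (hv : {v} ∈ Δ.simplices) {u w : V}
    (hu : u ∈ (Δ.link {v} hv).vertexSet) (hw : w ∈ (Δ.link {v} hv).vertexSet) :
    (Δ.link {v} hv).Joined u w ↔ Δ.Joined u w := by
  classical
  constructor
  · rintro ⟨β, hβ, h1, h2⟩
    exact ⟨_, (mem_link.1 hβ).2, by simp [h1], by simp [h2]⟩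
  · intro hj
    obtain ⟨h1, h2⟩ := (h.mem_link_vertexSet hv).1 hu
    obtain ⟨h3, h4⟩ := (h.mem_link_vertexSet hv).1 hw
    refine ⟨{u, w}, mem_link.2 ⟨?_, ?_⟩, by simp, by simp⟩
    · simp only [Finset.disjoint_singleton_left, Finset.mem_insert, Finset.mem_singleton, not_or]
      exact ⟨fun e => h1 (e ▸ rfl), fun e => h3 (e ▸ rfl)⟩
    · have := h.triple_mem h2.symm h4.symm hj
      rwa [Finset.insert_eq] at this

lemma isIncidence_link (h : IsFlatC3 Δ t) {v : V} (hv : {v} ∈ Δ.simplices) {i j : Fin 3}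
    (hij : i ≠ j) (hi : i ≠ t v) (hj : j ≠ t v) : (Δ.link {v} hv).IsIncidence t i j where
  ne := hij
  type_eq u hu := by
    have := ((h.mem_link_vertexSet hv).1 hu).1
    revert i j
    generalize t u = a, t v = b at *
    revert a b
    decide
  injOn α hα := by
    classical
    refine (h.injOn _ (mem_link.1 hα).2).mono ?_
    simp
  nonempty := by
    obtain ⟨u, hu, huv⟩ := h.neighbor v i hi
    exact ⟨u, (h.mem_link_vertexSet hv).2 ⟨hu ▸ hi, huv.symm⟩⟩
  thick u hu := by
    have hu' := (h.mem_link_vertexSet hv).1 hu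
    have third : ∀ a b : Fin 3, ∃ k, k ≠ a ∧ k ≠ b := by decide
    obtain ⟨k, hk, hk'⟩ := third (t u) (t v)
    obtain ⟨f, hf, hf'⟩ := h.thick u v hu'.2 hu'.1 k hk hk'
    refine ⟨f, hf, fun m => ⟨fun e => hk (by rw [← (hf' m).1, e]), ?_⟩⟩
    rw [h.link_joined_iff hv hu
      ((h.mem_link_vertexSet hv).2 ⟨(hf' m).1 ▸ hk', (hf' m).2.2.symm⟩)]
    exact (hf' m).2.1

lemma link_line (h : IsFlatC3 Δ t) {v : V} (hv : {v} ∈ Δ.simplices) (ht : t v = 1) :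
    (Δ.link {v} hv).IsGeneralizedPolygon t {0, 2} 2 := by
  have hinc := h.isIncidence_link hv (i := 0) (j := 2) (by decide) (by simp [ht]) (by simp [ht])
  refine hinc.isGeneralizedDigon fun u hu w hw hne => ?_
  rw [h.link_joined_iff hv hu hw]
  rcases hinc.type_eq u hu with h1 | h1 <;> rcases hinc.type_eq w hw with h2 | h2
  · exact absurd (h1.trans h2.symm) hne
  · exact (h.flat w u h2 h1).symm
  · exact h.flat u w h1 h2
  · exact absurd (h1.trans h2.symm) hne

lemma link_plane (h : IsFlatC3 Δ t) {v : V} (hv : {v} ∈ Δ.simplices) (ht : t v = 2) :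
    (Δ.link {v} hv).IsGeneralizedPolygon t {0, 1} 3 := by
  have hinc := h.isIncidence_link hv (i := 0) (j := 1) (by decide) (by simp [ht]) (by simp [ht])
  have mem := fun u => h.mem_link_vertexSet hv (u := u)
  refine hinc.isGeneralizedTriangle ?_ ?_
  · intro u hu w hw huw hne
    rcases hinc.type_eq u hu with h1 | h1
    · obtain ⟨d, hd, h2, h3, h4⟩ := h.line v u w ht h1 (huw ▸ h1) hne
      have hd' := (mem d).2 ⟨by simp [hd, ht], h2.symm⟩
      exact ⟨d, by simp [hd, h1], (h.link_joined_iff hv hu hd').2 h3,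
        (h.link_joined_iff hv hd' hw).2 h4.symm⟩
    · obtain ⟨q, hq, h2, h3⟩ := h.meet v u w ht h1 (huw ▸ h1) hne ((mem u).1 hu).2.symm
        ((mem w).1 hw).2.symm
      have hq' := (mem q).2 ⟨by simp [hq, ht], (h.flat v q ht hq).symm⟩
      exact ⟨q, by simp [hq, h1], (h.link_joined_iff hv hu hq').2 h2.symm,
        (h.link_joined_iff hv hq' hw).2 h3⟩
  · intro u w x y huw hne hx hy h1 h2 h3 h4
    have hu := h1.left_mem
    have hw := h2.symm.left_mem
    have hx' := h2.left_mem
    have hy' := h4.left_mem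
    rw [h.link_joined_iff hv hu hx'] at h1
    rw [h.link_joined_iff hv hx' hw] at h2
    rw [h.link_joined_iff hv hu hy'] at h3
    rw [h.link_joined_iff hv hy' hw] at h4
    rcases hinc.type_eq u hu with e | e
    · have ex : t x = 1 := (hinc.type_eq x hx').resolve_left (e ▸ hx)
      have ey : t y = 1 := (hinc.type_eq y hy').resolve_left (e ▸ hy)
      exact h.line_unique v u w x y ht e (huw ▸ e) ex ey hne ((mem x).1 hx').2.symm
        ((mem y).1 hy').2.symm h1 h2.symm h3 h4.symm
    · have ex : t x = 0 := (hinc.type_eq x hx').resolve_right (e ▸ hx)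
      have ey : t y = 0 := (hinc.type_eq y hy').resolve_right (e ▸ hy)
      by_contra hxy
      exact hne (h.line_unique v x y u w ht ex ey e (huw ▸ e) hxy ((mem u).1 hu).2.symm
        ((mem w).1 hw).2.symm h1.symm h3.symm h2 h4)

lemma link_point (h : IsFlatC3 Δ t) {v : V} (hv : {v} ∈ Δ.simplices) (ht : t v = 0) :
    (Δ.link {v} hv).IsGeneralizedPolygon t {1, 2} 4 := by
  have hinc := h.isIncidence_link hv (i := 1) (j := 2) (by decide) (by simp [ht]) (by simp [ht])
  have mem := fun u => h.mem_link_vertexSet hv (u := u)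
  refine hinc.isGeneralizedQuadrangle ?_ ?_ ?_
  · intro u hu w hw huw hn
    rw [h.link_joined_iff hv hu hw] at hn
    have key : ∀ d p, d ∈ (Δ.link {v} hv).vertexSet → p ∈ (Δ.link {v} hv).vertexSet → t d = 1 →
        t p = 2 → ¬ Δ.Joined p d → ∃ p' d', t p' = 2 ∧ t d' = 1 ∧ (Δ.link {v} hv).Joined d p' ∧
          (Δ.link {v} hv).Joined p' d' ∧ (Δ.link {v} hv).Joined d' p := by
      intro d p hd hp hd1 hp2 hn
      obtain ⟨p', d', e1, e2, h1, h2, h3, h4⟩ :=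
        h.proj v p d ht hp2 hd1 ((mem d).1 hd).2.symm hn
      have hp' := (mem p').2 ⟨by simp [e1, ht], h.flat p' v e1 ht⟩
      have hd' := (mem d').2 ⟨by simp [e2, ht], h4.symm⟩
      exact ⟨p', d', e1, e2, (h.link_joined_iff hv hd hp').2 h1.symm,
        (h.link_joined_iff hv hp' hd').2 h2, (h.link_joined_iff hv hd' hp).2 h3.symm⟩
    rcases hinc.type_eq u hu with e | e
    · have ew : t w = 2 := (hinc.type_eq w hw).resolve_left (e ▸ Ne.symm huw)
      obtain ⟨p', d', e1, e2, h1, h2, h3⟩ := key u w hu hw e ew fun h => hn h.symm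
      exact ⟨p', d', e1.trans ew.symm, e2.trans e.symm, h1, h2, h3⟩
    · have ew : t w = 1 := (hinc.type_eq w hw).resolve_right (e ▸ Ne.symm huw)
      obtain ⟨p', d', e1, e2, h1, h2, h3⟩ := key w u hw hu ew e hn
      exact ⟨d', p', e2.trans ew.symm, e1.trans e.symm, h3.symm, h2.symm, h1.symm⟩
  · intro u w a b a' b' huw ha hb ha' hb' hn h1 h2 h3 h4 h5 h6
    have mu := h1.left_mem
    have mw := h3.symm.left_mem
    have ma := h2.left_mem
    have mb := h3.left_mem
    have ma' := h5.left_mem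
    have mb' := h6.left_mem
    rw [h.link_joined_iff hv mu mw] at hn
    rw [h.link_joined_iff hv mu ma] at h1
    rw [h.link_joined_iff hv ma mb] at h2
    rw [h.link_joined_iff hv mb mw] at h3
    rw [h.link_joined_iff hv mu ma'] at h4
    rw [h.link_joined_iff hv ma' mb'] at h5
    rw [h.link_joined_iff hv mb' mw] at h6
    rcases hinc.type_eq u mu with e | e
    · have ew : t w = 2 := (hinc.type_eq w mw).resolve_left (e ▸ Ne.symm huw)
      rw [ew] at ha ha'
      rw [e] at hb hb'
      exact (h.proj_unique v w u a b a' b' ht ew e ha hb ha' hb' ((mem u).1 mu).2.symm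
        (fun h => hn h.symm) h1.symm h2 h3.symm ((mem b).1 mb).2.symm h4.symm h5 h6.symm
        ((mem b').1 mb').2.symm).1
    · have ew : t w = 1 := (hinc.type_eq w mw).resolve_right (e ▸ Ne.symm huw)
      rw [ew] at ha ha'
      rw [e] at hb hb'
      exact (h.proj_unique v u w b a b' a' ht e ew hb ha hb' ha' ((mem w).1 mw).2.symm hn
        h3 h2.symm h1 ((mem a).1 ma).2.symm h6 h5.symm h4 ((mem a').1 ma').2.symm).2
  · intro u w x y huw hne hx hy h1 h2 h3 h4
    have hu := h1.left_mem
    have hw := h2.symm.left_mem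
    have hx' := h2.left_mem
    have hy' := h4.left_mem
    rw [h.link_joined_iff hv hu hx'] at h1
    rw [h.link_joined_iff hv hx' hw] at h2
    rw [h.link_joined_iff hv hu hy'] at h3
    rw [h.link_joined_iff hv hy' hw] at h4
    rcases hinc.type_eq u hu with e | e
    · have ex : t x = 2 := (hinc.type_eq x hx').resolve_left (e ▸ hx)
      have ey : t y = 2 := (hinc.type_eq y hy').resolve_left (e ▸ hy)
      by_contra hxy
      exact hne (h.plane_unique x y u w ex ey e (huw ▸ e) hxy h1.symm h2 h3.symm h4)
    · have ex : t x = 1 := (hinc.type_eq x hx').resolve_right (e ▸ hx)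
      have ey : t y = 1 := (hinc.type_eq y hy').resolve_right (e ▸ hy)
      exact h.plane_unique u w x y e (huw ▸ e) ex ey hne h1 h3 h2.symm h4.symm

lemma link_isGeneralizedPolygon (h : IsFlatC3 Δ t) {v : V} (hv : {v} ∈ Δ.simplices)
    (i j : Fin 3) (hij : i ≠ j) (hi : i ≠ t v) (hj : j ≠ t v) :
    (Δ.link {v} hv).IsGeneralizedPolygon t {i, j} (CoxeterMatrix.B 3 i j) := by
  generalize hk' : t v = k at hi hj
  fin_cases i <;> fin_cases j <;> fin_cases k <;>
    first | exact (hij rfl).elim | exact (hi rfl).elim | exact (hj rfl).elim | skip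
  · exact h.link_plane hv hk'
  · exact h.link_line hv hk'
  · exact Finset.pair_comm (0 : Fin 3) 1 ▸ h.link_plane hv hk'
  · exact h.link_point hv hk'
  · exact Finset.pair_comm (0 : Fin 3) 2 ▸ h.link_line hv hk'
  · exact Finset.pair_comm (1 : Fin 3) 2 ▸ h.link_point hv hk'

/-- Two chambers with a common vertex are connected by a gallery in the star of this vertex. -/
lemma gallery_of_common_vertex (h : IsFlatC3 Δ t) {γ γ' : Finset V} (hγ : γ ∈ Δ.chambers 3)
    (hγ' : γ' ∈ Δ.chambers 3) {v : V} (hv : v ∈ γ) (hv' : v ∈ γ') :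
    Relation.ReflTransGen (Δ.GalleryStep 3) γ γ' := by
  classical
  have hvs := mem_vertexSet_of_mem hγ.1 hv
  have two : ∀ a : Fin 3, ∃ i j, i ≠ j ∧ i ≠ a ∧ j ≠ a := by decide
  obtain ⟨i, j, hij, hi, hj⟩ := two (t v)
  have hc := (h.link_isGeneralizedPolygon hvs i j hij hi hj).geometry.chamberComplex
  rw [Finset.card_pair hij] at hc
  have mem : ∀ δ ∈ Δ.chambers 3, v ∈ δ → δ.erase v ∈ (Δ.link {v} hvs).chambers 2 := by
    intro δ hδ hvδ
    refine ⟨mem_link.2 ⟨by simp, ?_⟩, by rw [Finset.card_erase_of_mem hvδ, hδ.2]⟩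
    rw [← Finset.insert_eq, Finset.insert_erase hvδ]
    exact hδ.1
  have hlift : ∀ δ ∈ (Δ.link {v} hvs).chambers 2, v ∉ δ ∧ insert v δ ∈ Δ.chambers 3 := by
    intro δ hδ
    obtain ⟨h1, h2⟩ := mem_link.1 hδ.1
    have h1' : v ∉ δ := by simpa using h1
    refine ⟨h1', by rwa [Finset.insert_eq], ?_⟩
    rw [Finset.card_insert_of_notMem h1', hδ.2]
  have hstep : ∀ δ δ', (Δ.link {v} hvs).GalleryStep 2 δ δ' →
      Δ.GalleryStep 3 (insert v δ) (insert v δ') := by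
    rintro δ δ' ⟨h1, h2, α, h3, h4, h5⟩
    refine ⟨(hlift δ h1).2, (hlift δ' h2).2, insert v α, Finset.insert_subset_insert v h3,
      Finset.insert_subset_insert v h4, ?_⟩
    rw [Finset.card_insert_of_notMem fun e => (hlift δ h1).1 (h3 e)]
    omega
  have := (hc.2 _ (mem γ hγ hv) _ (mem γ' hγ' hv')).lift (p := Δ.GalleryStep 3) (insert v) hstep
  rwa [Function.onFun, Finset.insert_erase hv, Finset.insert_erase hv'] at this

lemma isChamberComplex (h : IsFlatC3 Δ t) : Δ.IsChamberComplex 3 := by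
  classical
  refine ⟨h.isPure, fun γ hγ γ' hγ' => ?_⟩
  -- a plane of the first chamber and a point of the second one lie in a third chamber
  obtain ⟨p, hp, hp2⟩ := h.exists_type hγ 2
  obtain ⟨q, hq, hq0⟩ := h.exists_type hγ' 0
  obtain ⟨δ, hδ, hs, hc⟩ := h.exists_chamber (h.flat p q hp2 hq0).pair_mem
  exact (h.gallery_of_common_vertex hγ ⟨hδ, hc⟩ hp (hs (by simp))).trans
    (h.gallery_of_common_vertex ⟨hδ, hc⟩ hγ' (hs (by simp)) hq)

lemma isThick (h : IsFlatC3 Δ t) : Δ.IsThick 3 := by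
  classical
  intro α hα hc
  obtain ⟨u, v, huv, rfl⟩ := Finset.card_eq_two.1 (by omega : α.card = 2)
  have hj := joined_of_pair_mem hα
  have third : ∀ a b : Fin 3, ∃ k, k ≠ a ∧ k ≠ b := by decide
  obtain ⟨k, hk, hk'⟩ := third (t u) (t v)
  obtain ⟨f, hf, hf'⟩ := h.thick u v hj (h.type_ne hj huv) k hk hk'
  have hfu : ∀ m, f m ≠ u := fun m e => hk (by rw [← (hf' m).1, e])
  have hfv : ∀ m, f m ≠ v := fun m e => hk' (by rw [← (hf' m).1, e])
  have hinj : Function.Injective fun m => ({f m, u, v} : Finset V) := fun m m' e => by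
    have : f m ∈ ({f m', u, v} : Finset V) := by
      rw [← show ({f m, u, v} : Finset V) = {f m', u, v} from e]; simp
    simp only [Finset.mem_insert, Finset.mem_singleton, hfu m, hfv m, or_false] at this
    exact hf this
  calc (3 : ℕ∞) = (Set.range fun m => ({f m, u, v} : Finset V)).encard := by
        rw [← Set.image_univ, hinj.encard_image, Set.encard_univ]; simp
    _ ≤ _ := Set.encard_le_encard (by
        rintro _ ⟨m, rfl⟩
        refine ⟨⟨h.triple_mem (hf' m).2.1.symm (hf' m).2.2.symm hj, ?_⟩, by simp⟩
        rw [Finset.card_insert_of_notMem (by simp [hfu m, hfv m]), Finset.card_pair huv])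

theorem isGeometry (h : IsFlatC3 Δ t) : Δ.IsGeometry t Finset.univ where
  chamberComplex := h.isChamberComplex
  thick := h.isThick
  type_mem _ _ := Finset.mem_univ _
  type_injOn := h.injOn
  flag := h.flag
  link_chamberComplex α hα hmax := by
    have := h.card_le hα
    interval_cases hα' : α.card
    · rw [Finset.card_eq_zero] at hα'
      subst hα'
      rw [link_empty]
      exact h.isChamberComplex
    · obtain ⟨v, rfl⟩ := Finset.card_eq_one.1 hα'
      have two : ∀ a : Fin 3, ∃ i j, i ≠ j ∧ i ≠ a ∧ j ≠ a := by decide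
      obtain ⟨i, j, hij, hi, hj⟩ := two (t v)
      have hc := (h.link_isGeneralizedPolygon hα i j hij hi hj).geometry.chamberComplex
      rwa [Finset.card_pair hij] at hc
    · exact link_isChamberComplex_one (fun β hβ => h.card_le hβ) hα (by simp [hα']) hmax
    · exact absurd (isMaximalSimplex_of_card (fun β hβ => h.card_le hβ) hα hα') hmax

theorem isGeometryOfType (h : IsFlatC3 Δ t) : Δ.IsGeometryOfType t (CoxeterMatrix.B 3) where
  vertices := h.vertices
  geometry := h.isGeometry
  links i j hij α hα hαt := by
    have hc : α.card = 1 := by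
      rw [← Finset.card_image_of_injOn (h.injOn α hα), hαt, Finset.card_sdiff_of_subset (by simp),
        Finset.card_pair hij]
      rfl
    obtain ⟨v, rfl⟩ := Finset.card_eq_one.1 hc
    have hv : t v ∈ Finset.univ \ {i, j} := by rw [← hαt]; simp
    simp only [Finset.mem_sdiff, Finset.mem_univ, Finset.mem_insert, Finset.mem_singleton,
      true_and, not_or] at hv
    exact h.link_isGeneralizedPolygon hα i j hij (Ne.symm hv.1) (Ne.symm hv.2)

end IsFlatC3

end SComplex

/-! ### The geometry is not a building -/

namespace SComplex

variable {V : Type*} {Δ : SComplex V}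

lemma isoFixing_mem_iff {A B : SComplex V} {s : Set V} (h : IsoFixing A B s) {σ : Finset V}
    (hσ : (σ : Set V) ⊆ s) (hA : ∀ v ∈ σ, v ∈ A.vertexSet) :
    σ ∈ A.simplices ↔ σ ∈ B.simplices := by
  classical
  obtain ⟨φ, h1, h2⟩ := h
  have := h1 (σ.subtype (· ∈ A.vertexSet))
  have e1 : (σ.subtype (· ∈ A.vertexSet)).map (Function.Embedding.subtype _) = σ :=
    Finset.subtype_map_of_mem hA
  have e2 : ((σ.subtype (· ∈ A.vertexSet)).map φ.toEmbedding).map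
      (Function.Embedding.subtype _) = σ := by
    rw [Finset.map_map]
    conv_rhs => rw [← e1]
    rw [Finset.map_eq_image, Finset.map_eq_image]
    exact Finset.image_congr fun x hx =>
      h2 x (hσ (by simpa using hx))
  rwa [e1, e2] at this

/-- The part of the definition of an apartment system that compares two apartments. -/
def IsApartmentSystem (Δ : SComplex V) (𝒜 : Set (SComplex V)) : Prop :=
  (∀ α ∈ Δ.simplices, ∀ β ∈ Δ.simplices, ∃ A ∈ 𝒜, α ∈ A.simplices ∧ β ∈ A.simplices) ∧
    ∀ A ∈ 𝒜, ∀ B ∈ 𝒜, ∀ α β : Finset V,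
      α ∈ A.simplices → β ∈ A.simplices → α ∈ B.simplices → β ∈ B.simplices →
        IsoFixing A B ((α : Set V) ∪ (β : Set V))

variable {𝒜 : Set (SComplex V)}

/-- A simplex covered by two faces that lie in an apartment lies in this apartment. -/
lemma IsApartmentSystem.mem_of_faces (h𝒜 : Δ.IsApartmentSystem 𝒜) {A : SComplex V} (hA : A ∈ 𝒜)
    {σ α β : Finset V} (hσ : σ ∈ Δ.simplices) (hα : α ∈ A.simplices) (hβ : β ∈ A.simplices)
    (hασ : α ⊆ σ) (hβσ : β ⊆ σ) (hcov : (σ : Set V) ⊆ (α : Set V) ∪ (β : Set V)) :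
    σ ∈ A.simplices := by
  obtain ⟨B, hB, hσB, -⟩ := h𝒜.1 σ hσ σ hσ
  refine (isoFixing_mem_iff (h𝒜.2 A hA B hB α β hα hβ (B.down_closed hασ hσB)
    (B.down_closed hβσ hσB)) hcov fun v hv => ?_).2 hσB
  rcases hcov hv with h | h
  · exact mem_vertexSet_of_mem hα h
  · exact mem_vertexSet_of_mem hβ h

lemma IsApartmentSystem.pair_mem [DecidableEq V] (h𝒜 : Δ.IsApartmentSystem 𝒜) {A : SComplex V}
    (hA : A ∈ 𝒜) {u v : V} (hu : u ∈ A.vertexSet) (hv : v ∈ A.vertexSet) (h : Δ.Joined u v) :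
    {u, v} ∈ A.simplices :=
  h𝒜.mem_of_faces hA h.pair_mem hu hv (by simp) (by simp) (by simp [Set.insert_subset_iff])

lemma IsApartmentSystem.triple_mem [DecidableEq V] {t : V → Fin 3} (h : IsFlatC3 Δ t)
    (h𝒜 : Δ.IsApartmentSystem 𝒜) {A : SComplex V}
    (hA : A ∈ 𝒜) {u v w : V} (hu : u ∈ A.vertexSet) (hv : v ∈ A.vertexSet)
    (hw : w ∈ A.vertexSet) (huv : Δ.Joined u v) (huw : Δ.Joined u w) (hvw : Δ.Joined v w) :
    {u, v, w} ∈ A.simplices :=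
  h𝒜.mem_of_faces hA (h.triple_mem huv huw hvw) (h𝒜.pair_mem hA hu hv huv) hw
    (by intro x; simp; tauto) (by simp) (by intro x; simp; tauto)

/-- Two apartments with common simplices `α` and `β` are compared by a map that fixes the vertices of
`α` and `β` and preserves incidence. -/
lemma IsApartmentSystem.exists_map (h𝒜 : Δ.IsApartmentSystem 𝒜)
    (hsub : ∀ A ∈ 𝒜, A.simplices ⊆ Δ.simplices) {A B : SComplex V} (hA : A ∈ 𝒜) (hB : B ∈ 𝒜)
    {α β : Finset V} (hαA : α ∈ A.simplices) (hβA : β ∈ A.simplices) (hαB : α ∈ B.simplices)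
    (hβB : β ∈ B.simplices) :
    ∃ ψ : V → V, (∀ x ∈ B.vertexSet, ψ x ∈ A.vertexSet) ∧ Set.InjOn ψ B.vertexSet ∧
      (∀ x ∈ α, ψ x = x) ∧ (∀ x ∈ β, ψ x = x) ∧
      ∀ x ∈ B.vertexSet, ∀ y ∈ B.vertexSet, Δ.Joined x y → Δ.Joined (ψ x) (ψ y) := by
  classical
  obtain ⟨φ, h1, h2⟩ := h𝒜.2 B hB A hA α β hαB hβB hαA hβA
  have hψ : ∀ x (hx : x ∈ B.vertexSet),
      (if hx : x ∈ B.vertexSet then (φ ⟨x, hx⟩ : V) else x) = φ ⟨x, hx⟩ := fun x hx => dif_pos hx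
  refine ⟨fun x => if hx : x ∈ B.vertexSet then (φ ⟨x, hx⟩ : V) else x, fun x hx => ?_,
    fun x hx y hy e => ?_, fun x hx => ?_, fun x hx => ?_, fun x hx y hy hj => ?_⟩
  · simp only [hψ x hx]
    exact (φ ⟨x, hx⟩).2
  · simp only [hψ x hx, hψ y hy] at e
    exact congrArg Subtype.val (φ.injective (Subtype.ext e))
  · have hx' := mem_vertexSet_of_mem hαB hx
    simp only [hψ x hx']
    exact h2 ⟨x, hx'⟩ (Or.inl hx)
  · have hx' := mem_vertexSet_of_mem hβB hx
    simp only [hψ x hx']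
    exact h2 ⟨x, hx'⟩ (Or.inr hx)
  · simp only [hψ x hx, hψ y hy]
    have := (h1 {⟨x, hx⟩, ⟨y, hy⟩}).1 (by simpa using h𝒜.pair_mem hB hx hy hj)
    refine joined_of_pair_mem (hsub A hA ?_)
    simpa using this

namespace IsFlatC3

variable {t : V → Fin 3}

/-- Thinness of an apartment, in terms of vertices: a panel of a chamber of the apartment has exactly
one other neighbor in the apartment. -/
lemma exists_other (h : IsFlatC3 Δ t) {A : SComplex V} (hsub : A.simplices ⊆ Δ.simplices)
    (hthin : A.IsThin 3)
    (hfull : ∀ [DecidableEq V] {u v w : V}, u ∈ A.vertexSet → v ∈ A.vertexSet → w ∈ A.vertexSet →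
      Δ.Joined u v → Δ.Joined u w → Δ.Joined v w → {u, v, w} ∈ A.simplices)
    {u v w : V} (hu : u ∈ A.vertexSet) (hv : v ∈ A.vertexSet) (hw : w ∈ A.vertexSet)
    (huv : Δ.Joined u v) (huw : Δ.Joined u w) (hvw : Δ.Joined v w) (nuv : t u ≠ t v)
    (nuw : t w ≠ t u) (nvw : t w ≠ t v) :
    ∃ w' ∈ A.vertexSet, w' ≠ w ∧ t w' = t w ∧ Δ.Joined u w' ∧ Δ.Joined v w' ∧
      ∀ x ∈ A.vertexSet, t x = t w → Δ.Joined u x → Δ.Joined v x → x = w ∨ x = w' := by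
  classical
  have hcard : ∀ x, t x = t w → ({u, v, x} : Finset V).card = 3 := fun x hx => by
    refine Finset.card_eq_three.2 ⟨u, v, x, ?_, ?_, ?_, rfl⟩ <;> rintro rfl
    exacts [nuv rfl, nuw hx.symm, nvw hx.symm]
  have hmem : ∀ x ∈ A.vertexSet, t x = t w → Δ.Joined u x → Δ.Joined v x →
      ({u, v, x} : Finset V) ∈ {γ ∈ A.chambers 3 | {u, v} ⊆ γ} := fun x hx e h1 h2 =>
    ⟨⟨hfull hu hv hx huv h1 h2, hcard x e⟩, by intro y; simp; tauto⟩
  have huvne : u ≠ v := fun e => nuv (e ▸ rfl)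
  have hcard2 : ({u, v} : Finset V).card = 2 := Finset.card_pair huvne
  have htw := hthin {u, v} (A.down_closed (by intro y; simp; tauto)
    (hfull hu hv hw huv huw hvw)) (by rw [hcard2])
  obtain ⟨γ₁, γ₂, hne, hset⟩ := Set.encard_eq_two.1 htw
  have hinj : ∀ x y, t x = t w → ({u, v, x} : Finset V) = {u, v, y} → x = y := fun x y hx e => by
    have : x ∈ ({u, v, y} : Finset V) := e ▸ by simp
    simp only [Finset.mem_insert, Finset.mem_singleton] at this
    rcases this with rfl | rfl | h'
    · exact absurd hx.symm nuw
    · exact absurd hx.symm nvw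
    · exact h'
  -- the second chamber of the apartment on the panel `{u, v}`
  obtain ⟨γ, hγ, hγne, hγall⟩ : ∃ γ ∈ {γ ∈ A.chambers 3 | {u, v} ⊆ γ}, γ ≠ {u, v, w} ∧
      ∀ δ ∈ {γ ∈ A.chambers 3 | {u, v} ⊆ γ}, δ = {u, v, w} ∨ δ = γ := by
    have hm := hmem w hw rfl huw hvw
    rw [hset] at hm ⊢
    rcases hm with e | e
    · exact ⟨γ₂, by simp, by rw [e]; exact hne.symm, fun δ hδ => by rw [e]; exact hδ⟩
    · exact ⟨γ₁, by simp, by rw [e]; exact hne, fun δ hδ => by rw [e]; exact hδ.symm⟩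
  obtain ⟨⟨hγA, hγ3⟩, hγuv⟩ := hγ
  have hc1 : (γ \ {u, v}).card = 1 := by
    rw [Finset.card_sdiff_of_subset hγuv, hγ3, hcard2]
  obtain ⟨w', hw'⟩ := Finset.card_eq_one.1 hc1
  have hw'γ : w' ∈ γ ∧ w' ≠ u ∧ w' ≠ v := by
    have : w' ∈ γ \ {u, v} := hw' ▸ by simp
    simpa using this
  have hγe : γ = {u, v, w'} := by
    rw [← Finset.sdiff_union_of_subset hγuv, hw']
    ext; simp; tauto
  have hj1 : Δ.Joined u w' := ⟨γ, hsub hγA, hγuv (by simp), hw'γ.1⟩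
  have hj2 : Δ.Joined v w' := ⟨γ, hsub hγA, hγuv (by simp), hw'γ.1⟩
  have ht : t w' = t w := by
    have h1 := h.type_ne hj1 hw'γ.2.1.symm
    have h2 := h.type_ne hj2 hw'γ.2.2.symm
    revert nuv nuw nvw h1 h2
    generalize t u = a, t v = b, t w = c, t w' = d
    revert a b c d
    decide
  refine ⟨w', mem_vertexSet_of_mem hγA hw'γ.1, fun e => hγne (by rw [hγe, e]), ht, hj1, hj2,
    fun x hx hxt h1 h2 => ?_⟩
  rcases hγall _ (hmem x hx hxt h1 h2) with e | e
  · exact Or.inl (hinj x w hxt e)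
  · exact Or.inr (hinj x w' hxt (e.trans hγe))

/-- Apartments contain with two points of a plane the line that joins them in this plane. -/
lemma line_mem_apartment (h : IsFlatC3 Δ t) (h𝒜 : Δ.IsApartmentSystem 𝒜)
    (hsub : ∀ A ∈ 𝒜, A.simplices ⊆ Δ.simplices) {A : SComplex V} (hA : A ∈ 𝒜) {p q q' d : V}
    (hp : p ∈ A.vertexSet) (hq : q ∈ A.vertexSet) (hq' : q' ∈ A.vertexSet)
    (tp : t p = 2) (tq : t q = 0) (tq' : t q' = 0) (td : t d = 1) (hne : q ≠ q')
    (hpd : Δ.Joined p d) (hqd : Δ.Joined q d) (hqd' : Δ.Joined q' d) : d ∈ A.vertexSet := by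
  classical
  have hpq := h.flat p q tp tq
  have hpq' := h.flat p q' tp tq'
  obtain ⟨B, hB, h1, h2⟩ := h𝒜.1 _ (h.triple_mem hpq hpd hqd) _ hpq'.pair_mem
  obtain ⟨ψ, hψA, hψi, hψα, hψβ, hψj⟩ := h𝒜.exists_map hsub hA hB (h𝒜.pair_mem hA hp hq hpq)
    (h𝒜.pair_mem hA hp hq' hpq') (B.down_closed (by intro x; simp; tauto) h1) h2
  have bp : p ∈ B.vertexSet := mem_vertexSet_of_mem h1 (by simp)
  have bq : q ∈ B.vertexSet := mem_vertexSet_of_mem h1 (by simp)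
  have bd : d ∈ B.vertexSet := mem_vertexSet_of_mem h1 (by simp)
  have bq' : q' ∈ B.vertexSet := mem_vertexSet_of_mem h2 (by simp)
  have ep : ψ p = p := hψα p (by simp)
  have eq : ψ q = q := hψα q (by simp)
  have eq' : ψ q' = q' := hψβ q' (by simp)
  have jp : Δ.Joined p (ψ d) := ep ▸ hψj p bp d bd hpd
  have jq : Δ.Joined q (ψ d) := eq ▸ hψj q bq d bd hqd
  have jq' : Δ.Joined q' (ψ d) := eq' ▸ hψj q' bq' d bd hqd'
  have n1 : p ≠ ψ d := fun e => by
    have := hψi bp bd (ep.trans e)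
    rw [this, td] at tp
    exact absurd tp (by decide)
  have n2 : q ≠ ψ d := fun e => by
    have := hψi bq bd (eq.trans e)
    rw [this, td] at tq
    exact absurd tq (by decide)
  have tψ : t (ψ d) = 1 := by
    have m1 := h.type_ne jp n1
    have m2 := h.type_ne jq n2
    rw [tp] at m1
    rw [tq] at m2
    revert m1 m2
    generalize t (ψ d) = a
    revert a
    decide
  rw [h.line_unique p q q' d (ψ d) tp tq tq' td tψ hne hpd jp hqd hqd' jq jq']
  exact hψA d bd

/-- Apartments are closed under projections in the generalized quadrangle of a point. -/
lemma proj_mem_apartment (h : IsFlatC3 Δ t) (h𝒜 : Δ.IsApartmentSystem 𝒜)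
    (hsub : ∀ A ∈ 𝒜, A.simplices ⊆ Δ.simplices) {A : SComplex V} (hA : A ∈ 𝒜) {q p d p' d' : V}
    (hq : q ∈ A.vertexSet) (hp : p ∈ A.vertexSet) (hd : d ∈ A.vertexSet)
    (tq : t q = 0) (tp : t p = 2) (td : t d = 1) (tp' : t p' = 2) (td' : t d' = 1)
    (hqd : Δ.Joined q d) (hpd : ¬ Δ.Joined p d) (h1 : Δ.Joined p' d) (h2 : Δ.Joined p' d')
    (h3 : Δ.Joined p d') (h4 : Δ.Joined q d') : p' ∈ A.vertexSet ∧ d' ∈ A.vertexSet := by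
  classical
  have hpq := h.flat p q tp tq
  have hpq' := h.flat p' q tp' tq
  obtain ⟨B, hB, k1, k2⟩ := h𝒜.1 _ (h.triple_mem hpq.symm h4 h3) _ (h.triple_mem hqd hpq'.symm h1.symm)
  obtain ⟨ψ, hψA, hψi, hψα, hψβ, hψj⟩ := h𝒜.exists_map hsub hA hB (h𝒜.pair_mem hA hq hp hpq.symm)
    (h𝒜.pair_mem hA hq hd hqd) (B.down_closed (by intro x; simp; tauto) k1)
    (B.down_closed (by intro x; simp; tauto) k2)
  have bq : q ∈ B.vertexSet := mem_vertexSet_of_mem k1 (by simp)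
  have bp : p ∈ B.vertexSet := mem_vertexSet_of_mem k1 (by simp)
  have bd' : d' ∈ B.vertexSet := mem_vertexSet_of_mem k1 (by simp)
  have bd : d ∈ B.vertexSet := mem_vertexSet_of_mem k2 (by simp)
  have bp' : p' ∈ B.vertexSet := mem_vertexSet_of_mem k2 (by simp)
  have eq : ψ q = q := hψα q (by simp)
  have ep : ψ p = p := hψα p (by simp)
  have ed : ψ d = d := hψβ d (by simp)
  have j1 : Δ.Joined (ψ p') d := ed ▸ hψj p' bp' d bd h1
  have j2 : Δ.Joined (ψ p') (ψ d') := hψj p' bp' d' bd' h2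
  have j3 : Δ.Joined p (ψ d') := ep ▸ hψj p bp d' bd' h3
  have j4 : Δ.Joined q (ψ d') := eq ▸ hψj q bq d' bd' h4
  have j5 : Δ.Joined (ψ p') q := eq ▸ hψj p' bp' q bq hpq'
  have ne : ∀ {x y : V}, x ∈ B.vertexSet → y ∈ B.vertexSet → ψ x = x → t x ≠ t y → x ≠ ψ y :=
    fun bx by' ex hne e => hne (congrArg t (hψi bx by' (ex.trans e)))
  have tψp : t (ψ p') = 2 := by
    have m1 := h.type_ne j1 (ne bd bp' ed (by rw [td, tp']; decide)).symm
    have m2 := h.type_ne j5 (ne bq bp' eq (by rw [tq, tp']; decide)).symm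
    rw [td] at m1
    rw [tq] at m2
    revert m1 m2
    generalize t (ψ p') = a
    revert a
    decide
  have tψd : t (ψ d') = 1 := by
    have m1 := h.type_ne j3 (ne bp bd' ep (by rw [tp, td']; decide))
    have m2 := h.type_ne j4 (ne bq bd' eq (by rw [tq, td']; decide))
    rw [tp] at m1
    rw [tq] at m2
    revert m1 m2
    generalize t (ψ d') = a
    revert a
    decide
  obtain ⟨e1, e2⟩ := h.proj_unique q p d p' d' (ψ p') (ψ d') tq tp td tp' td' tψp tψd hqd hpd
    h1 h2 h3 h4 j1 j2 j3 j4
  exact ⟨e1 ▸ hψA p' bp', e2 ▸ hψA d' bd'⟩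

/-- An apartment that contains two planes without a common line would contain a triangle in one of
these planes and, on a vertex of the triangle, an ordinary quadrangle. The plane of the apartment on the
opposite side of the triangle occupies the same place in the quadrangle as the other plane. -/
theorem not_isBuilding (h : IsFlatC3 Δ t) : ¬ Δ.IsBuilding := by
  classical
  rintro ⟨n, hcc, -, 𝒜, hap, hex, hiso⟩
  obtain ⟨γ, hγ, -⟩ := hcc.1.1 ∅ Δ.empty_mem
  obtain rfl : n = 3 := (hcc.1.2 γ hγ).symm.trans (h.isPure.2 γ hγ)
  have hsub : ∀ A ∈ 𝒜, A.simplices ⊆ Δ.simplices := fun A hA => (hap A hA).1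
  have h𝒜 : Δ.IsApartmentSystem 𝒜 := ⟨hex, hiso⟩
  obtain ⟨p, p', tp, tp', hfar⟩ := h.far
  have hmem : ∀ v, {v} ∈ Δ.simplices := fun v => by
    have : v ∈ Δ.vertexSet := h.vertices ▸ Set.mem_univ v
    exact this
  obtain ⟨A, hA, ap, ap'⟩ := hex {p} (hmem p) {p'} (hmem p')
  obtain ⟨hsA, hcA, htA⟩ := hap A hA
  -- a chamber of the apartment on the first plane
  obtain ⟨γ, hγ, hpγ⟩ := hcA.1.1 {p} ap
  have hγΔ : γ ∈ Δ.chambers 3 := ⟨hsA hγ.prop, hcA.1.2 γ hγ⟩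
  obtain ⟨d₁, hd₁, td₁⟩ := h.exists_type hγΔ 1
  obtain ⟨q, hq, tq⟩ := h.exists_type hγΔ 0
  have hpγ' : p ∈ γ := hpγ (by simp)
  have ad₁ := mem_vertexSet_of_mem hγ.prop hd₁
  have aq := mem_vertexSet_of_mem hγ.prop hq
  have pd₁ : Δ.Joined p d₁ := ⟨γ, hγΔ.1, hpγ', hd₁⟩
  have qd₁ : Δ.Joined q d₁ := ⟨γ, hγΔ.1, hq, hd₁⟩
  have pq : ∀ {x y : V}, t x = 2 → t y = 0 → Δ.Joined x y := h.flat _ _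
  have other := fun {u v w : V} => h.exists_other (u := u) (v := v) (w := w) hsA htA
    (fun hu hv hw h1 h2 h3 => by convert IsApartmentSystem.triple_mem h h𝒜 hA hu hv hw h1 h2 h3)
  obtain ⟨d₂, ad₂, nd₂, td₂, pd₂, qd₂, -⟩ := other ap aq ad₁ (pq tp tq) pd₁ qd₁
    (by rw [tp, tq]; decide) (by rw [td₁, tp]; decide) (by rw [td₁, tq]; decide)
  rw [td₁] at td₂
  obtain ⟨q₂, aq₂, nq₂, tq₂, pq₂, dq₂, -⟩ := other ap ad₁ aq pd₁ (pq tp tq) qd₁.symm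
    (by rw [tp, td₁]; decide) (by rw [tp, tq]; decide) (by rw [td₁, tq]; decide)
  rw [tq] at tq₂
  obtain ⟨q₃, aq₃, nq₃, tq₃, pq₃, dq₃, -⟩ := other ap ad₂ aq pd₂ (pq tp tq) qd₂.symm
    (by rw [tp, td₂]; decide) (by rw [tp, tq]; decide) (by rw [td₂, tq]; decide)
  rw [tq] at tq₃
  have nq₂₃ : q₂ ≠ q₃ := by
    rintro rfl
    exact nd₂ (h.line_unique p q q₂ d₂ d₁ tp tq tq₂ td₂ td₁ nq₂.symm pd₂ pd₁ qd₂ dq₃.symm qd₁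
      dq₂.symm)
  obtain ⟨d₃, td₃, pd₃, qd₃, qd₃'⟩ := h.line p q₂ q₃ tp tq₂ tq₃ nq₂₃
  have ad₃ := h.line_mem_apartment h𝒜 hsub hA ap aq₂ aq₃ tp tq₂ tq₃ td₃ nq₂₃ pd₃ qd₃ qd₃'
  have hqd₃ : ¬ Δ.Joined q d₃ := fun hj => by
    have e := h.line_unique p q q₂ d₃ d₁ tp tq tq₂ td₃ td₁ nq₂.symm pd₃ pd₁ hj qd₃ qd₁ dq₂.symm
    rw [e] at qd₃'
    exact nd₂ (h.line_unique p q q₃ d₂ d₁ tp tq tq₃ td₂ td₁ nq₃.symm pd₂ pd₁ qd₂ dq₃.symm qd₁ qd₃')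
  have hp'd₁ : ¬ Δ.Joined p' d₁ := hfar d₁ td₁ pd₁
  obtain ⟨p₃, ap₃, np₃, tp₃, dp₃, qp₃, -⟩ := other ad₃ aq₂ ap qd₃.symm pd₃.symm
    (pq tp tq₂).symm (by rw [td₃, tq₂]; decide) (by rw [tp, td₃]; decide) (by rw [tp, tq₂]; decide)
  rw [tp] at tp₃
  have hp₃d₁ : ¬ Δ.Joined p₃ d₁ := fun hj => hqd₃ <| by
    rw [← h.plane_unique p p₃ d₁ d₃ tp tp₃ td₁ td₃ np₃.symm pd₁ pd₃ hj dp₃.symm]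
    exact qd₁
  -- both `p'` and `p₃` are opposite to `p` in the quadrangle on `q`
  obtain ⟨p₁, ap₁, np₁, tp₁, dp₁, qp₁, hp₁⟩ := other ad₁ aq ap qd₁.symm pd₁.symm (pq tp tq).symm
    (by rw [td₁, tq]; decide) (by rw [tp, td₁]; decide) (by rw [tp, tq]; decide)
  rw [tp] at tp₁
  have opp : ∀ x ∈ A.vertexSet, t x = 2 → ¬ Δ.Joined x d₁ →
      (∀ d, t d = 1 → Δ.Joined p d → Δ.Joined q d → ¬ Δ.Joined x d) →
      ∃ d ∈ A.vertexSet, t d = 1 ∧ Δ.Joined p₁ d ∧ Δ.Joined x d ∧ Δ.Joined q d := by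
    intro x ax tx hx hxd
    obtain ⟨y, d, ty, td, yd₁, yd, xd, qd⟩ := h.proj q x d₁ tq tx td₁ qd₁ hx
    obtain ⟨ay, ad⟩ := h.proj_mem_apartment h𝒜 hsub hA aq ax ad₁ tq tx td₁ ty td qd₁ hx yd₁ yd xd qd
    rcases hp₁ y ay (by rw [ty, tp]) yd₁.symm (pq ty tq).symm with rfl | rfl
    · exact absurd xd (hxd d td yd qd)
    · exact ⟨d, ad, td, yd, xd, qd⟩
  obtain ⟨d₄, ad₄, td₄, p₁d₄, p'd₄, qd₄⟩ := opp p' ap' tp' hp'd₁ fun d td pd _ => hfar d td pd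
  obtain ⟨d₅, ad₅, td₅, p₁d₅, p₃d₅, qd₅⟩ := opp p₃ ap₃ tp₃ hp₃d₁ fun d td pd qd hj => hqd₃ <| by
    rw [← h.plane_unique p p₃ d d₃ tp tp₃ td td₃ np₃.symm pd pd₃ hj dp₃.symm]
    exact qd
  obtain ⟨d₆, -, -, -, -, -, hd₆⟩ := other ap₁ aq ad₁ (pq tp₁ tq) dp₁.symm qd₁
    (by rw [tp₁, tq]; decide) (by rw [td₁, tp₁]; decide) (by rw [td₁, tq]; decide)
  have e4 : d₄ = d₆ := (hd₆ d₄ ad₄ (by rw [td₄, td₁]) p₁d₄ qd₄).resolve_left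
    fun e => hp'd₁ (e ▸ p'd₄)
  have e5 : d₅ = d₆ := (hd₆ d₅ ad₅ (by rw [td₅, td₁]) p₁d₅ qd₅).resolve_left
    fun e => hp₃d₁ (e ▸ p₃d₅)
  rw [e5, ← e4] at p₃d₅
  obtain ⟨p₆, -, -, -, -, -, hp₆⟩ := other ad₄ aq ap₁ qd₄.symm p₁d₄.symm (pq tp₁ tq).symm
    (by rw [td₄, tq]; decide) (by rw [tp₁, td₄]; decide) (by rw [tp₁, tq]; decide)
  have e' : p' = p₆ := (hp₆ p' ap' (by rw [tp', tp₁]) p'd₄.symm (pq tp' tq).symm).resolve_left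
    fun e => hp'd₁ (e ▸ dp₁.symm)
  have e₃ : p₃ = p₆ := (hp₆ p₃ ap₃ (by rw [tp₃, tp₁]) p₃d₅.symm (pq tp₃ tq).symm).resolve_left
    fun e => hp₃d₁ (e ▸ dp₁.symm)
  exact hfar d₃ td₃ pd₃ (e'.trans e₃.symm ▸ dp₃.symm)

end IsFlatC3

end SComplex

/-! ### Linear algebra in `SU(3)` -/

open Matrix

namespace SU3

lemma conjTranspose_mul_self (A : SU3) : A.1ᴴ * A.1 = 1 :=
  mem_unitaryGroup_iff'.1 (mem_specialUnitaryGroup_iff.1 A.2).1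

lemma mul_conjTranspose_self (A : SU3) : A.1 * A.1ᴴ = 1 :=
  mem_unitaryGroup_iff.1 (mem_specialUnitaryGroup_iff.1 A.2).1

lemma det_eq_one (A : SU3) : A.1.det = 1 := (mem_specialUnitaryGroup_iff.1 A.2).2

@[simp] lemma coe_inv (A : SU3) : (A⁻¹).1 = A.1ᴴ := rfl

/-- A matrix with orthonormal columns and determinant one. -/
def ofUnitary (M : Matrix (Fin 3) (Fin 3) ℂ) (h : Mᴴ * M = 1) (hd : M.det = 1) : SU3 :=
  ⟨M, mem_specialUnitaryGroup_iff.2 ⟨mem_unitaryGroup_iff'.2 h, hd⟩⟩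

/-- The transpose of an element of `SU(3)`. -/
def transpose (A : SU3) : SU3 :=
  ofUnitary A.1ᵀ (by
    rw [← transpose_one, ← A.mul_conjTranspose_self, transpose_mul]; rfl)
    (by rw [det_transpose, A.det_eq_one])

/-- The entrywise complex conjugate of an element of `SU(3)`. -/
def conj (A : SU3) : SU3 := (A⁻¹).transpose

lemma conj_mul_transpose (A : SU3) : A.1ᴴᵀ * A.1ᵀ = 1 := by
  rw [← transpose_mul, A.mul_conjTranspose_self, transpose_one]

lemma transpose_mul_conj (A : SU3) : A.1ᵀ * A.1ᴴᵀ = 1 := by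
  rw [← transpose_mul, A.conjTranspose_mul_self, transpose_one]

/-- The columns of an element of `SU(3)`. -/
abbrev colv (A : SU3) (j : Fin 3) : Fin 3 → ℂ := fun i => A.1 i j

lemma star_colv_dotProduct (A : SU3) (i j : Fin 3) :
    star (A.colv i) ⬝ᵥ A.colv j = if i = j then 1 else 0 := by
  have := congrFun (congrFun A.conjTranspose_mul_self i) j
  rwa [Matrix.one_apply] at this

lemma adjugate_eq (A : SU3) : A.1.adjugate = A.1ᴴ := by
  calc A.1.adjugate = A.1.adjugate * (A.1 * A.1ᴴ) := by rw [A.mul_conjTranspose_self, mul_one]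
    _ = A.1ᴴ := by rw [← mul_assoc, adjugate_mul, A.det_eq_one, one_smul, one_mul]

/-- The last column of an element of `SU(3)` is determined by the others. -/
lemma ext_of_colv {A B : SU3} (h0 : A.colv 0 = B.colv 0) (h1 : A.colv 1 = B.colv 1) : A = B := by
  have hA := A.adjugate_eq
  have hB := B.adjugate_eq
  rw [adjugate_fin_three] at hA hB
  have e0 : ∀ i, A.1 i 0 = B.1 i 0 := congrFun h0
  have e1 : ∀ i, A.1 i 1 = B.1 i 1 := congrFun h1
  refine Subtype.ext (Matrix.ext fun i j => ?_)
  fin_cases j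
  · exact e0 i
  · exact e1 i
  · apply star_injective
    change A.1ᴴ 2 i = B.1ᴴ 2 i
    rw [← hA, ← hB]
    fin_cases i <;> simp [e0, e1]

lemma exists_colv_zero_one {u v : Fin 3 → ℂ} (hu : star u ⬝ᵥ u = 1) (hv : star v ⬝ᵥ v = 1)
    (huv : star u ⬝ᵥ v = 0) : ∃ A : SU3, A.colv 0 = u ∧ A.colv 1 = v := by
  have hvu : star v ⬝ᵥ u = 0 := by
    rw [← star_eq_zero, ← star_dotProduct_star, star_star, huv]
  simp only [dotProduct, Fin.sum_univ_three, Pi.star_apply, RCLike.star_def] at hu hv huv hvu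
  have hdet : (u 1 * v 2 - u 2 * v 1) * star (u 1 * v 2 - u 2 * v 1) +
      (u 2 * v 0 - u 0 * v 2) * star (u 2 * v 0 - u 0 * v 2) +
      (u 0 * v 1 - u 1 * v 0) * star (u 0 * v 1 - u 1 * v 0) = 1 := by
    simp only [RCLike.star_def, map_sub, map_mul]
    linear_combination (starRingEnd ℂ (v 0) * v 0 + starRingEnd ℂ (v 1) * v 1 +
      starRingEnd ℂ (v 2) * v 2) * hu + hv - (starRingEnd ℂ (v 0) * u 0 +
      starRingEnd ℂ (v 1) * u 1 + starRingEnd ℂ (v 2) * u 2) * huv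
  refine ⟨ofUnitary !![u 0, v 0, star (u 1 * v 2 - u 2 * v 1); u 1, v 1,
    star (u 2 * v 0 - u 0 * v 2); u 2, v 2, star (u 0 * v 1 - u 1 * v 0)] ?_ ?_, ?_, ?_⟩
  · ext i j
    rw [mul_apply, Fin.sum_univ_three]
    simp only [conjTranspose_apply]
    fin_cases i <;> fin_cases j <;> simp
    exacts [hu, huv, by ring, hvu, hv, by ring, by ring, by ring,
      by simpa only [RCLike.star_def, map_sub, map_mul] using hdet]
  · rw [det_fin_three]
    simp
    simp only [RCLike.star_def, map_sub, map_mul] at hdet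
    linear_combination hdet
  · ext i; fin_cases i <;> rfl
  · ext i; fin_cases i <;> rfl

lemma exists_colv_zero_two {u v : Fin 3 → ℂ} (hu : star u ⬝ᵥ u = 1) (hv : star v ⬝ᵥ v = 1)
    (huv : star u ⬝ᵥ v = 0) : ∃ A : SU3, A.colv 0 = u ∧ A.colv 2 = v := by
  obtain ⟨A, h0, h1⟩ := exists_colv_zero_one hu hv huv
  -- a cyclic exchange of the last two columns, with a sign
  let S : SU3 := ofUnitary !![1, 0, 0; 0, 0, 1; 0, -1, 0]
    (by ext i j; fin_cases i <;> fin_cases j <;> simp [mul_apply, Fin.sum_univ_three])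
    (by simp [det_fin_three])
  refine ⟨A * S, ?_, ?_⟩
  · rw [← h0]; ext i; simp [colv, S, ofUnitary, mul_apply, Fin.sum_univ_three]
  · rw [← h1]; ext i; simp [colv, S, ofUnitary, mul_apply, Fin.sum_univ_three]

lemma star_dotProduct_self_eq (v : Fin 3 → ℂ) :
    star v ⬝ᵥ v = ((∑ i, ‖v i‖ ^ 2 : ℝ) : ℂ) := by
  simp only [dotProduct, Pi.star_apply, RCLike.star_def, Complex.ofReal_sum]
  refine Finset.sum_congr rfl fun i _ => ?_
  rw [mul_comm, Complex.mul_conj, Complex.normSq_eq_norm_sq]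

lemma exists_smul_unit {v : Fin 3 → ℂ} (hv : v ≠ 0) :
    ∃ r : ℂ, r ≠ 0 ∧ star (r • v) ⬝ᵥ (r • v) = 1 := by
  have hpos : 0 < ∑ i, ‖v i‖ ^ 2 := by
    obtain ⟨k, hk⟩ := Function.ne_iff.1 hv
    refine Finset.sum_pos' (fun i _ => by positivity) ⟨k, Finset.mem_univ _, ?_⟩
    have : 0 < ‖v k‖ := norm_pos_iff.2 hk
    positivity
  set s := ∑ i, ‖v i‖ ^ 2
  refine ⟨((Real.sqrt s)⁻¹ : ℝ), ?_, ?_⟩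
  · exact_mod_cast inv_ne_zero (Real.sqrt_ne_zero'.2 hpos)
  · rw [star_smul, smul_dotProduct, dotProduct_smul, star_dotProduct_self_eq, RCLike.star_def,
      Complex.conj_ofReal, smul_eq_mul, smul_eq_mul]
    norm_cast
    change (√s)⁻¹ * ((√s)⁻¹ * s) = 1
    rw [← mul_assoc, ← mul_inv, Real.mul_self_sqrt hpos.le, inv_mul_cancel₀ hpos.ne']

/-- Any two vectors in `ℂ³` have a common unit normal vector. -/
lemma exists_unit_orthogonal (u v : Fin 3 → ℂ) :
    ∃ n : Fin 3 → ℂ, star n ⬝ᵥ n = 1 ∧ star u ⬝ᵥ n = 0 ∧ star v ⬝ᵥ n = 0 := by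
  obtain ⟨n, hn, h⟩ := exists_mulVec_eq_zero_iff.2
    (show (Matrix.of ![star u, star v, 0]).det = 0 by simp [det_fin_three])
  obtain ⟨r, hr, hu⟩ := exists_smul_unit hn
  refine ⟨r • n, hu, ?_, ?_⟩
  · rw [dotProduct_smul, show star u ⬝ᵥ n = 0 from congrFun h 0, smul_zero]
  · rw [dotProduct_smul, show star v ⬝ᵥ n = 0 from congrFun h 1, smul_zero]

lemma exists_colv_zero {u : Fin 3 → ℂ} (hu : star u ⬝ᵥ u = 1) : ∃ A : SU3, A.colv 0 = u := by
  obtain ⟨n, hn, h, -⟩ := exists_unit_orthogonal u u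
  obtain ⟨A, hA, -⟩ := exists_colv_zero_one hu hn h
  exact ⟨A, hA⟩

/-- The projectors of parallel unit vectors agree. -/
lemma mul_star_eq_of_parallel {u v : Fin 3 → ℂ} (hu : star u ⬝ᵥ u = 1) (hv : star v ⬝ᵥ v = 1)
    (h : ∀ i j, u i * v j = u j * v i) (i j : Fin 3) :
    u i * star (u j) = v i * star (v j) := by
  have h' : ∀ i j, star (u i) * star (v j) = star (u j) * star (v i) := fun i j => by
    rw [← star_mul', ← star_mul', h]
  simp only [dotProduct, Fin.sum_univ_three, Pi.star_apply] at hu hv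
  linear_combination (-(u i * star (u j))) * hv + v i * star (v j) * hu +
    star (u j) * star (v 0) * h i 0 + u 0 * v i * h' j 0 +
    star (u j) * star (v 1) * h i 1 + u 1 * v i * h' j 1 +
    star (u j) * star (v 2) * h i 2 + u 2 * v i * h' j 2

/-- In `ℂ³`, if two vectors are orthogonal to two others, then one of the two pairs is parallel. -/
lemma parallel_or_parallel {u v x y : Fin 3 → ℂ} (h1 : star x ⬝ᵥ u = 0) (h2 : star x ⬝ᵥ v = 0)
    (h3 : star y ⬝ᵥ u = 0) (h4 : star y ⬝ᵥ v = 0) :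
    (∀ i j, u i * v j = u j * v i) ∨ ∀ i j, x i * y j = x j * y i := by
  by_cases hn : u ⨯₃ v = 0
  · left
    have n0 := congrFun hn 0
    have n1 := congrFun hn 1
    have n2 := congrFun hn 2
    simp [cross_apply] at n0 n1 n2
    intro i j
    fin_cases i <;> fin_cases j <;> simp <;>
      first
      | ring1
      | linear_combination n0
      | linear_combination n1
      | linear_combination n2
      | linear_combination -n0
      | linear_combination -n1
      | linear_combination -n2
  · right
    have key : ∀ x : Fin 3 → ℂ, star x ⬝ᵥ u = 0 → star x ⬝ᵥ v = 0 → ∀ i j,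
        star (x i) * (u ⨯₃ v) j = star (x j) * (u ⨯₃ v) i := by
      intro x hu hv i j
      simp only [dotProduct, Fin.sum_univ_three, Pi.star_apply] at hu hv
      fin_cases i <;> fin_cases j <;> simp [cross_apply] at hu hv ⊢ <;>
        first
        | ring1
        | linear_combination u 0 * hv - v 0 * hu
        | linear_combination u 1 * hv - v 1 * hu
        | linear_combination u 2 * hv - v 2 * hu
        | linear_combination v 0 * hu - u 0 * hv
        | linear_combination v 1 * hu - u 1 * hv
        | linear_combination v 2 * hu - u 2 * hv
    obtain ⟨k, hk⟩ := Function.ne_iff.1 hn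
    intro i j
    apply star_injective
    rw [star_mul', star_mul']
    apply mul_right_cancel₀ (mul_ne_zero hk hk)
    have a1 := key x h1 h2 i k
    have a2 := key x h1 h2 j k
    have b1 := key y h3 h4 i k
    have b2 := key y h3 h4 j k
    simp only [Pi.zero_apply] at hk
    linear_combination (star (y j) * (u ⨯₃ v) k) * a1 + star (x k) * (u ⨯₃ v) i * b2 -
      star (y i) * (u ⨯₃ v) k * a2 - star (x k) * (u ⨯₃ v) j * b1

lemma star_dotProduct_comm_eq_zero {u v : Fin 3 → ℂ} (h : star u ⬝ᵥ v = 0) :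
    star v ⬝ᵥ u = 0 := by
  rw [← star_eq_zero, ← star_dotProduct_star, star_star, h]

lemma exists_colv_two {u : Fin 3 → ℂ} (hu : star u ⬝ᵥ u = 1) : ∃ A : SU3, A.colv 2 = u := by
  obtain ⟨n, hn, h, -⟩ := exists_unit_orthogonal u u
  obtain ⟨A, -, hA⟩ := exists_colv_zero_two hn hu (star_dotProduct_comm_eq_zero h)
  exact ⟨A, hA⟩

/-- A real rotation in the last two coordinates. -/
def rotLast (c s : ℝ) (h : c ^ 2 + s ^ 2 = 1) : SU3 :=
  ofUnitary !![1, 0, 0; 0, (c : ℂ), -s; 0, s, c]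
    (by
      have h' : (c : ℂ) ^ 2 + (s : ℂ) ^ 2 = 1 := by exact_mod_cast h
      ext i j
      fin_cases i <;> fin_cases j <;> simp [mul_apply, Fin.sum_univ_three]
      · linear_combination h'
      · ring
      · ring
      · linear_combination h')
    (by
      have h' : (c : ℂ) ^ 2 + (s : ℂ) ^ 2 = 1 := by exact_mod_cast h
      simp only [det_fin_three, of_apply, cons_val]
      linear_combination h')

/-- A real rotation in the first two coordinates. -/
def rotFirst (c s : ℝ) (h : c ^ 2 + s ^ 2 = 1) : SU3 :=
  ofUnitary !![(c : ℂ), -s, 0; s, c, 0; 0, 0, 1]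
    (by
      have h' : (c : ℂ) ^ 2 + (s : ℂ) ^ 2 = 1 := by exact_mod_cast h
      ext i j
      fin_cases i <;> fin_cases j <;> simp [mul_apply, Fin.sum_univ_three]
      · linear_combination h'
      · ring
      · ring
      · linear_combination h')
    (by
      have h' : (c : ℂ) ^ 2 + (s : ℂ) ^ 2 = 1 := by exact_mod_cast h
      simp only [det_fin_three, of_apply, cons_val]
      linear_combination h')

end SU3

/-! ### Vertices and incidence in terms of matrices -/

namespace ExceptionalC3

/-- The vertex of type `i` of the chamber that is the translate of the base chamber by `g`. -/
def vtx (i : Fin 3) (g : SU3 × SU3) : Σ i, G ⧸ stab i := ⟨i, ((g : G) : G ⧸ stab i)⟩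

lemma exists_vtx (v : Σ i, G ⧸ stab i) : ∃ g, v = vtx (vertexType v) g := by
  obtain ⟨i, x⟩ := v
  obtain ⟨y, rfl⟩ := QuotientGroup.mk_surjective x
  obtain ⟨g, rfl⟩ := QuotientGroup.mk_surjective y
  exact ⟨g, rfl⟩

lemma Z_le (i : Fin 3) : Z ≤ K i := inf_le_right.trans (iInf_le _ i)

lemma mk_mem_stab_iff (i : Fin 3) (g : SU3 × SU3) : (g : G) ∈ stab i ↔ g ∈ K i := by
  constructor
  · rintro ⟨k, hk, h⟩
    have := QuotientGroup.eq.1 h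
    have h2 := (K i).mul_mem hk (Z_le i this)
    rwa [mul_inv_cancel_left] at h2
  · exact fun h => ⟨g, h, rfl⟩

lemma vtx_eq_iff {i : Fin 3} {g g' : SU3 × SU3} : vtx i g = vtx i g' ↔ g⁻¹ * g' ∈ K i := by
  rw [← mk_mem_stab_iff, QuotientGroup.mk_mul, QuotientGroup.mk_inv, ← QuotientGroup.eq]
  simp [vtx]

lemma vtx_mul_eq_iff {i : Fin 3} {k g g' : SU3 × SU3} :
    vtx i (k * g) = vtx i (k * g') ↔ vtx i g = vtx i g' := by
  rw [vtx_eq_iff, vtx_eq_iff]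
  simp [mul_assoc]

/-- The projection of `ℂ³` onto a coordinate axis. -/
def proj (k : Fin 3) : Matrix (Fin 3) (Fin 3) ℂ := diagonal (Pi.single k 1)

/-- The three matrices that describe the vertices: `w w*`, `a bᵀ` and `A Bᵀ`, where `a`, `b` are the
first columns of `A`, `B` and `w` is the last column of `B`. -/
def inv (i : Fin 3) (g : SU3 × SU3) : Matrix (Fin 3) (Fin 3) ℂ :=
  match i with
  | 0 => g.2.1 * proj 2 * g.2.1ᴴ
  | 1 => g.1.1 * proj 0 * g.2.1ᵀ
  | 2 => g.1.1 * g.2.1ᵀ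

lemma sandwich_transpose (A A' B B' : SU3) (E : Matrix (Fin 3) (Fin 3) ℂ) :
    A.1 * E * B.1ᵀ = A'.1 * E * B'.1ᵀ ↔ (A⁻¹ * A').1 * E * (B⁻¹ * B').1ᵀ = E := by
  have e : (A⁻¹ * A').1 * E * (B⁻¹ * B').1ᵀ = A.1ᴴ * (A'.1 * E * B'.1ᵀ) * B.1ᴴᵀ := by
    change A.1ᴴ * A'.1 * E * (B.1ᴴ * B'.1)ᵀ = _
    rw [transpose_mul]
    simp only [mul_assoc]
  rw [e]
  constructor
  · intro h
    rw [← h]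
    calc _ = (A.1ᴴ * A.1) * E * (B.1ᵀ * B.1ᴴᵀ) := by simp only [mul_assoc]
      _ = E := by rw [A.conjTranspose_mul_self, B.transpose_mul_conj, one_mul, mul_one]
  · intro h
    calc _ = A.1 * (A.1ᴴ * (A'.1 * E * B'.1ᵀ) * B.1ᴴᵀ) * B.1ᵀ := by rw [h]
      _ = (A.1 * A.1ᴴ) * (A'.1 * E * B'.1ᵀ) * (B.1ᴴᵀ * B.1ᵀ) := by simp only [mul_assoc]
      _ = _ := by rw [A.mul_conjTranspose_self, B.conj_mul_transpose, one_mul, mul_one]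

lemma sandwich_conjTranspose (B B' : SU3) (E : Matrix (Fin 3) (Fin 3) ℂ) :
    B.1 * E * B.1ᴴ = B'.1 * E * B'.1ᴴ ↔ (B⁻¹ * B').1 * E = E * (B⁻¹ * B').1 := by
  change _ ↔ B.1ᴴ * B'.1 * E = E * (B.1ᴴ * B'.1)
  constructor
  · intro h
    calc _ = B.1ᴴ * (B'.1 * E * B'.1ᴴ) * B'.1 := by
          simp only [mul_assoc, B'.conjTranspose_mul_self, mul_one]
      _ = (B.1ᴴ * B.1) * E * (B.1ᴴ * B'.1) := by rw [← h]; simp only [mul_assoc]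
      _ = _ := by rw [B.conjTranspose_mul_self, one_mul]
  · intro h
    calc _ = B.1 * (E * (B.1ᴴ * B'.1)) * B'.1ᴴ := by
          simp only [mul_assoc, B'.mul_conjTranspose_self, mul_one]
      _ = (B.1 * B.1ᴴ) * B'.1 * E * B'.1ᴴ := by rw [← h]; simp only [mul_assoc]
      _ = _ := by rw [B.mul_conjTranspose_self, one_mul]

lemma mem_Kq_iff (u : SU3 × SU3) : u ∈ Kq ↔ u.2.1 * proj 2 = proj 2 * u.2.1 := by
  have e : ∀ i j, (u.2.1 * proj 2) i j = u.2.1 i j * (Pi.single 2 1 : Fin 3 → ℂ) j :=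
    fun i j => mul_diagonal _ _ _ _
  have e' : ∀ i j, (proj 2 * u.2.1) i j = (Pi.single 2 1 : Fin 3 → ℂ) i * u.2.1 i j :=
    fun i j => diagonal_mul _ _ _ _
  constructor
  · rintro ⟨h1, h2, h3, h4⟩
    ext i j
    rw [e, e']
    fin_cases i <;> fin_cases j <;> simp [h1, h2, h3, h4]
  · intro h
    have h' := fun i j => congrFun (congrFun h i) j
    simp only [e, e'] at h'
    exact ⟨by simpa using h' 0 2, by simpa using h' 1 2, by simpa using (h' 2 0).symm,
      by simpa using (h' 2 1).symm⟩

lemma mem_Kd_iff (u : SU3 × SU3) : u ∈ Kd ↔ u.1.1 * proj 0 * u.2.1ᵀ = proj 0 := by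
  have e1 : u.1.1 * proj 0 * u.2.1ᵀ = proj 0 ↔ u.1.1 * proj 0 = proj 0 * u.2.1ᴴᵀ := by
    constructor
    · intro h
      calc _ = u.1.1 * proj 0 * u.2.1ᵀ * u.2.1ᴴᵀ := by
            rw [mul_assoc _ u.2.1ᵀ, u.2.transpose_mul_conj, mul_one]
        _ = _ := by rw [h]
    · intro h
      rw [h, mul_assoc, u.2.conj_mul_transpose, mul_one]
  have e2 : u.1.1 * proj 0 * u.2.1ᵀ = proj 0 → proj 0 * u.2.1ᵀ = u.1.1ᴴ * proj 0 := by
    intro h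
    rw [← h, ← mul_assoc, ← mul_assoc, u.1.conjTranspose_mul_self, one_mul, h]
  have r : ∀ (M : Matrix (Fin 3) (Fin 3) ℂ) i j,
      (M * proj 0) i j = M i j * (Pi.single 0 1 : Fin 3 → ℂ) j := fun M i j => mul_diagonal _ _ _ _
  have l : ∀ (M : Matrix (Fin 3) (Fin 3) ℂ) i j,
      (proj 0 * M) i j = (Pi.single 0 1 : Fin 3 → ℂ) i * M i j := fun M i j => diagonal_mul _ _ _ _
  constructor
  · rintro ⟨⟨h1, h2, h3, h4⟩, ⟨h5, h6, h7, h8⟩, h9⟩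
    rw [e1]
    ext i j
    rw [l, r, transpose_apply, conjTranspose_apply]
    fin_cases i <;> fin_cases j <;> simp [h3, h4, h5, h6, h9]
  · intro h
    have h1 := fun i j => congrFun (congrFun (e1.1 h) i) j
    have h2 := fun i j => congrFun (congrFun (e2 h) i) j
    simp only [l, r, transpose_apply, conjTranspose_apply] at h1 h2
    refine ⟨⟨?_, ?_, by simpa using h1 1 0, by simpa using h1 2 0⟩, ⟨?_, ?_, by simpa using h2 0 1,
      by simpa using h2 0 2⟩, by simpa using h1 0 0⟩
    · simpa using (h2 1 0).symm
    · simpa using (h2 2 0).symm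
    · simpa using (h1 0 1).symm
    · simpa using (h1 0 2).symm

lemma mem_Kp_iff (u : SU3 × SU3) : u ∈ Kp ↔ u.1.1 * u.2.1ᵀ = 1 := by
  have e : u ∈ Kp ↔ u.1.1 = u.2.1ᴴᵀ := ⟨fun h => Matrix.ext h, fun h i j => by rw [h]; rfl⟩
  rw [e]
  constructor
  · intro h
    rw [h, u.2.conj_mul_transpose]
  · intro h
    calc u.1.1 = u.1.1 * (u.2.1ᵀ * u.2.1ᴴᵀ) := by rw [u.2.transpose_mul_conj, mul_one]
      _ = _ := by rw [← mul_assoc, h, one_mul]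

lemma vtx_eq_vtx_iff {i : Fin 3} {g g' : SU3 × SU3} : vtx i g = vtx i g' ↔ inv i g = inv i g' := by
  rw [vtx_eq_iff]
  fin_cases i
  · exact (mem_Kq_iff _).trans (sandwich_conjTranspose g.2 g'.2 (proj 2)).symm
  · exact (mem_Kd_iff _).trans (sandwich_transpose g.1 g'.1 g.2 g'.2 (proj 0)).symm
  · have := sandwich_transpose g.1 g'.1 g.2 g'.2 1
    rw [mul_one, mul_one, mul_one] at this
    exact (mem_Kp_iff _).trans this.symm

lemma mem_simplices_iff {s : Finset (Σ i, G ⧸ stab i)} :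
    s ∈ Delta.simplices ↔ ∃ g, ∀ v ∈ s, v = vtx (vertexType v) g := by
  constructor
  · rintro ⟨x, hx⟩
    obtain ⟨g, rfl⟩ := QuotientGroup.mk_surjective x
    refine ⟨g, fun v hv => ?_⟩
    obtain ⟨i, y⟩ := v
    have : ((g : G) : G ⧸ stab i) = y := Set.mem_iInter₂.1 hx ⟨i, y⟩ hv
    rw [← this]
    rfl
  · rintro ⟨g, hg⟩
    refine ⟨(g : G), Set.mem_iInter₂.2 fun v hv => ?_⟩
    have h := hg v hv
    obtain ⟨i, y⟩ := v
    exact (eq_of_heq (Sigma.mk.inj h).2).symm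

lemma joined_iff {u v : Σ i, G ⧸ stab i} :
    Delta.Joined u v ↔ ∃ g, u = vtx (vertexType u) g ∧ v = vtx (vertexType v) g := by
  classical
  constructor
  · rintro ⟨α, hα, hu, hv⟩
    obtain ⟨g, hg⟩ := mem_simplices_iff.1 hα
    exact ⟨g, hg u hu, hg v hv⟩
  · rintro ⟨g, hu, hv⟩
    refine ⟨{u, v}, mem_simplices_iff.2 ⟨g, fun w hw => ?_⟩, by simp, by simp⟩
    rcases Finset.mem_insert.1 hw with rfl | hw
    · exact hu
    · rw [Finset.mem_singleton.1 hw]; exact hv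

lemma joined_vtx_iff {i j : Fin 3} {g g' : SU3 × SU3} :
    Delta.Joined (vtx i g) (vtx j g') ↔ ∃ h, vtx i g = vtx i h ∧ vtx j g' = vtx j h := joined_iff

lemma joined_vtx (i j : Fin 3) (g : SU3 × SU3) : Delta.Joined (vtx i g) (vtx j g) :=
  joined_vtx_iff.2 ⟨g, rfl, rfl⟩

lemma joined_mul_iff {i j : Fin 3} {k g g' : SU3 × SU3} :
    Delta.Joined (vtx i (k * g)) (vtx j (k * g')) ↔ Delta.Joined (vtx i g) (vtx j g') := by
  rw [joined_vtx_iff, joined_vtx_iff]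
  constructor
  · rintro ⟨h, h1, h2⟩
    refine ⟨k⁻¹ * h, ?_, ?_⟩
    · rwa [← vtx_mul_eq_iff (k := k), mul_inv_cancel_left]
    · rwa [← vtx_mul_eq_iff (k := k), mul_inv_cancel_left]
  · rintro ⟨h, h1, h2⟩
    exact ⟨k * h, vtx_mul_eq_iff.2 h1, vtx_mul_eq_iff.2 h2⟩

lemma vtx_eq_of_joined {i : Fin 3} {g g' : SU3 × SU3} (h : Delta.Joined (vtx i g) (vtx i g')) :
    vtx i g = vtx i g' := by
  obtain ⟨k, h1, h2⟩ := joined_vtx_iff.1 h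
  rw [h1, h2]

/-- Two chambers whose second components agree have the same point. -/
lemma vtx_zero_eq {g g' : SU3 × SU3} (h : g.2.colv 2 = g'.2.colv 2) : vtx 0 g = vtx 0 g' := by
  have e : ∀ B : SU3, B.1 * proj 2 * B.1ᴴ = vecMulVec (B.colv 2) (star (B.colv 2)) := fun B => by
    ext i j
    simp [mul_apply, Fin.sum_univ_three, proj, vecMulVec_apply, SU3.colv]
  rw [vtx_eq_vtx_iff]
  change g.2.1 * proj 2 * g.2.1ᴴ = g'.2.1 * proj 2 * g'.2.1ᴴ
  rw [e, e, h]

lemma inv_zero_apply (g : SU3 × SU3) (i j : Fin 3) :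
    inv 0 g i j = g.2.1 i 2 * star (g.2.1 j 2) := by
  simp [inv, mul_apply, Fin.sum_univ_three, proj]

lemma inv_one_apply (g : SU3 × SU3) (i j : Fin 3) :
    inv 1 g i j = g.1.1 i 0 * g.2.1 j 0 := by
  simp [inv, mul_apply, Fin.sum_univ_three, proj]

/-- A plane and a line are incident if and only if `A Bᵀ b̄ = a`. -/
lemma joined_two_one_iff {g g' : SU3 × SU3} :
    Delta.Joined (vtx 2 g) (vtx 1 g') ↔ inv 2 g *ᵥ star (g'.2.colv 0) = g'.1.colv 0 := by
  have star_col : ∀ B : SU3, B.1ᵀ *ᵥ star (B.colv 0) = Pi.single 0 1 := fun B => by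
    ext i
    have := B.star_colv_dotProduct 0 i
    rw [dotProduct_comm] at this
    refine this.trans ?_
    simp [Pi.single_apply, eq_comm]
  have col : ∀ A : SU3, A.1 *ᵥ Pi.single 0 1 = A.colv 0 := fun A => by
    ext i; simp
  constructor
  · intro h
    obtain ⟨k, h1, h2⟩ := joined_vtx_iff.1 h
    rw [vtx_eq_vtx_iff] at h1 h2
    -- the two descriptions `a bᵀ` of the line differ by a scalar
    have e : ∀ i j, g'.1.1 i 0 * g'.2.1 j 0 = k.1.1 i 0 * k.2.1 j 0 := fun i j => by
      rw [← inv_one_apply, ← inv_one_apply, h2]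
    have hk : inv 2 g *ᵥ star (k.2.colv 0) = k.1.colv 0 := by
      rw [h1]
      change (k.1.1 * k.2.1ᵀ) *ᵥ _ = _
      rw [← mulVec_mulVec, star_col, col]
    have n1 := k.2.star_colv_dotProduct 0 0
    have n2 := g'.2.star_colv_dotProduct 0 0
    have n3 := g'.1.star_colv_dotProduct 0 0
    have n4 := k.1.star_colv_dotProduct 0 0
    simp only [if_true, dotProduct, Fin.sum_univ_three, Pi.star_apply] at n1 n2 n3 n4
    set c : ℂ := ∑ i, star (g'.1.1 i 0) * k.1.1 i 0 with hc
    simp only [Fin.sum_univ_three] at hc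
    have hb : ∀ j, g'.2.1 j 0 = c * k.2.1 j 0 := fun j => by
      rw [hc]
      linear_combination (-g'.2.1 j 0) * n3 + star (g'.1.1 0 0) * e 0 j +
        star (g'.1.1 1 0) * e 1 j + star (g'.1.1 2 0) * e 2 j
    have ha : ∀ i, g'.1.1 i 0 = star c * k.1.1 i 0 := fun i => by
      have hb' : ∀ j, star (g'.2.1 j 0) = star c * star (k.2.1 j 0) := fun j => by
        rw [hb, star_mul']
      linear_combination (-g'.1.1 i 0) * n2 + star (g'.2.1 0 0) * e i 0 + star (g'.2.1 1 0) * e i 1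
        + star (g'.2.1 2 0) * e i 2 + k.1.1 i 0 * (k.2.1 0 0 * hb' 0 + k.2.1 1 0 * hb' 1 +
        k.2.1 2 0 * hb' 2) + k.1.1 i 0 * star c * n1
    have hs : star (g'.2.colv 0) = star c • star (k.2.colv 0) := by
      ext j; simp [SU3.colv, hb j]
    rw [hs, mulVec_smul, hk]
    ext i
    exact (ha i).symm
  · intro h
    let P : SU3 := g.1 * g.2.transpose
    refine joined_vtx_iff.2 ⟨(P * g'.2.conj, g'.2), vtx_eq_vtx_iff.2 ?_, vtx_eq_vtx_iff.2 ?_⟩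
    · change g.1.1 * g.2.1ᵀ = (g.1.1 * g.2.1ᵀ) * g'.2.1ᴴᵀ * g'.2.1ᵀ
      rw [mul_assoc _ g'.2.1ᴴᵀ, g'.2.conj_mul_transpose, mul_one]
    · ext i j
      rw [inv_one_apply, inv_one_apply]
      have := congrFun h i
      change g'.1.1 i 0 * _ = (P.1 * g'.2.1ᴴᵀ) i 0 * _
      rw [← show _ = g'.1.1 i 0 from this]
      rfl

/-- A point and a line are incident if and only if `w` is orthogonal to `b`. -/
lemma joined_zero_one_iff {g g' : SU3 × SU3} :
    Delta.Joined (vtx 0 g) (vtx 1 g') ↔ star (g.2.colv 2) ⬝ᵥ g'.2.colv 0 = 0 := by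
  constructor
  · intro h
    obtain ⟨k, h1, h2⟩ := joined_vtx_iff.1 h
    rw [vtx_eq_vtx_iff] at h1 h2
    have e1 : ∀ i j, g.2.1 i 2 * star (g.2.1 j 2) = k.2.1 i 2 * star (k.2.1 j 2) := fun i j => by
      rw [← inv_zero_apply, ← inv_zero_apply, h1]
    have e2 : ∀ i j, g'.1.1 i 0 * g'.2.1 j 0 = k.1.1 i 0 * k.2.1 j 0 := fun i j => by
      rw [← inv_one_apply, ← inv_one_apply, h2]
    have n0 := k.2.star_colv_dotProduct 2 0
    have n2 := g.2.star_colv_dotProduct 2 2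
    have n3 := g'.1.star_colv_dotProduct 0 0
    simp only [if_true, dotProduct, Fin.sum_univ_three, Pi.star_apply, Fin.reduceEq,
      if_false] at n0 n2 n3 ⊢
    have e3 : ∀ i, g'.1.1 i 0 * (star (g.2.1 0 2) * g'.2.1 0 0 + star (g.2.1 1 2) * g'.2.1 1 0 +
        star (g.2.1 2 2) * g'.2.1 2 0) = 0 := fun i => by
      have e4 : ∀ l, g.2.1 l 2 * (g'.1.1 i 0 * (star (g.2.1 0 2) * g'.2.1 0 0 +
          star (g.2.1 1 2) * g'.2.1 1 0 + star (g.2.1 2 2) * g'.2.1 2 0)) = 0 := fun l => by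
        linear_combination g'.1.1 i 0 * (g'.2.1 0 0 * e1 l 0 + g'.2.1 1 0 * e1 l 1 +
          g'.2.1 2 0 * e1 l 2) + k.2.1 l 2 * (star (k.2.1 0 2) * e2 i 0 +
          star (k.2.1 1 2) * e2 i 1 + star (k.2.1 2 2) * e2 i 2) + k.2.1 l 2 * k.1.1 i 0 * n0
      linear_combination star (g.2.1 0 2) * e4 0 + star (g.2.1 1 2) * e4 1 +
        star (g.2.1 2 2) * e4 2 - (g'.1.1 i 0 * (star (g.2.1 0 2) * g'.2.1 0 0 +
          star (g.2.1 1 2) * g'.2.1 1 0 + star (g.2.1 2 2) * g'.2.1 2 0)) * n2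
    linear_combination star (g'.1.1 0 0) * e3 0 + star (g'.1.1 1 0) * e3 1 +
        star (g'.1.1 2 0) * e3 2 - (star (g.2.1 0 2) * g'.2.1 0 0 +
          star (g.2.1 1 2) * g'.2.1 1 0 + star (g.2.1 2 2) * g'.2.1 2 0) * n3
  · intro h
    have h' : star (g'.2.colv 0) ⬝ᵥ g.2.colv 2 = 0 := by
      rw [← star_eq_zero, ← star_dotProduct_star, star_star, h]
    obtain ⟨B, hB0, hB2⟩ := SU3.exists_colv_zero_two
      (by simpa using g'.2.star_colv_dotProduct 0 0)
      (by simpa using g.2.star_colv_dotProduct 2 2) h'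
    refine joined_vtx_iff.2 ⟨(g'.1, B), vtx_zero_eq hB2.symm, vtx_eq_vtx_iff.2 ?_⟩
    ext i j
    rw [inv_one_apply, inv_one_apply]
    rw [show g'.2.1 j 0 = B.1 j 0 from (congrFun hB0 j).symm]

end ExceptionalC3

/-! ### The incidence axioms for the exceptional geometry -/

namespace ExceptionalC3

lemma exists_vtx_of_type {v : Σ i, G ⧸ stab i} {i : Fin 3} (h : vertexType v = i) :
    ∃ g, v = vtx i g := h ▸ exists_vtx v

/-- Planes are parametrized by `SU(3)`. -/
lemma inv_two_mem (g : SU3 × SU3) : ∃ P : SU3, P.1 = inv 2 g := ⟨g.1 * g.2.transpose, rfl⟩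

lemma vtx_one_eq {g g' : SU3 × SU3} (h1 : g.1.colv 0 = g'.1.colv 0)
    (h2 : g.2.colv 0 = g'.2.colv 0) : vtx 1 g = vtx 1 g' := by
  rw [vtx_eq_vtx_iff]
  ext i j
  rw [inv_one_apply, inv_one_apply]
  rw [show g.1.1 i 0 = g'.1.1 i 0 from congrFun h1 i,
    show g.2.1 j 0 = g'.2.1 j 0 from congrFun h2 j]

/-- An incident pair of a point and a line, together with any plane, can be moved to the base point, the
base plane, and a line whose second vector is the first basis vector. -/
lemma exists_base {q d : SU3 × SU3} (p : SU3 × SU3) (h : Delta.Joined (vtx 0 q) (vtx 1 d)) :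
    ∃ g₀ : SU3 × SU3, ∃ A : SU3, vtx 2 p = vtx 2 g₀ ∧ vtx 0 q = vtx 0 g₀ ∧
      vtx 1 d = vtx 1 (g₀ * (A, 1)) := by
  obtain ⟨k, h1, h2⟩ := joined_vtx_iff.1 h
  let P : SU3 := p.1 * p.2.transpose
  let g₀ : SU3 × SU3 := (P * k.2.conj, k.2)
  refine ⟨g₀, (P * k.2.conj)⁻¹ * k.1, vtx_eq_vtx_iff.2 ?_, ?_, ?_⟩
  · change p.1.1 * p.2.1ᵀ = (p.1.1 * p.2.1ᵀ) * k.2.1ᴴᵀ * k.2.1ᵀ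
    rw [mul_assoc _ k.2.1ᴴᵀ, k.2.conj_mul_transpose, mul_one]
  · rw [h1]
    exact vtx_zero_eq rfl
  · rw [h2]
    congr 1
    ext1
    · exact (mul_inv_cancel_left _ _).symm
    · exact (mul_one _).symm

lemma joined_flat (p q : SU3 × SU3) : Delta.Joined (vtx 2 p) (vtx 0 q) := by
  obtain ⟨g₀, A, h1, h2, -⟩ := exists_base p (joined_vtx 0 1 q)
  rw [h1, h2]
  exact joined_vtx 2 0 g₀

lemma inv_two_plane (P : SU3) : inv 2 (P, 1) = P.1 := by
  change P.1 * (1 : Matrix (Fin 3) (Fin 3) ℂ)ᵀ = P.1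
  rw [transpose_one, mul_one]

lemma joined_base_plane_iff {d : SU3 × SU3} :
    Delta.Joined (vtx 2 1) (vtx 1 d) ↔ star (d.2.colv 0) = d.1.colv 0 := by
  rw [joined_two_one_iff]
  have : inv 2 1 = 1 := inv_two_plane 1
  rw [this, one_mulVec]

lemma joined_base_point_iff {d : SU3 × SU3} :
    Delta.Joined (vtx 0 1) (vtx 1 d) ↔ d.2.1 2 0 = 0 := by
  rw [joined_zero_one_iff]
  simp [dotProduct, Fin.sum_univ_three, SU3.colv]

lemma joined_plane_line_iff {g : SU3 × SU3} {A : SU3} :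
    Delta.Joined (vtx 2 g) (vtx 1 (A, 1)) ↔ ∀ i, inv 2 g i 0 = A.1 i 0 := by
  rw [joined_two_one_iff, funext_iff]
  refine forall_congr' fun i => ?_
  simp [mulVec, dotProduct, Fin.sum_univ_three, SU3.colv]

/-- A line of the base plane is determined by its second vector up to a scalar. -/
lemma vtx_one_eq_of_parallel {d d' : SU3 × SU3} (h : Delta.Joined (vtx 2 1) (vtx 1 d))
    (h' : Delta.Joined (vtx 2 1) (vtx 1 d'))
    (hp : ∀ i j, d.2.1 i 0 * d'.2.1 j 0 = d.2.1 j 0 * d'.2.1 i 0) : vtx 1 d = vtx 1 d' := by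
  rw [joined_base_plane_iff] at h h'
  rw [vtx_eq_vtx_iff]
  ext i j
  rw [inv_one_apply, inv_one_apply, ← show star (d.2.1 i 0) = d.1.1 i 0 from congrFun h i,
    ← show star (d'.2.1 i 0) = d'.1.1 i 0 from congrFun h' i, mul_comm, mul_comm (star _)]
  exact SU3.mul_star_eq_of_parallel (u := d.2.colv 0) (v := d'.2.colv 0)
    (by simpa using d.2.star_colv_dotProduct 0 0) (by simpa using d'.2.star_colv_dotProduct 0 0)
    hp j i

/-- A plane through the line given by `a` and the first basis vector whose point row contains a line of
the base plane through the base point: the defining equations. -/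
lemma proj_equations {d' p' : SU3 × SU3} {A : SU3} (h1 : Delta.Joined (vtx 2 p') (vtx 1 (A, 1)))
    (h2 : Delta.Joined (vtx 2 p') (vtx 1 d')) (h3 : Delta.Joined (vtx 2 1) (vtx 1 d'))
    (h4 : Delta.Joined (vtx 0 1) (vtx 1 d')) :
    (1 - A.1 0 0) * d'.2.1 0 0 = A.1 1 0 * d'.2.1 1 0 ∧
      ∀ i, inv 2 p' i 1 * star (d'.2.1 1 0) =
        star (d'.2.1 i 0) - A.1 i 0 * star (d'.2.1 0 0) := by
  rw [joined_base_point_iff] at h4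
  rw [joined_base_plane_iff] at h3
  rw [joined_two_one_iff, ← h3] at h2
  rw [joined_plane_line_iff] at h1
  obtain ⟨P, hP⟩ := inv_two_mem p'
  rw [← hP] at h1 h2 ⊢
  have h5 : ∀ i, P.1 i 1 * star (d'.2.1 1 0) =
      star (d'.2.1 i 0) - A.1 i 0 * star (d'.2.1 0 0) := fun i => by
    have := congrFun h2 i
    simp only [mulVec, dotProduct, Fin.sum_univ_three, Pi.star_apply, SU3.colv, h4, star_zero,
      mul_zero, add_zero, h1 i] at this
    linear_combination this
  refine ⟨?_, h5⟩
  have n0 := P.star_colv_dotProduct 0 0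
  have n1 := P.star_colv_dotProduct 0 1
  simp only [if_true, dotProduct, Fin.sum_univ_three, Pi.star_apply, Fin.reduceEq, SU3.colv,
    if_false, h1] at n0 n1
  apply star_injective
  have e0 := h5 0
  have e1 := h5 1
  have e2 := h5 2
  rw [h4, star_zero] at e2
  simp only [star_mul', star_sub, star_one]
  linear_combination star (A.1 0 0) * e0 + star (A.1 1 0) * e1 + star (A.1 2 0) * e2 -
    star (d'.2.1 1 0) * n1 - star (d'.2.1 0 0) * n0

lemma colv_zero_eq_of_apply_eq_one {A : SU3} (h : A.1 0 0 = 1) : A.1 1 0 = 0 ∧ A.1 2 0 = 0 := by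
  have n := A.star_colv_dotProduct 0 0
  rw [if_pos rfl, SU3.star_dotProduct_self_eq, Fin.sum_univ_three] at n
  have n' : ‖A.1 0 0‖ ^ 2 + ‖A.1 1 0‖ ^ 2 + ‖A.1 2 0‖ ^ 2 = 1 := by exact_mod_cast n
  rw [h, norm_one] at n'
  have h1 : ‖A.1 1 0‖ = 0 := by nlinarith [norm_nonneg (A.1 1 0), norm_nonneg (A.1 2 0)]
  have h2 : ‖A.1 2 0‖ = 0 := by nlinarith [norm_nonneg (A.1 1 0), norm_nonneg (A.1 2 0)]
  exact ⟨norm_eq_zero.1 h1, norm_eq_zero.1 h2⟩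

lemma one_sub_ne_zero_of_not_joined {A : SU3}
    (h : ¬ Delta.Joined (vtx 2 1) (vtx 1 (A, 1))) : 1 - A.1 0 0 ≠ 0 := by
  intro h0
  have h0' : A.1 0 0 = 1 := (sub_eq_zero.1 h0).symm
  obtain ⟨h1, h2⟩ := colv_zero_eq_of_apply_eq_one h0'
  refine h (joined_plane_line_iff.2 fun i => ?_)
  rw [show inv 2 1 = 1 from inv_two_plane 1]
  fin_cases i
  · exact (one_apply_eq 0).trans h0'.symm
  · exact (one_apply_ne (by decide)).trans h1.symm
  · exact (one_apply_ne (by decide)).trans h2.symm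

lemma base_second_ne_zero {A : SU3} {d' : SU3 × SU3} (hA : 1 - A.1 0 0 ≠ 0)
    (h : (1 - A.1 0 0) * d'.2.1 0 0 = A.1 1 0 * d'.2.1 1 0)
    (h4 : Delta.Joined (vtx 0 1) (vtx 1 d')) : d'.2.1 1 0 ≠ 0 := by
  intro h1
  rw [joined_base_point_iff] at h4
  rw [h1, mul_zero] at h
  have h0 := (mul_eq_zero.1 h).resolve_left hA
  have n := d'.2.star_colv_dotProduct 0 0
  simp [dotProduct, Fin.sum_univ_three, SU3.colv, h0, h1, h4] at n

lemma vtx_two_eq_of_colv {p p' : SU3 × SU3} (h0 : ∀ i, inv 2 p i 0 = inv 2 p' i 0)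
    (h1 : ∀ i, inv 2 p i 1 = inv 2 p' i 1) : vtx 2 p = vtx 2 p' := by
  rw [vtx_eq_vtx_iff]
  exact congrArg Subtype.val (SU3.ext_of_colv (A := p.1 * p.2.transpose)
    (B := p'.1 * p'.2.transpose) (funext h0) (funext h1))

lemma proj_unique_base {A : SU3} {d' d'' p' p'' : SU3 × SU3}
    (hn : ¬ Delta.Joined (vtx 2 1) (vtx 1 (A, 1)))
    (h1 : Delta.Joined (vtx 2 p') (vtx 1 (A, 1)))
    (h2 : Delta.Joined (vtx 2 p') (vtx 1 d')) (h3 : Delta.Joined (vtx 2 1) (vtx 1 d'))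
    (h4 : Delta.Joined (vtx 0 1) (vtx 1 d'))
    (k1 : Delta.Joined (vtx 2 p'') (vtx 1 (A, 1)))
    (k2 : Delta.Joined (vtx 2 p'') (vtx 1 d'')) (k3 : Delta.Joined (vtx 2 1) (vtx 1 d''))
    (k4 : Delta.Joined (vtx 0 1) (vtx 1 d'')) : vtx 2 p' = vtx 2 p'' ∧ vtx 1 d' = vtx 1 d'' := by
  have hA := one_sub_ne_zero_of_not_joined hn
  obtain ⟨e1, e2⟩ := proj_equations h1 h2 h3 h4
  obtain ⟨f1, f2⟩ := proj_equations k1 k2 k3 k4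
  have hy := base_second_ne_zero hA e1 h4
  have hy' := base_second_ne_zero hA f1 k4
  have hpar : d'.2.1 0 0 * d''.2.1 1 0 = d'.2.1 1 0 * d''.2.1 0 0 := by
    apply mul_left_cancel₀ hA
    linear_combination d''.2.1 1 0 * e1 - d'.2.1 1 0 * f1
  have g4 := joined_base_point_iff.1 h4
  have g4' := joined_base_point_iff.1 k4
  have hpar' : ∀ i j, d'.2.1 i 0 * d''.2.1 j 0 = d'.2.1 j 0 * d''.2.1 i 0 := by
    intro i j
    fin_cases i <;> fin_cases j <;> simp [g4, g4', hpar]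
  refine ⟨vtx_two_eq_of_colv (fun i => ?_) fun i => ?_, vtx_one_eq_of_parallel h3 k3 hpar'⟩
  · rw [joined_plane_line_iff.1 h1, joined_plane_line_iff.1 k1]
  · apply mul_right_cancel₀ (mul_ne_zero (star_ne_zero.2 hy) (star_ne_zero.2 hy'))
    have s : ∀ i, star (d'.2.1 i 0) * star (d''.2.1 1 0) =
        star (d'.2.1 1 0) * star (d''.2.1 i 0) := fun i => by
      rw [← star_mul', ← star_mul', hpar']
    linear_combination star (d''.2.1 1 0) * e2 i - star (d'.2.1 1 0) * f2 i + s i -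
      A.1 i 0 * s 0

lemma exists_proj_base {A : SU3} (hn : ¬ Delta.Joined (vtx 2 1) (vtx 1 (A, 1))) :
    ∃ p' d' : SU3 × SU3, Delta.Joined (vtx 2 p') (vtx 1 (A, 1)) ∧
      Delta.Joined (vtx 2 p') (vtx 1 d') ∧ Delta.Joined (vtx 2 1) (vtx 1 d') ∧
      Delta.Joined (vtx 0 1) (vtx 1 d') := by
  have hA := one_sub_ne_zero_of_not_joined hn
  have hne : (![A.1 1 0, 1 - A.1 0 0, 0] : Fin 3 → ℂ) ≠ 0 := fun h => hA (congrFun h 1)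
  obtain ⟨r, hr, hu⟩ := SU3.exists_smul_unit hne
  set b : Fin 3 → ℂ := r • ![A.1 1 0, 1 - A.1 0 0, 0] with hb
  have b0 : b 0 = r * A.1 1 0 := by simp [hb]
  have b1 : b 1 = r * (1 - A.1 0 0) := by simp [hb]
  have b2 : b 2 = 0 := by simp [hb]
  have hb1 : star (b 1) ≠ 0 := star_ne_zero.2 (b1 ▸ mul_ne_zero hr hA)
  obtain ⟨B, hB⟩ := SU3.exists_colv_zero hu
  have hB' : ∀ i, B.1 i 0 = b i := congrFun hB
  -- the second column of the plane maps `b̄` to itself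
  let c : Fin 3 → ℂ := fun i => (star (b i) - A.1 i 0 * star (b 0)) / star (b 1)
  have n := A.star_colv_dotProduct 0 0
  simp only [if_true, dotProduct, Fin.sum_univ_three, Pi.star_apply, SU3.colv] at n hu
  have hac : star (A.colv 0) ⬝ᵥ c = 0 := by
    simp only [dotProduct, Fin.sum_univ_three, Pi.star_apply, SU3.colv, c]
    field_simp
    rw [b2, star_zero]
    simp only [b0, b1, star_mul', star_sub, star_one] at *
    linear_combination (-star r * star (A.1 1 0)) * n
  have hcc : star c ⬝ᵥ c = 1 := by
    have hb1' : b 1 ≠ 0 := fun h => hb1 (by rw [h, star_zero])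
    simp only [dotProduct, Fin.sum_univ_three, Pi.star_apply, c, star_div₀, star_sub,
      star_mul', star_star]
    have k : b 0 * A.1 0 0 + b 1 * A.1 1 0 = b 0 := by rw [b0, b1]; ring
    have k' := congrArg star k
    simp only [star_add, star_mul'] at k'
    rw [b2, star_zero]
    field_simp
    linear_combination (-star (b 0)) * k - b 0 * k' + b 0 * star (b 0) * n
  obtain ⟨R, hR0, hR1⟩ := SU3.exists_colv_zero_one (by simpa using A.star_colv_dotProduct 0 0)
    hcc hac
  have hR0' : ∀ i, R.1 i 0 = A.1 i 0 := congrFun hR0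
  have hR1' : ∀ i, R.1 i 1 = c i := congrFun hR1
  refine ⟨(R, 1), (B.conj, B), joined_plane_line_iff.2 ?_, ?_, ?_, ?_⟩
  · rw [inv_two_plane]; exact hR0'
  · rw [joined_two_one_iff, inv_two_plane]
    ext i
    simp only [mulVec, dotProduct, Fin.sum_univ_three, Pi.star_apply, SU3.colv, hB', hR0', hR1', b2,
      star_zero, mul_zero, add_zero]
    rw [show B.conj.1 i 0 = star (B.1 i 0) from rfl, hB']
    simp only [c]
    field_simp
    ring
  · rw [joined_base_plane_iff]; rfl
  · rw [joined_base_point_iff]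
    exact (hB' 2).trans b2

end ExceptionalC3

namespace ExceptionalC3

lemma joined_iff_base {i j : Fin 3} {g g' : SU3 × SU3} :
    Delta.Joined (vtx i g) (vtx j g') ↔ Delta.Joined (vtx i 1) (vtx j (g⁻¹ * g')) := by
  rw [← joined_mul_iff (k := g) (g := 1), mul_one, mul_inv_cancel_left]

lemma vtx_eq_iff_translate {i : Fin 3} (k : SU3 × SU3) {g g' : SU3 × SU3} :
    vtx i g = vtx i g' ↔ vtx i (k⁻¹ * g) = vtx i (k⁻¹ * g') := vtx_mul_eq_iff.symm

lemma exists_line (p q q' : SU3 × SU3) : ∃ d, Delta.Joined (vtx 2 p) (vtx 1 d) ∧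
    Delta.Joined (vtx 0 q) (vtx 1 d) ∧ Delta.Joined (vtx 0 q') (vtx 1 d) := by
  obtain ⟨b, hb, h1, h2⟩ := SU3.exists_unit_orthogonal ((p⁻¹ * q).2.colv 2) ((p⁻¹ * q').2.colv 2)
  obtain ⟨B, rfl⟩ := SU3.exists_colv_zero hb
  refine ⟨p * (B.conj, B), ?_, ?_, ?_⟩
  · rw [joined_iff_base, inv_mul_cancel_left, joined_base_plane_iff]
    rfl
  · rwa [← mul_inv_cancel_left p q, joined_mul_iff, joined_zero_one_iff]
  · rwa [← mul_inv_cancel_left p q', joined_mul_iff, joined_zero_one_iff]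

lemma line_unique {p q q' d d' : SU3 × SU3} (hq : vtx 0 q ≠ vtx 0 q')
    (h1 : Delta.Joined (vtx 2 p) (vtx 1 d)) (h2 : Delta.Joined (vtx 2 p) (vtx 1 d'))
    (h3 : Delta.Joined (vtx 0 q) (vtx 1 d)) (h4 : Delta.Joined (vtx 0 q') (vtx 1 d))
    (h5 : Delta.Joined (vtx 0 q) (vtx 1 d')) (h6 : Delta.Joined (vtx 0 q') (vtx 1 d')) :
    vtx 1 d = vtx 1 d' := by
  rw [joined_iff_base] at h1 h2
  rw [← joined_mul_iff (k := p⁻¹), joined_zero_one_iff] at h3 h4 h5 h6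
  rw [Ne, vtx_eq_iff_translate p] at hq
  rw [vtx_eq_iff_translate p]
  rcases SU3.parallel_or_parallel h3 h5 h4 h6 with h | h
  · exact vtx_one_eq_of_parallel h1 h2 h
  · refine absurd (vtx_eq_vtx_iff.2 ?_) hq
    ext i j
    rw [inv_zero_apply, inv_zero_apply]
    exact SU3.mul_star_eq_of_parallel (by simpa using SU3.star_colv_dotProduct _ 2 2)
      (by simpa using SU3.star_colv_dotProduct _ 2 2) h i j

lemma exists_meet (d d' : SU3 × SU3) :
    ∃ q, Delta.Joined (vtx 0 q) (vtx 1 d) ∧ Delta.Joined (vtx 0 q) (vtx 1 d') := by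
  obtain ⟨w, hw, h1, h2⟩ := SU3.exists_unit_orthogonal (d.2.colv 0) (d'.2.colv 0)
  obtain ⟨B, rfl⟩ := SU3.exists_colv_two hw
  exact ⟨(1, B), joined_zero_one_iff.2 (SU3.star_dotProduct_comm_eq_zero h1),
    joined_zero_one_iff.2 (SU3.star_dotProduct_comm_eq_zero h2)⟩

/-- The line of `exists_base` when the plane contains it. -/
lemma vtx_one_base_eq {A : SU3} {g₀ : SU3 × SU3}
    (h : Delta.Joined (vtx 2 g₀) (vtx 1 (g₀ * (A, 1)))) : vtx 1 (g₀ * (A, 1)) = vtx 1 g₀ := by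
  rw [joined_iff_base, inv_mul_cancel_left, joined_plane_line_iff] at h
  rw [show inv 2 1 = 1 from inv_two_plane 1] at h
  conv_rhs => rw [← mul_one g₀]
  exact vtx_mul_eq_iff.2 (vtx_one_eq (funext fun i => (h i).symm) rfl)

lemma plane_unique {p p' d d' : SU3 × SU3} (hd : vtx 1 d ≠ vtx 1 d')
    (h1 : Delta.Joined (vtx 2 p) (vtx 1 d)) (h2 : Delta.Joined (vtx 2 p) (vtx 1 d'))
    (h3 : Delta.Joined (vtx 2 p') (vtx 1 d)) (h4 : Delta.Joined (vtx 2 p') (vtx 1 d')) :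
    vtx 2 p = vtx 2 p' := by
  obtain ⟨q, hq, hq'⟩ := exists_meet d d'
  obtain ⟨g₀, A, ep, eq, ed⟩ := exists_base p hq
  rw [ep, ed] at h1
  rw [ed, vtx_one_base_eq h1, ← mul_one g₀] at hd h3
  rw [ep, joined_iff_base] at h2
  rw [ep, vtx_eq_iff_translate g₀, inv_mul_cancel]
  rw [eq, joined_iff_base] at hq'
  rw [← joined_mul_iff (k := g₀⁻¹), inv_mul_cancel_left] at h3
  rw [← joined_mul_iff (k := g₀⁻¹)] at h4
  rw [Ne, vtx_eq_iff_translate g₀, inv_mul_cancel_left] at hd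
  generalize g₀⁻¹ * d' = d₁ at *
  have h1' : Delta.Joined (vtx 2 1) (vtx 1 ((1 : SU3), (1 : SU3))) := joined_vtx 2 1 1
  obtain ⟨-, e⟩ := proj_equations (A := 1) h3 h4 h2 hq'
  obtain ⟨-, e'⟩ := proj_equations (A := 1) h1' h2 h2 hq'
  have hy : d₁.2.1 1 0 ≠ 0 := by
    intro hy
    have hz := joined_base_point_iff.1 hq'
    refine hd (vtx_one_eq_of_parallel (joined_vtx 2 1 1) h2 fun i j => ?_)
    fin_cases i <;> fin_cases j <;> simp [hy, hz]
  refine vtx_two_eq_of_colv (fun i => ?_) fun i => ?_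
  · rw [joined_plane_line_iff.1 h1', joined_plane_line_iff.1 h3]
  · exact mul_right_cancel₀ (star_ne_zero.2 hy) ((e' i).trans (e i).symm)

lemma exists_proj {q p d : SU3 × SU3} (h : Delta.Joined (vtx 0 q) (vtx 1 d))
    (hn : ¬ Delta.Joined (vtx 2 p) (vtx 1 d)) :
    ∃ p' d' : SU3 × SU3, Delta.Joined (vtx 2 p') (vtx 1 d) ∧
      Delta.Joined (vtx 2 p') (vtx 1 d') ∧ Delta.Joined (vtx 2 p) (vtx 1 d') ∧
      Delta.Joined (vtx 0 q) (vtx 1 d') := by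
  obtain ⟨g₀, A, ep, eq, ed⟩ := exists_base p h
  rw [ep, ed, joined_iff_base, inv_mul_cancel_left] at hn
  obtain ⟨p', d', h1, h2, h3, h4⟩ := exists_proj_base hn
  refine ⟨g₀ * p', g₀ * d', ?_, joined_mul_iff.2 h2, ?_, ?_⟩
  · rwa [ed, joined_mul_iff]
  · rwa [ep, joined_iff_base, inv_mul_cancel_left]
  · rwa [eq, joined_iff_base, inv_mul_cancel_left]

lemma proj_unique {q p d p' d' p'' d'' : SU3 × SU3} (h : Delta.Joined (vtx 0 q) (vtx 1 d))
    (hn : ¬ Delta.Joined (vtx 2 p) (vtx 1 d))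
    (h1 : Delta.Joined (vtx 2 p') (vtx 1 d)) (h2 : Delta.Joined (vtx 2 p') (vtx 1 d'))
    (h3 : Delta.Joined (vtx 2 p) (vtx 1 d')) (h4 : Delta.Joined (vtx 0 q) (vtx 1 d'))
    (k1 : Delta.Joined (vtx 2 p'') (vtx 1 d)) (k2 : Delta.Joined (vtx 2 p'') (vtx 1 d''))
    (k3 : Delta.Joined (vtx 2 p) (vtx 1 d'')) (k4 : Delta.Joined (vtx 0 q) (vtx 1 d'')) :
    vtx 2 p' = vtx 2 p'' ∧ vtx 1 d' = vtx 1 d'' := by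
  obtain ⟨g₀, A, ep, eq, ed⟩ := exists_base p h
  rw [ep, ed, joined_iff_base, inv_mul_cancel_left] at hn
  rw [ep, joined_iff_base] at h3 k3
  rw [eq, joined_iff_base] at h4 k4
  rw [ed, ← joined_mul_iff (k := g₀⁻¹), inv_mul_cancel_left] at h1 k1
  rw [← joined_mul_iff (k := g₀⁻¹)] at h2 k2
  rw [vtx_eq_iff_translate g₀, vtx_eq_iff_translate g₀ (i := 1)]
  exact proj_unique_base hn h1 h2 h3 h4 k1 k2 k3 k4

/-- An incident point-line pair with a plane incident with the line have a common element. -/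
lemma exists_common {q d p : SU3 × SU3} (h : Delta.Joined (vtx 0 q) (vtx 1 d))
    (h' : Delta.Joined (vtx 2 p) (vtx 1 d)) :
    ∃ g, vtx 0 q = vtx 0 g ∧ vtx 1 d = vtx 1 g ∧ vtx 2 p = vtx 2 g := by
  obtain ⟨g₀, A, ep, eq, ed⟩ := exists_base p h
  rw [ep, ed] at h'
  exact ⟨g₀, eq, ed.trans (vtx_one_base_eq h'), ep⟩

lemma isFlagComplex : Delta.IsFlagComplex := by
  intro s hs
  rw [mem_simplices_iff]
  have key : (∃ g, ∀ k, ∀ v ∈ s, vertexType v = k → v = vtx k g) →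
      ∃ g, ∀ v ∈ s, v = vtx (vertexType v) g := fun ⟨g, hg⟩ => ⟨g, fun v hv => hg _ v hv rfl⟩
  apply key
  by_cases hd : ∃ d, vtx 1 d ∈ s
  · obtain ⟨d, hd⟩ := hd
    have claim : ∀ k, ∃ x, Delta.Joined (vtx k x) (vtx 1 d) ∧
        ∀ v ∈ s, vertexType v = k → v = vtx k x := fun k => by
      by_cases hk : ∃ x, vtx k x ∈ s
      · obtain ⟨x, hx⟩ := hk
        refine ⟨x, hs _ hx _ hd, fun v hv e => ?_⟩
        obtain ⟨y, rfl⟩ := exists_vtx_of_type e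
        exact vtx_eq_of_joined (hs _ hv _ hx)
      · refine ⟨d, joined_vtx k 1 d, fun v hv e => absurd ?_ hk⟩
        obtain ⟨y, rfl⟩ := exists_vtx_of_type e
        exact ⟨y, hv⟩
    obtain ⟨q, hq, hq'⟩ := claim 0
    obtain ⟨p, hp, hp'⟩ := claim 2
    obtain ⟨g, e0, e1, e2⟩ := exists_common hq hp
    refine ⟨g, fun k v hv e => ?_⟩
    fin_cases k
    · exact (hq' v hv e).trans e0
    · obtain ⟨y, rfl⟩ := exists_vtx_of_type e
      exact (vtx_eq_of_joined (hs _ hv _ hd)).trans e1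
    · exact (hp' v hv e).trans e2
  · have claim : ∀ k, ∃ x, ∀ v ∈ s, vertexType v = k → v = vtx k x := fun k => by
      by_cases hk : ∃ x, vtx k x ∈ s
      · obtain ⟨x, hx⟩ := hk
        refine ⟨x, fun v hv e => ?_⟩
        obtain ⟨y, rfl⟩ := exists_vtx_of_type e
        exact vtx_eq_of_joined (hs _ hv _ hx)
      · refine ⟨1, fun v hv e => absurd ?_ hk⟩
        obtain ⟨y, rfl⟩ := exists_vtx_of_type e
        exact ⟨y, hv⟩
    obtain ⟨q, hq⟩ := claim 0
    obtain ⟨p, hp⟩ := claim 2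
    obtain ⟨g, e2, e0⟩ := joined_vtx_iff.1 (joined_flat p q)
    refine ⟨g, fun k v hv e => ?_⟩
    fin_cases k
    · exact (hq v hv e).trans e0
    · refine absurd ?_ hd
      obtain ⟨y, rfl⟩ := exists_vtx_of_type e
      exact ⟨y, hv⟩
    · exact (hp v hv e).trans e2

/-- Every panel of the base chamber is in three chambers: witnesses in the panel stabilizer. -/
lemma exists_panel_elements (k : Fin 3) : ∃ f : Fin 3 → SU3 × SU3,
    (∀ m, ∀ i, i ≠ k → f m ∈ K i) ∧ Function.Injective fun m => vtx k (f m) := by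
  let c : Fin 3 → ℝ := ![1, 0, 3 / 5]
  let s : Fin 3 → ℝ := ![0, 1, 4 / 5]
  have hcs : ∀ m, c m ^ 2 + s m ^ 2 = 1 := fun m => by
    fin_cases m <;> norm_num [c, s]
  have hc : ∀ m n, c m * c m = c n * c n → m = n := fun m n => by
    fin_cases m <;> fin_cases n <;> norm_num [c]
  let R : Fin 3 → SU3 := fun m => SU3.rotLast (c m) (s m) (hcs m)
  let S : Fin 3 → SU3 := fun m => SU3.rotFirst (c m) (s m) (hcs m)
  fin_cases k
  · refine ⟨fun m => (R m, R m), fun m i hi => ?_, fun m n h => hc m n ?_⟩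
    · fin_cases i
      · exact absurd rfl hi
      · simp [K, Kd, R, SU3.rotLast, SU3.ofUnitary]
      · intro i j
        fin_cases i <;> fin_cases j <;> simp [R, SU3.rotLast, SU3.ofUnitary]
    · have e : inv 0 (R m, R m) = inv 0 (R n, R n) := vtx_eq_vtx_iff.1 h
      have := congrFun (congrFun e 2) 2
      simp only [inv_zero_apply] at this
      simpa [R, SU3.rotLast, SU3.ofUnitary, ← Complex.ofReal_mul] using this
  · refine ⟨fun m => (S m, S m), fun m i hi => ?_, fun m n h => hc m n ?_⟩
    · fin_cases i
      · simp [K, Kq, S, SU3.rotFirst, SU3.ofUnitary]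
      · exact absurd rfl hi
      · intro i j
        fin_cases i <;> fin_cases j <;> simp [S, SU3.rotFirst, SU3.ofUnitary]
    · have e : inv 1 (S m, S m) = inv 1 (S n, S n) := vtx_eq_vtx_iff.1 h
      have := congrFun (congrFun e 0) 0
      simp only [inv_one_apply] at this
      simpa [S, SU3.rotFirst, SU3.ofUnitary, ← Complex.ofReal_mul] using this
  · refine ⟨fun m => (R m, 1), fun m i hi => ?_, fun m n h => hc m n ?_⟩
    · fin_cases i
      · simp [K, Kq]
      · simp [K, Kd, R, SU3.rotLast, SU3.ofUnitary]
      · exact absurd rfl hi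
    · have e : inv 2 (R m, 1) = inv 2 (R n, 1) := vtx_eq_vtx_iff.1 h
      rw [inv_two_plane, inv_two_plane] at e
      have := congrFun (congrFun e 1) 1
      have h' : c m = c n := by simpa [R, SU3.rotLast, SU3.ofUnitary] using this
      rw [h']

/-- The planes given by `1` and by `diag(i, i, -1)` have no common line, since the latter matrix has no
eigenvalue `1`. -/
lemma exists_far : ∃ p : SU3 × SU3, ∀ d, Delta.Joined (vtx 2 1) (vtx 1 d) →
    ¬ Delta.Joined (vtx 2 p) (vtx 1 d) := by
  let P : SU3 := SU3.ofUnitary (diagonal ![Complex.I, Complex.I, -1])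
    (by
      rw [diagonal_conjTranspose, diagonal_mul_diagonal, ← diagonal_one]
      congr 1
      ext i
      fin_cases i <;> simp)
    (by simp [det_diagonal, Fin.prod_univ_three])
  refine ⟨(P, 1), fun d h h' => ?_⟩
  rw [joined_base_plane_iff] at h
  rw [joined_two_one_iff, inv_two_plane, ← h] at h'
  have e : ∀ i, (![Complex.I, Complex.I, -1] : Fin 3 → ℂ) i * star (d.2.1 i 0) =
      star (d.2.1 i 0) := fun i => by
    have := congrFun h' i
    rwa [show P.1 = diagonal ![Complex.I, Complex.I, -1] from rfl, mulVec_diagonal] at this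
  have hI : Complex.I ≠ 1 := fun h => by simpa using congrArg Complex.re h
  have z : ∀ i, d.2.1 i 0 = 0 := fun i => by
    by_contra hne
    have h1 := mul_right_cancel₀ (star_ne_zero.2 hne) ((e i).trans (one_mul _).symm)
    fin_cases i
    · exact hI h1
    · exact hI h1
    · norm_num at h1
  have n := d.2.star_colv_dotProduct 0 0
  simp [dotProduct, z] at n

theorem isFlatC3 : Delta.IsFlatC3 vertexType where
  nonempty := ⟨vtx 0 1⟩
  vertices := by
    refine Set.eq_univ_of_forall fun v => mem_simplices_iff.2 ?_
    obtain ⟨g, hg⟩ := exists_vtx v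
    exact ⟨g, fun w hw => by rw [Finset.mem_singleton.1 hw]; exact hg⟩
  injOn α hα u hu v hv e := by
    obtain ⟨g, hg⟩ := mem_simplices_iff.1 hα
    rw [hg u hu, hg v hv, e]
  flag := isFlagComplex
  neighbor v k _ := by
    obtain ⟨g, hg⟩ := exists_vtx v
    exact ⟨vtx k g, rfl, hg ▸ joined_vtx _ k g⟩
  thick u v huv hne k hku hkv := by
    obtain ⟨g, hu, hv⟩ := joined_iff.1 huv
    obtain ⟨f, hf, hinj⟩ := exists_panel_elements k
    have key : ∀ w, w = vtx (vertexType w) g → k ≠ vertexType w → ∀ m,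
        Delta.Joined w (vtx k (g * f m)) := fun w hw hkw m => by
      have : vtx (vertexType w) g = vtx (vertexType w) (g * f m) :=
        vtx_eq_iff.2 (by simpa using hf m _ hkw.symm)
      rw [hw, this]
      exact joined_vtx _ k _
    exact ⟨fun m => vtx k (g * f m), fun m n h => hinj (vtx_mul_eq_iff.1 h),
      fun m => ⟨rfl, key u hu hku m, key v hv hkv m⟩⟩
  flat p q hp hq := by
    obtain ⟨p, rfl⟩ := exists_vtx_of_type hp
    obtain ⟨q, rfl⟩ := exists_vtx_of_type hq
    exact joined_flat p q
  line p q q' hp hq hq' _ := by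
    obtain ⟨p, rfl⟩ := exists_vtx_of_type hp
    obtain ⟨q, rfl⟩ := exists_vtx_of_type hq
    obtain ⟨q', rfl⟩ := exists_vtx_of_type hq'
    obtain ⟨d, h⟩ := exists_line p q q'
    exact ⟨vtx 1 d, rfl, h⟩
  line_unique p q q' d d' hp hq hq' hd hd' := by
    obtain ⟨p, rfl⟩ := exists_vtx_of_type hp
    obtain ⟨q, rfl⟩ := exists_vtx_of_type hq
    obtain ⟨q', rfl⟩ := exists_vtx_of_type hq'
    obtain ⟨d, rfl⟩ := exists_vtx_of_type hd
    obtain ⟨d', rfl⟩ := exists_vtx_of_type hd'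
    exact line_unique
  meet p d d' _ hd hd' _ _ _ := by
    obtain ⟨d, rfl⟩ := exists_vtx_of_type hd
    obtain ⟨d', rfl⟩ := exists_vtx_of_type hd'
    obtain ⟨q, h⟩ := exists_meet d d'
    exact ⟨vtx 0 q, rfl, h⟩
  proj q p d hq hp hd h hn := by
    obtain ⟨p, rfl⟩ := exists_vtx_of_type hp
    obtain ⟨q, rfl⟩ := exists_vtx_of_type hq
    obtain ⟨d, rfl⟩ := exists_vtx_of_type hd
    obtain ⟨p', d', h⟩ := exists_proj h hn
    exact ⟨vtx 2 p', vtx 1 d', rfl, rfl, h⟩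
  proj_unique q p d p' d' p'' d'' hq hp hd hp' hd' hp'' hd'' := by
    obtain ⟨p, rfl⟩ := exists_vtx_of_type hp
    obtain ⟨q, rfl⟩ := exists_vtx_of_type hq
    obtain ⟨d, rfl⟩ := exists_vtx_of_type hd
    obtain ⟨p', rfl⟩ := exists_vtx_of_type hp'
    obtain ⟨d', rfl⟩ := exists_vtx_of_type hd'
    obtain ⟨p'', rfl⟩ := exists_vtx_of_type hp''
    obtain ⟨d'', rfl⟩ := exists_vtx_of_type hd''
    exact proj_unique
  plane_unique p p' d d' hp hp' hd hd' hne h1 h2 h3 h4 := by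
    obtain ⟨p, rfl⟩ := exists_vtx_of_type hp
    obtain ⟨p', rfl⟩ := exists_vtx_of_type hp'
    obtain ⟨d, rfl⟩ := exists_vtx_of_type hd
    obtain ⟨d', rfl⟩ := exists_vtx_of_type hd'
    by_contra h
    exact hne (plane_unique h h1 h2 h3 h4)
  far := by
    obtain ⟨p, hp⟩ := exists_far
    refine ⟨vtx 2 1, vtx 2 p, rfl, rfl, fun d hd => ?_⟩
    obtain ⟨d, rfl⟩ := exists_vtx_of_type hd
    exact hp d

end ExceptionalC3

/-! ### The topology of the exceptional geometry -/

namespace SU3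

instance : ContinuousInv SU3 where
  continuous_inv := (continuous_subtype_val.matrix_conjTranspose).subtype_mk _

instance : IsTopologicalGroup SU3 where

instance : CompactSpace SU3 := by
  refine isCompact_iff_compactSpace.1 (IsCompact.of_isClosed_subset (s := Set.univ.pi fun _ =>
    Set.univ.pi fun _ => Metric.closedBall 0 1)
    (isCompact_univ_pi fun _ => isCompact_univ_pi fun _ => isCompact_closedBall _ _) ?_ ?_)
  · exact (isClosed_unitary (R := Matrix (Fin 3) (Fin 3) ℂ)).inter
      (isClosed_eq (f := fun M : Matrix (Fin 3) (Fin 3) ℂ => M.det) continuous_id.matrix_det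
        (continuous_const (y := 1)))
  · intro M hM i _ j _
    rw [mem_closedBall_zero_iff]
    exact entry_norm_bound_of_unitary (mem_specialUnitaryGroup_iff.1 hM).1 i j

end SU3

namespace ExceptionalC3

lemma continuous_inv (i : Fin 3) : Continuous (inv i) := by
  have h1 : Continuous fun g : SU3 × SU3 => g.1.1 := continuous_subtype_val.comp continuous_fst
  have h2 : Continuous fun g : SU3 × SU3 => g.2.1 := continuous_subtype_val.comp continuous_snd
  fin_cases i
  · exact (h2.matrix_mul continuous_const).matrix_mul h2.matrix_conjTranspose
  · exact (h1.matrix_mul continuous_const).matrix_mul h2.matrix_transpose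
  · exact h1.matrix_mul h2.matrix_transpose

lemma isQuotientMap_mk_mk (i : Fin 3) :
    Topology.IsQuotientMap fun g : SU3 × SU3 => ((g : G) : G ⧸ stab i) :=
  QuotientGroup.isOpenQuotientMap_mk.isQuotientMap.comp
    QuotientGroup.isOpenQuotientMap_mk.isQuotientMap

lemma continuous_vtx (i : Fin 3) : Continuous (vtx i) :=
  continuous_sigmaMk.comp (isQuotientMap_mk_mk i).continuous

/-- The matrix of a vertex is a continuous injective invariant. -/
instance : T2Space (Σ i, G ⧸ stab i) := by
  choose r hr using exists_vtx
  have hinv : ∀ i g, inv i (r (vtx i g)) = inv i g := fun i g =>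
    (vtx_eq_vtx_iff.1 (hr (vtx i g))).symm
  refine T2Space.of_injective_continuous
    (f := fun v => (vertexType v, inv (vertexType v) (r v))) ?_ ?_
  · intro v w h
    obtain ⟨h1, h2⟩ := Prod.mk.inj h
    rw [hr v, hr w, ← h1, vtx_eq_vtx_iff]
    exact h2.trans (by rw [h1])
  · refine continuous_sigma fun i => (isQuotientMap_mk_mk i).continuous_iff.2 ?_
    exact ((continuous_const (y := i)).prodMk (continuous_inv i)).congr fun g => by
      exact Prod.ext rfl (hinv i g).symm

lemma smul_vtx (h g : SU3 × SU3) (i : Fin 3) : (h : G) • vtx i g = vtx i (h * g) := rfl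

lemma vertexType_smul (g : G) (v : Σ i, G ⧸ stab i) : vertexType (g • v) = vertexType v := rfl

lemma continuous_smul_vtx (v : Σ i, G ⧸ stab i) : Continuous fun g : G => g • v := by
  obtain ⟨g, hg⟩ := exists_vtx v
  rw [hg, QuotientGroup.isOpenQuotientMap_mk.isQuotientMap.continuous_iff]
  exact (continuous_vtx _).comp (continuous_id.mul continuous_const)

/-- The flags of type `J` are the translates of the standard flag of type `J`. -/
lemma mem_flagVariety_iff {J : Finset (Fin 3)} {f : J → Σ i, G ⧸ stab i} :
    f ∈ Delta.flagVariety vertexType J ↔ ∃ g, (fun j : J => vtx j g) = f := by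
  classical
  constructor
  · rintro ⟨hf, α, hα, hαf⟩
    obtain ⟨g, hg⟩ := mem_simplices_iff.1 hα
    refine ⟨g, funext fun j => ?_⟩
    rw [hg (f j) (hαf ▸ Set.mem_range_self j : f j ∈ (α : Set _)), hf]
  · rintro ⟨g, rfl⟩
    refine ⟨fun j => rfl, Finset.univ.image fun j : J => vtx j g, mem_simplices_iff.2 ⟨g, ?_⟩,
      by simp⟩
    intro v hv
    obtain ⟨j, -, rfl⟩ := Finset.mem_image.1 hv
    rfl

lemma isClosed_flagVariety (J : Finset (Fin 3)) :
    IsClosed (Delta.flagVariety vertexType J) := by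
  have : Delta.flagVariety vertexType J = Set.range fun g => fun j : J => vtx j g :=
    Set.ext fun f => mem_flagVariety_iff
  rw [this]
  exact (isCompact_range (continuous_pi fun j : J => continuous_vtx j)).isClosed

lemma isClosed_Z : IsClosed (Z : Set (SU3 × SU3)) := by
  have h1 : IsClosed (Subgroup.center (SU3 × SU3) : Set (SU3 × SU3)) := by
    have : (Subgroup.center (SU3 × SU3) : Set (SU3 × SU3)) = ⋂ g, {z | g * z = z * g} := by
      ext z
      simp [Subgroup.mem_center_iff]
    rw [this]
    exact isClosed_iInter fun g => isClosed_eq (continuous_const.mul continuous_id)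
      (continuous_id.mul continuous_const)
  have h2 : ∀ i, IsClosed (K i : Set (SU3 × SU3)) := fun i => by
    have : (K i : Set (SU3 × SU3)) = {g | vtx i 1 = vtx i g} := by
      ext g
      rw [Set.mem_ofPred_eq, vtx_eq_iff, inv_one, one_mul]
      rfl
    rw [this]
    exact isClosed_eq continuous_const (continuous_vtx i)
  have : (Z : Set (SU3 × SU3)) =
      (Subgroup.center (SU3 × SU3) : Set (SU3 × SU3)) ∩ ⋂ i, (K i : Set (SU3 × SU3)) := by
    simp [Z]
  rw [this]
  exact h1.inter (isClosed_iInter h2)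

lemma mem_stabilizer_iff {α : Finset (Σ i, G ⧸ stab i)} (hα : α ∈ Delta.simplices) {g : G} :
    g ∈ MulAction.stabilizer G (α : Set (Σ i, G ⧸ stab i)) ↔ ∀ v ∈ α, g • v = v := by
  rw [MulAction.mem_stabilizer_iff]
  constructor
  · intro h v hv
    have : g • v ∈ (α : Set _) := h ▸ Set.smul_mem_smul_set hv
    exact isFlatC3.injOn α hα this hv (vertexType_smul g v)
  · intro h
    ext v
    constructor
    · rintro ⟨w, hw, rfl⟩
      exact (congrArg (· ∈ (α : Set _)) (h w hw)).mpr hw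
    · exact fun hv => ⟨v, hv, h v hv⟩

lemma exists_eq_image_of_mem_chambers {γ : Finset (Σ i, G ⧸ stab i)} [DecidableEq (Σ i, G ⧸ stab i)]
    (hγ : γ ∈ Delta.chambers 3) : ∃ g, γ = Finset.univ.image fun i => vtx i g := by
  obtain ⟨g, hg⟩ := mem_simplices_iff.1 hγ.1
  refine ⟨g, Finset.eq_of_subset_of_card_le (fun v hv => ?_) ?_⟩
  · exact Finset.mem_image.2 ⟨_, Finset.mem_univ _, (hg v hv).symm⟩
  · rw [hγ.2]
    exact Finset.card_image_le

theorem isHomogeneousCompactGeometry :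
    Delta.IsHomogeneousCompactGeometry G vertexType (CoxeterMatrix.B 3) where
  topologicalGroup := inferInstance
  locallyCompact :=
    haveI := isClosed_Z
    inferInstance
  hausdorff :=
    haveI := isClosed_Z
    inferInstance
  ofType := isFlatC3.isGeometryOfType
  simplicial g α hα := by
    obtain ⟨k, hk⟩ := mem_simplices_iff.1 hα
    obtain ⟨h, rfl⟩ := QuotientGroup.mk_surjective g
    refine mem_simplices_iff.2 ⟨h * k, fun v hv => ?_⟩
    obtain ⟨w, hw, rfl⟩ := Finset.mem_map.1 hv
    change (h : G) • w = vtx (vertexType w) (h * k)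
    conv_lhs => rw [hk w hw]
    rfl
  type_smul := vertexType_smul
  transitive γ hγ γ' hγ' := by
    classical
    obtain ⟨g, rfl⟩ := exists_eq_image_of_mem_chambers hγ
    obtain ⟨g', rfl⟩ := exists_eq_image_of_mem_chambers hγ'
    refine ⟨((g' * g⁻¹ : SU3 × SU3) : G), ?_⟩
    rw [Finset.map_eq_image, Finset.image_image]
    refine Finset.image_congr fun i _ => ?_
    change ((g' * g⁻¹ : SU3 × SU3) : G) • vtx i g = vtx i g'
    rw [smul_vtx, inv_mul_cancel_right]
  stabilizer_closed α hα := by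
    have : (MulAction.stabilizer G (α : Set (Σ i, G ⧸ stab i)) : Set G) =
        ⋂ v ∈ α, {g : G | g • v = v} := by
      ext g
      simpa using mem_stabilizer_iff hα
    rw [this]
    exact isClosed_biInter fun v _ => isClosed_eq (continuous_smul_vtx v) continuous_const
  stabilizer_cocompact α _ := inferInstance
  isOpen_iff U := by
    refine ⟨fun h v => h.preimage (continuous_smul_vtx v), fun h => isOpen_sigma_iff.2 fun i => ?_⟩
    rw [← (isQuotientMap_mk_mk i).isOpen_preimage]
    have e : (fun g : SU3 × SU3 => ((g : G) : G ⧸ stab i)) ⁻¹' ((fun x => ⟨i, x⟩) ⁻¹' U) =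
        QuotientGroup.mk ⁻¹' {g : G | g • vtx i 1 ∈ U} := by
      ext g
      change vtx i g ∈ U ↔ vtx i (g * 1) ∈ U
      rw [mul_one]
    change IsOpen ((fun g : SU3 × SU3 => ((g : G) : G ⧸ stab i)) ⁻¹' ((fun x => ⟨i, x⟩) ⁻¹' U))
    rw [e]
    exact (h (vtx i 1)).preimage QuotientGroup.continuous_mk
  compactGeometry :=
    { ofType := isFlatC3.isGeometryOfType
      compact := inferInstance
      hausdorff := inferInstance
      closed := isClosed_flagVariety }

end ExceptionalC3

/-! ### Hermitian octonionic matrices as pairs of complex matrices -/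

namespace Octonion

/-- The quaternion with given coordinates. -/
def quat (a b c d : ℝ) : ℍ[ℝ] := ⟨a, b, c, d⟩

@[simp] lemma re_quat (a b c d : ℝ) : (quat a b c d).re = a := rfl

@[simp] lemma imI_quat (a b c d : ℝ) : (quat a b c d).imI = b := rfl

@[simp] lemma imJ_quat (a b c d : ℝ) : (quat a b c d).imJ = c := rfl

@[simp] lemma imK_quat (a b c d : ℝ) : (quat a b c d).imK = d := rfl

/-- The octonions as the space `ℂ ⊕ ℂ³`, on which `SU(3)` acts by automorphisms. The sign in
the last coordinate makes the product `SU(3)`-invariant, see `oct_mul`. -/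
def oct (z : ℂ) (u : Fin 3 → ℂ) : Octonion :=
  ((quat z.re z.im (u 0).re (u 0).im, quat (u 1).re (u 1).im (u 2).re (-(u 2).im)) : ℍ[ℝ] × ℍ[ℝ])

lemma oct_ext_iff {z w : ℂ} {u v : Fin 3 → ℂ} : oct z u = oct w v ↔ z = w ∧ u = v := by
  refine ⟨fun h => ?_, fun ⟨h, h'⟩ => h ▸ h' ▸ rfl⟩
  obtain ⟨h1, h2⟩ := Prod.mk.inj h
  have a1 := congrArg QuaternionAlgebra.re h1
  have a2 := congrArg QuaternionAlgebra.imI h1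
  have a3 := congrArg QuaternionAlgebra.imJ h1
  have a4 := congrArg QuaternionAlgebra.imK h1
  have b1 := congrArg QuaternionAlgebra.re h2
  have b2 := congrArg QuaternionAlgebra.imI h2
  have b3 := congrArg QuaternionAlgebra.imJ h2
  have b4 := neg_injective (congrArg QuaternionAlgebra.imK h2)
  refine ⟨Complex.ext a1 a2, funext fun i => ?_⟩
  fin_cases i
  · exact Complex.ext a3 a4
  · exact Complex.ext b1 b2
  · exact Complex.ext b3 b4

lemma exists_oct (o : Octonion) : ∃ z u, o = oct z u :=
  ⟨⟨o.1.re, o.1.imI⟩, ![⟨o.1.imJ, o.1.imK⟩, ⟨o.2.re, o.2.imI⟩, ⟨o.2.imJ, -o.2.imK⟩],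
    Prod.ext (QuaternionAlgebra.ext rfl rfl rfl rfl)
      (QuaternionAlgebra.ext rfl rfl rfl (neg_neg _).symm)⟩

lemma oct_add (z w : ℂ) (u v : Fin 3 → ℂ) : oct z u + oct w v = oct (z + w) (u + v) := by
  refine Prod.ext (QuaternionAlgebra.ext rfl rfl rfl rfl) (QuaternionAlgebra.ext rfl rfl rfl ?_)
  change -(u 2).im + -(v 2).im = -((u 2).im + (v 2).im)
  ring

lemma one_eq_oct : (1 : Octonion) = oct 1 0 :=
  Prod.ext (QuaternionAlgebra.ext rfl rfl rfl rfl)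
    (QuaternionAlgebra.ext rfl rfl rfl neg_zero.symm)

lemma star_oct (z : ℂ) (u : Fin 3 → ℂ) : star (oct z u) = oct (star z) (-u) := by
  refine Prod.ext ?_ ?_
  · change star _ = _
    ext <;> simp [oct]
  · exact QuaternionAlgebra.ext rfl rfl rfl rfl

/-- The product in terms of the hermitian form and the cross product of `ℂ³`. -/
lemma oct_mul (z w : ℂ) (u v : Fin 3 → ℂ) : oct z u * oct w v =
    oct (z * w - u ⬝ᵥ star v) (z • v + star w • u + star (u ⨯₃ v)) := by
  refine Prod.ext ?_ ?_
  · change _ * _ - star _ * _ = _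
    ext <;> simp [oct, dotProduct, Fin.sum_univ_three, cross_apply] <;> ring
  · change _ * _ + _ * star _ = _
    ext <;> simp [oct, dotProduct, Fin.sum_univ_three, cross_apply] <;> ring

lemma continuous_quat {X : Type*} [TopologicalSpace X] {a b c d : X → ℝ}
    (ha : Continuous a) (hb : Continuous b) (hc : Continuous c) (hd : Continuous d) :
    Continuous fun x => quat (a x) (b x) (c x) (d x) := by
  have : Continuous fun x => Quaternion.linearIsometryEquivTuple.symm
      (WithLp.toLp 2 ![a x, b x, c x, d x]) := by
    refine Quaternion.linearIsometryEquivTuple.symm.continuous.comp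
      ((PiLp.continuous_toLp 2 _).comp (continuous_pi fun i => ?_))
    fin_cases i
    · exact ha
    · exact hb
    · exact hc
    · exact hd
  exact this

lemma continuous_oct {X : Type*} [TopologicalSpace X] {z : X → ℂ} {u : X → Fin 3 → ℂ}
    (hz : Continuous z) (hu : Continuous u) : Continuous fun x => oct (z x) (u x) := by
  have hu' : ∀ i, Continuous fun x => u x i := fun i => (continuous_apply i).comp hu
  exact (continuous_quat (Complex.continuous_re.comp hz) (Complex.continuous_im.comp hz)
    (Complex.continuous_re.comp (hu' 0)) (Complex.continuous_im.comp (hu' 0))).prodMk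
    (continuous_quat (Complex.continuous_re.comp (hu' 1))
      (Complex.continuous_im.comp (hu' 1)) (Complex.continuous_re.comp (hu' 2))
      (Complex.continuous_im.comp (hu' 2)).neg)

instance : T2Space Octonion := inferInstanceAs (T2Space (ℍ[ℝ] × ℍ[ℝ]))

/-- The octonionic matrix given by a pair of complex matrices. If `H` is hermitian, then so is this
matrix, and every hermitian octonionic matrix arises in this way. -/
def ofPair (H x : Matrix (Fin 3) (Fin 3) ℂ) : Matrix (Fin 3) (Fin 3) Octonion :=
  !![oct (H 0 0) 0, oct (H 0 1) (-star (x 2)), oct (H 0 2) (star (x 1));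
    oct (H 1 0) (star (x 2)), oct (H 1 1) 0, oct (H 1 2) (-star (x 0));
    oct (H 2 0) (-star (x 1)), oct (H 2 1) (star (x 0)), oct (H 2 2) 0]

lemma ofPair_injective {H H' x x' : Matrix (Fin 3) (Fin 3) ℂ} (h : ofPair H x = ofPair H' x') :
    H = H' ∧ x = x' := by
  have e : ∀ i j, ofPair H x i j = ofPair H' x' i j := fun i j => by rw [h]
  constructor
  · ext i j
    have := e i j
    fin_cases i <;> fin_cases j <;> exact (oct_ext_iff.1 this).1
  · funext k
    fin_cases k
    · exact star_injective (oct_ext_iff.1 (e 2 1)).2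
    · exact star_injective (oct_ext_iff.1 (e 0 2)).2
    · exact star_injective (oct_ext_iff.1 (e 1 0)).2

lemma conjTranspose_ofPair {H : Matrix (Fin 3) (Fin 3) ℂ} (x : Matrix (Fin 3) (Fin 3) ℂ) :
    (ofPair H x).conjTranspose = ofPair Hᴴ x := by
  ext1 i j
  rw [conjTranspose_apply]
  fin_cases i <;> fin_cases j <;> simp [ofPair, star_oct]

lemma trace_ofPair (H x : Matrix (Fin 3) (Fin 3) ℂ) : (ofPair H x).trace = oct H.trace 0 := by
  simp [ofPair, trace, Fin.sum_univ_three, oct_add]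

lemma exists_ofPair {X : Matrix (Fin 3) (Fin 3) Octonion} (hX : X.conjTranspose = X) :
    ∃ H x : Matrix (Fin 3) (Fin 3) ℂ, Hᴴ = H ∧ X = ofPair H x := by
  choose z u h using fun i j => exists_oct (X i j)
  have e : ∀ i j, star (z j i) = z i j ∧ -u j i = u i j := fun i j => by
    have := congrFun (congrFun hX i) j
    rwa [conjTranspose_apply, h, h, star_oct, oct_ext_iff] at this
  have hd : ∀ i, u i i = 0 := fun i => self_eq_neg.1 (e i i).2.symm
  obtain ⟨x, x0, x1, x2⟩ : ∃ x : Matrix (Fin 3) (Fin 3) ℂ,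
      x 0 = -star (u 1 2) ∧ x 1 = -star (u 2 0) ∧ x 2 = -star (u 0 1) :=
    ⟨of ![-star (u 1 2), -star (u 2 0), -star (u 0 1)], rfl, rfl, rfl⟩
  refine ⟨of z, x, Matrix.ext fun i j => (e i j).1, ?_⟩
  ext1 i j
  rw [h]
  have e01 := (e 0 1).2
  have e12 := (e 1 2).2
  have e20 := (e 2 0).2
  fin_cases i <;> fin_cases j <;> refine oct_ext_iff.2 ⟨rfl, ?_⟩ <;>
    simp [hd, x0, x1, x2, ← e01, ← e12, ← e20]

/-- Squaring preserves the octonionic matrices given by pairs: the square is expressed in terms of complex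
matrices. -/
lemma ofPair_mul_self {H : Matrix (Fin 3) (Fin 3) ℂ} (hH : Hᴴ = H)
    (x : Matrix (Fin 3) (Fin 3) ℂ) : ofPair H x * ofPair H x =
      ofPair (H * H + (x * xᴴ).trace • 1 - x * xᴴ) (H.trace • x - H * x + x.adjugateᴴ) := by
  have e : ∀ i j, star (H i j) = H j i := fun i j => by
    conv_rhs => rw [← hH]
    rfl
  have e' : ∀ i j, (starRingEnd ℂ) (H i j) = H j i := e
  ext1 i j
  rw [mul_apply, Fin.sum_univ_three]
  fin_cases i <;> fin_cases j <;>
    · simp only [ofPair, of_apply, cons_val, oct_mul, oct_add, oct_ext_iff, Fin.zero_eta,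
        Fin.mk_one, Fin.reduceFinMk, Fin.isValue]
      refine ⟨?_, ?_⟩
      · simp [mul_apply, dotProduct, Fin.sum_univ_three, trace, one_apply]
        try ring
      · funext k
        fin_cases k <;>
        · simp [mul_apply, Fin.sum_univ_three, trace, adjugate_fin_three, cross_apply, e']
          try ring

lemma ofPair_mul_self_eq_iff {H : Matrix (Fin 3) (Fin 3) ℂ} (hH : Hᴴ = H)
    (x : Matrix (Fin 3) (Fin 3) ℂ) : ofPair H x * ofPair H x = ofPair H x ↔
      H * H + (x * xᴴ).trace • 1 - x * xᴴ = H ∧ H.trace • x - H * x + x.adjugateᴴ = x := by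
  rw [ofPair_mul_self hH]
  exact ⟨fun h => ofPair_injective h, fun ⟨h1, h2⟩ => by rw [h1, h2]⟩

lemma continuous_ofPair {X : Type*} [TopologicalSpace X] {H x : X → Matrix (Fin 3) (Fin 3) ℂ}
    (hH : Continuous H) (hx : Continuous x) : Continuous fun t => ofPair (H t) (x t) := by
  have hH' : ∀ i j, Continuous fun t => H t i j := fun i j => hH.matrix_elem i j
  have hx' : ∀ i, Continuous fun t => star (x t i) := fun i =>
    continuous_star.comp ((continuous_apply i).comp hx)
  refine continuous_matrix fun i j => ?_
  fin_cases i <;> fin_cases j <;>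
    first
    | exact continuous_oct (hH' _ _) continuous_const
    | exact continuous_oct (hH' _ _) (hx' _)
    | exact continuous_oct (hH' _ _) (hx' _).neg

end Octonion

/-! ### The Cayley plane as a space of pairs of complex matrices -/

namespace ExceptionalC3

/-- The equations that describe the Cayley plane in terms of pairs of complex matrices. In the presence of
the other equations, `sq` says that the adjugate of `H` is `x xᴴ`. -/
structure IsPoint (H x : Matrix (Fin 3) (Fin 3) ℂ) : Prop where
  hermitian : Hᴴ = H
  trace : H.trace = 1
  sq : H * H + (x * xᴴ).trace • 1 - x * xᴴ = H
  cofactor : H * x = x.adjugateᴴ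

lemma IsPoint.ofPair_mem {H x : Matrix (Fin 3) (Fin 3) ℂ} (h : IsPoint H x) :
    (Octonion.ofPair H x).conjTranspose = Octonion.ofPair H x ∧
      Octonion.ofPair H x * Octonion.ofPair H x = Octonion.ofPair H x ∧
        (Octonion.ofPair H x).trace = 1 := by
  refine ⟨?_, (Octonion.ofPair_mul_self_eq_iff h.hermitian x).2 ⟨h.sq, ?_⟩, ?_⟩
  · rw [Octonion.conjTranspose_ofPair, h.hermitian]
  · rw [h.trace, h.cofactor, one_smul, sub_add_cancel]
  · rw [Octonion.trace_ofPair, h.trace, Octonion.one_eq_oct]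

lemma exists_isPoint {X : Matrix (Fin 3) (Fin 3) Octonion}
    (hX : X.conjTranspose = X ∧ X * X = X ∧ X.trace = 1) :
    ∃ H x, IsPoint H x ∧ X = Octonion.ofPair H x := by
  obtain ⟨h1, h2, h3⟩ := hX
  obtain ⟨H, x, hH, rfl⟩ := Octonion.exists_ofPair h1
  have ht : H.trace = 1 := by
    rw [Octonion.trace_ofPair, Octonion.one_eq_oct, Octonion.oct_ext_iff] at h3
    exact h3.1
  obtain ⟨h4, h5⟩ := (Octonion.ofPair_mul_self_eq_iff hH x).1 h2
  refine ⟨H, x, ⟨hH, ht, h4, ?_⟩, rfl⟩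
  rw [ht, one_smul, sub_add, sub_eq_self, sub_eq_zero] at h5
  exact h5

/-- The group `SU(3) × SU(3)` acts on the Cayley plane. -/
lemma IsPoint.translate {H x : Matrix (Fin 3) (Fin 3) ℂ} (h : IsPoint H x) (A B : SU3) :
    IsPoint (B.1 * H * B.1ᴴ) (B.1 * x * A.1ᵀ) := by
  have e : (B.1 * x * A.1ᵀ) * (B.1 * x * A.1ᵀ)ᴴ = B.1 * (x * xᴴ) * B.1ᴴ := by
    calc _ = B.1 * x * (A.1ᵀ * A.1ᴴᵀ) * xᴴ * B.1ᴴ := by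
          rw [conjTranspose_mul, conjTranspose_mul, show A.1ᵀᴴ = A.1ᴴᵀ from rfl]
          simp only [mul_assoc]
      _ = _ := by rw [A.transpose_mul_conj, mul_one, ← mul_assoc B.1]
  have e' : (B.1 * H * B.1ᴴ) * (B.1 * H * B.1ᴴ) = B.1 * (H * H) * B.1ᴴ := by
    calc _ = B.1 * H * (B.1ᴴ * B.1) * H * B.1ᴴ := by simp only [mul_assoc]
      _ = _ := by rw [B.conjTranspose_mul_self, mul_one, ← mul_assoc B.1]
  have t : ∀ M : Matrix (Fin 3) (Fin 3) ℂ, (B.1 * M * B.1ᴴ).trace = M.trace := fun M => by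
    rw [trace_mul_comm, ← mul_assoc, B.conjTranspose_mul_self, one_mul]
  refine ⟨?_, by rw [t, h.trace], ?_, ?_⟩
  · rw [conjTranspose_mul, conjTranspose_mul, conjTranspose_conjTranspose, h.hermitian, mul_assoc]
  · rw [e, e', t]
    conv_rhs => rw [← h.sq]
    rw [mul_sub, sub_mul, mul_add, add_mul, mul_smul_comm, smul_mul_assoc, mul_one,
      B.mul_conjTranspose_self]
  · have hA : A.1ᵀ.adjugate = A.1ᴴᵀ := by rw [← adjugate_transpose, A.adjugate_eq]
    have hA' : A.1ᴴᵀᴴ = A.1ᵀ := by ext; simp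
    rw [adjugate_mul_distrib, adjugate_mul_distrib, hA, B.adjugate_eq, conjTranspose_mul,
      conjTranspose_mul, conjTranspose_conjTranspose, ← h.cofactor]
    calc _ = B.1 * H * (B.1ᴴ * B.1) * x * A.1ᵀ := by simp only [mul_assoc]
      _ = _ := by rw [B.conjTranspose_mul_self, mul_one, hA', ← mul_assoc B.1]

/-- The square roots of the products of two of three real numbers. -/
noncomputable def rootProd (l : Fin 3 → ℝ) : Fin 3 → ℝ :=
  ![√(l 1 * l 2), √(l 0 * l 2), √(l 0 * l 1)]

lemma rootProd_mul_self {l : Fin 3 → ℝ} (hl : ∀ i, 0 ≤ l i) :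
    rootProd l 0 * rootProd l 0 = l 1 * l 2 ∧ rootProd l 1 * rootProd l 1 = l 0 * l 2 ∧
      rootProd l 2 * rootProd l 2 = l 0 * l 1 :=
  ⟨Real.mul_self_sqrt (mul_nonneg (hl _) (hl _)), Real.mul_self_sqrt (mul_nonneg (hl _) (hl _)),
    Real.mul_self_sqrt (mul_nonneg (hl _) (hl _))⟩

lemma rootProd_eq {l : Fin 3 → ℝ} (hl : ∀ i, 0 ≤ l i) :
    rootProd l 0 = √(l 1) * √(l 2) ∧ rootProd l 1 = √(l 0) * √(l 2) ∧
      rootProd l 2 = √(l 0) * √(l 1) :=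
  ⟨Real.sqrt_mul (hl _) _, Real.sqrt_mul (hl _) _, Real.sqrt_mul (hl _) _⟩

lemma rootProd_mul {l : Fin 3 → ℝ} (hl : ∀ i, 0 ≤ l i) :
    l 0 * rootProd l 0 = rootProd l 1 * rootProd l 2 ∧
      l 1 * rootProd l 1 = rootProd l 0 * rootProd l 2 ∧
      l 2 * rootProd l 2 = rootProd l 0 * rootProd l 1 := by
  obtain ⟨h0, h1, h2⟩ := rootProd_eq hl
  have s := fun i => Real.mul_self_sqrt (hl i)
  rw [h0, h1, h2]
  refine ⟨?_, ?_, ?_⟩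
  · linear_combination -(√(l 1) * √(l 2)) * s 0
  · linear_combination -(√(l 0) * √(l 2)) * s 1
  · linear_combination -(√(l 0) * √(l 1)) * s 2

/-- The diagonal matrix with given real entries. -/
noncomputable def diagR (l : Fin 3 → ℝ) : Matrix (Fin 3) (Fin 3) ℂ := diagonal fun i => (l i : ℂ)

lemma conjTranspose_diagR (l : Fin 3 → ℝ) : (diagR l)ᴴ = diagR l := by
  rw [diagR, diagonal_conjTranspose]
  congr 1
  ext i
  exact Complex.conj_ofReal _

lemma diagR_mul_diagR (l m : Fin 3 → ℝ) : diagR l * diagR m = diagR (l * m) := by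
  simp [diagR, diagonal_mul_diagonal]

lemma isPoint_diagR {l : Fin 3 → ℝ} (hl : ∀ i, 0 ≤ l i) (hs : l 0 + l 1 + l 2 = 1) :
    IsPoint (diagR l) (diagR (rootProd l)) := by
  obtain ⟨q0, q1, q2⟩ := rootProd_mul_self hl
  obtain ⟨c0, c1, c2⟩ := rootProd_mul hl
  refine ⟨conjTranspose_diagR l, ?_, ?_, ?_⟩
  · rw [diagR, trace_diagonal, Fin.sum_univ_three]
    exact_mod_cast hs
  · rw [conjTranspose_diagR, diagR_mul_diagR, diagR_mul_diagR, diagR, diagR, diagR, trace_diagonal,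
      Fin.sum_univ_three, smul_one_eq_diagonal, diagonal_add, diagonal_sub, diagonal_eq_diagonal_iff]
    intro i
    simp only [Pi.mul_apply, q0, q1, q2]
    have h : ∀ i, l i * l i + (l 1 * l 2 + l 0 * l 2 + l 0 * l 1) - rootProd l i * rootProd l i =
        l i := fun i => match i with
      | 0 => by linear_combination -q0 + l 0 * hs
      | 1 => by linear_combination -q1 + l 1 * hs
      | 2 => by linear_combination -q2 + l 2 * hs
    exact_mod_cast h i
  · rw [diagR_mul_diagR, diagR, diagR, adjugate_diagonal, diagonal_conjTranspose,
      diagonal_eq_diagonal_iff]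
    have e : ∀ i, ((l * rootProd l) i : ℂ) = ∏ j ∈ Finset.univ.erase i, (rootProd l j : ℂ) :=
      fun i => match i with
      | 0 => by
        rw [show Finset.univ.erase (0 : Fin 3) = {1, 2} by decide, Finset.prod_pair (by decide)]
        exact_mod_cast c0
      | 1 => by
        rw [show Finset.univ.erase (1 : Fin 3) = {0, 2} by decide, Finset.prod_pair (by decide)]
        exact_mod_cast c1
      | 2 => by
        rw [show Finset.univ.erase (2 : Fin 3) = {0, 1} by decide, Finset.prod_pair (by decide)]
        exact_mod_cast c2
    intro i
    rw [Pi.star_apply, ← e i]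
    exact (Complex.conj_ofReal _).symm

/-- A hermitian matrix is conjugate under `SU(3)` to a diagonal matrix with increasing entries. -/
lemma exists_diagR {H : Matrix (Fin 3) (Fin 3) ℂ} (hH : Hᴴ = H) :
    ∃ (B : SU3) (l : Fin 3 → ℝ), Monotone l ∧ H = B.1 * diagR l * B.1ᴴ := by
  have hH' : H.IsHermitian := hH
  let σ := Tuple.sort hH'.eigenvalues
  let l := hH'.eigenvalues ∘ σ
  let U : Matrix (Fin 3) (Fin 3) ℂ := hH'.eigenvectorUnitary.1
  have hU : Uᴴ * U = 1 := mem_unitaryGroup_iff'.1 hH'.eigenvectorUnitary.2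
  let V := U.submatrix id σ
  have hV : Vᴴ * V = 1 := by
    have := submatrix_mul_equiv Uᴴ U σ (Equiv.refl _) σ
    rwa [hU, submatrix_one_equiv] at this
  have hdiag : H = V * diagR l * Vᴴ := by
    have h1 : diagR l = (diagR hH'.eigenvalues).submatrix σ σ := by
      rw [diagR, diagR, submatrix_diagonal_equiv]; rfl
    rw [h1, conjTranspose_submatrix, submatrix_mul_equiv, submatrix_mul_equiv, submatrix_id_id]
    exact hH'.spectral_theorem
  have hd : star V.det * V.det = 1 := by
    rw [← det_conjTranspose, ← det_mul, hV, det_one]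
  let E : Matrix (Fin 3) (Fin 3) ℂ := diagonal ![star V.det, 1, 1]
  have hE : Eᴴ * E = 1 := by
    rw [diagonal_conjTranspose, diagonal_mul_diagonal, ← diagonal_one, diagonal_eq_diagonal_iff]
    intro i
    fin_cases i
    · simpa [mul_comm] using hd
    · simp
    · simp
  have hE' : E * Eᴴ = 1 := mul_eq_one_comm.1 hE
  have hc : E * diagR l = diagR l * E := by
    rw [diagR, diagonal_mul_diagonal, diagonal_mul_diagonal]
    simp only [mul_comm]
  refine ⟨SU3.ofUnitary (V * E) ?_ ?_, l, Tuple.monotone_sort _, ?_⟩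
  · rw [conjTranspose_mul]
    calc _ = Eᴴ * (Vᴴ * V) * E := by simp only [mul_assoc]
      _ = 1 := by rw [hV, mul_one, hE]
  · rw [det_mul, det_diagonal, Fin.prod_univ_three]
    simpa [mul_comm] using hd
  · rw [hdiag]
    change _ = V * E * diagR l * (V * E)ᴴ
    rw [conjTranspose_mul]
    calc _ = V * (diagR l * (E * Eᴴ)) * Vᴴ := by rw [hE', mul_one]
      _ = V * (diagR l * E) * Eᴴ * Vᴴ := by simp only [mul_assoc]
      _ = _ := by rw [← hc]; simp only [mul_assoc]

/-- If the first matrix of a point of the Cayley plane is diagonal, then the rows of the second one are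
orthogonal, and their lengths are the `rootProd l`. So it is diagonal up to a factor in `SU(3)`, which has
determinant one by the equation `cofactor` if all eigenvalues are positive. -/
lemma exists_of_isPoint_diagR {l : Fin 3 → ℝ} (hm : Monotone l) {x : Matrix (Fin 3) (Fin 3) ℂ}
    (h : IsPoint (diagR l) x) : (∀ i, 0 ≤ l i) ∧ l 0 + l 1 + l 2 = 1 ∧
      ∃ A : SU3, x = diagR (rootProd l) * A.1ᵀ := by
  have hs : l 0 + l 1 + l 2 = 1 := by
    have := h.trace
    rw [diagR, trace_diagonal, Fin.sum_univ_three] at this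
    exact_mod_cast this
  let n : Fin 3 → ℝ := fun i => ∑ j, ‖x i j‖ ^ 2
  have hn : ∀ i, (x * xᴴ) i i = (n i : ℂ) := fun i => by
    have := SU3.star_dotProduct_self_eq (x i)
    rw [dotProduct_comm] at this
    exact this
  have hnn : ∀ i, 0 ≤ n i := fun i => Finset.sum_nonneg fun j _ => by positivity
  have hoff : ∀ i j, i ≠ j → (x * xᴴ) i j = 0 := fun i j hij => by
    have := congrFun (congrFun h.sq i) j
    rw [diagR_mul_diagR] at this
    simpa [diagR, hij, one_apply] using this
  have hdiag : ∀ i, l i * l i + (n 0 + n 1 + n 2) - n i = l i := fun i => by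
    have := congrFun (congrFun h.sq i) i
    rw [diagR_mul_diagR, Matrix.sub_apply, Matrix.add_apply, hn, trace, Fin.sum_univ_three] at this
    simp only [diag_apply, hn, diagR, diagonal_apply_eq, Matrix.smul_apply, one_apply_eq, Pi.mul_apply,
      smul_eq_mul, mul_one] at this
    exact_mod_cast this
  have d0 := hdiag 0
  have d1 := hdiag 1
  have d2 := hdiag 2
  have n0 : n 0 = l 1 * l 2 := by
    linear_combination -(1 / 2) * d0 + (1 / 2) * d1 + (1 / 2) * d2 +
      (1 / 2) * (l 0 - l 1 - l 2) * hs
  have n1 : n 1 = l 0 * l 2 := by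
    linear_combination (1 / 2) * d0 - (1 / 2) * d1 + (1 / 2) * d2 +
      (1 / 2) * (l 1 - l 0 - l 2) * hs
  have n2 : n 2 = l 0 * l 1 := by
    linear_combination (1 / 2) * d0 + (1 / 2) * d1 - (1 / 2) * d2 +
      (1 / 2) * (l 2 - l 0 - l 1) * hs
  have h01 : l 0 ≤ l 1 := hm (by decide)
  have h12 : l 1 ≤ l 2 := hm (by decide)
  have hl0 : 0 ≤ l 0 := by
    by_contra! hneg
    have := n1 ▸ hnn 1
    have hl2 : l 2 ≤ 0 := nonpos_of_mul_nonneg_right this hneg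
    linarith
  have hl : ∀ i, 0 ≤ l i := fun i => hl0.trans (hm (Fin.zero_le i))
  obtain ⟨q0, q1, q2⟩ := rootProd_mul_self hl
  have hq : ∀ i, n i = rootProd l i * rootProd l i := fun i => by
    fin_cases i
    · exact n0.trans q0.symm
    · exact n1.trans q1.symm
    · exact n2.trans q2.symm
  refine ⟨hl, hs, ?_⟩
  rcases hl0.eq_or_lt with h0 | h0
  · -- the last two rows of `x` vanish
    have hrow : ∀ i, rootProd l i = 0 → ∀ j, x i j = 0 := fun i hi j => by
      have h := hq i
      rw [hi, mul_zero, Finset.sum_eq_zero_iff_of_nonneg fun j _ => by positivity] at h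
      exact norm_eq_zero.1 (pow_eq_zero_iff two_ne_zero |>.1 (h j (Finset.mem_univ j)))
    have k1 : rootProd l 1 = 0 := by rw [(rootProd_eq hl).2.1, ← h0, Real.sqrt_zero, zero_mul]
    have k2 : rootProd l 2 = 0 := by rw [(rootProd_eq hl).2.2, ← h0, Real.sqrt_zero, zero_mul]
    have hA : ∃ A : SU3, ∀ j, x 0 j = rootProd l 0 * A.1 j 0 := by
      by_cases k0 : rootProd l 0 = 0
      · exact ⟨1, fun j => by rw [hrow 0 k0, k0, Complex.ofReal_zero, zero_mul]⟩
      · have k0' : (rootProd l 0 : ℂ) ≠ 0 := Complex.ofReal_ne_zero.2 k0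
        have hu : star ((rootProd l 0 : ℂ)⁻¹ • x 0) ⬝ᵥ ((rootProd l 0 : ℂ)⁻¹ • x 0) = 1 := by
          rw [star_smul, smul_dotProduct, dotProduct_smul, SU3.star_dotProduct_self_eq]
          change _ • _ • ((n 0 : ℝ) : ℂ) = 1
          rw [hq 0, star_inv₀, RCLike.star_def, Complex.conj_ofReal, smul_eq_mul, smul_eq_mul]
          push_cast
          field_simp
        obtain ⟨A, hA⟩ := SU3.exists_colv_zero hu
        refine ⟨A, fun j => ?_⟩
        rw [show A.1 j 0 = (rootProd l 0 : ℂ)⁻¹ * x 0 j from congrFun hA j,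
          mul_inv_cancel_left₀ k0']
    obtain ⟨A, hA⟩ := hA
    refine ⟨A, Matrix.ext fun i j => ?_⟩
    rw [diagR, diagonal_mul]
    exact match i with
    | 0 => hA j
    | 1 => by rw [hrow 1 k1, k1, Complex.ofReal_zero, zero_mul]
    | 2 => by rw [hrow 2 k2, k2, Complex.ofReal_zero, zero_mul]
  · have hp : ∀ i, 0 < l i := fun i => h0.trans_le (hm (Fin.zero_le i))
    have hk : ∀ i, rootProd l i ≠ 0 := fun i hi => by
      have h := hq i
      rw [hi, mul_zero] at h
      exact match i, h with
      | 0, h => (mul_pos (hp 1) (hp 2)).ne' (n0.symm.trans h)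
      | 1, h => (mul_pos (hp 0) (hp 2)).ne' (n1.symm.trans h)
      | 2, h => (mul_pos (hp 0) (hp 1)).ne' (n2.symm.trans h)
    have hxx : x * xᴴ = diagR (rootProd l * rootProd l) := by
      ext i j
      by_cases hij : i = j
      · rw [← hij, hn, hq, diagR, diagonal_apply_eq]; rfl
      · rw [hoff i j hij, diagR, diagonal_apply_ne _ hij]
    let y := diagR (rootProd l)⁻¹ * x
    have hy : y * star y = 1 := by
      change (diagR (rootProd l)⁻¹ * x) * (diagR (rootProd l)⁻¹ * x)ᴴ = 1
      rw [conjTranspose_mul, conjTranspose_diagR]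
      calc _ = diagR (rootProd l)⁻¹ * (x * xᴴ) * diagR (rootProd l)⁻¹ := by simp only [mul_assoc]
        _ = 1 := by
          rw [hxx, diagR_mul_diagR, diagR_mul_diagR, diagR, ← diagonal_one,
            diagonal_eq_diagonal_iff]
          intro i
          have := hk i
          simp [this]
    have hdet : star x.det = rootProd l 0 * rootProd l 1 * rootProd l 2 := by
      have e : diagR l * (x * xᴴ) = (x.det • (1 : Matrix (Fin 3) (Fin 3) ℂ))ᴴ := by
        rw [← mul_assoc, h.cofactor, ← conjTranspose_mul, mul_adjugate]
      rw [hxx, diagR_mul_diagR] at e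
      have e0 := congrFun (congrFun e 0) 0
      rw [diagR, diagonal_apply_eq, conjTranspose_apply, Matrix.smul_apply, one_apply_eq, smul_eq_mul,
        mul_one] at e0
      rw [← e0]
      have c0 := (rootProd_mul hl).1
      have : l 0 * (rootProd l 0 * rootProd l 0) = rootProd l 0 * rootProd l 1 * rootProd l 2 := by
        linear_combination rootProd l 0 * c0
      exact_mod_cast this
    have hdet' : x.det = rootProd l 0 * rootProd l 1 * rootProd l 2 := by
      rw [← star_star x.det, hdet]
      simp
    have hyd : y.det = 1 := by
      rw [det_mul, diagR, det_diagonal, Fin.prod_univ_three, hdet']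
      have := fun i => Complex.ofReal_ne_zero.2 (hk i)
      simp only [Pi.inv_apply, Complex.ofReal_inv]
      field_simp [this 0, this 1, this 2]
    let Y : SU3 := ⟨y, mem_specialUnitaryGroup_iff.2 ⟨mem_unitaryGroup_iff.2 hy, hyd⟩⟩
    refine ⟨Y.transpose, ?_⟩
    change x = diagR (rootProd l) * (diagR (rootProd l)⁻¹ * x)
    rw [← mul_assoc, diagR_mul_diagR]
    have : rootProd l * (rootProd l)⁻¹ = 1 := funext fun i => mul_inv_cancel₀ (hk i)
    rw [this, diagR]
    simp

end ExceptionalC3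

/-! ### The coarse realization is the Cayley plane -/

namespace ExceptionalC3

/-- The increasing eigenvalues `sₚ/3`, `sₚ/3 + s_d/2`, `sₚ/3 + s_d/2 + s_q` that encode a point of the
simplex. -/
noncomputable def eig (s : Fin 3 → ℝ) : Fin 3 → ℝ :=
  ![s 2 / 3, s 2 / 3 + s 1 / 2, s 2 / 3 + s 1 / 2 + s 0]

lemma eig_nonneg {s : Fin 3 → ℝ} (hs : ∀ i, 0 ≤ s i) : ∀ i, 0 ≤ eig s i := fun i => by
  have h0 := hs 0
  have h1 := hs 1
  have h2 := hs 2
  exact match i with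
  | 0 => by simp only [eig, cons_val]; positivity
  | 1 => by simp only [eig, cons_val]; positivity
  | 2 => by simp only [eig, cons_val]; positivity

lemma eig_sum (s : Fin 3 → ℝ) : eig s 0 + eig s 1 + eig s 2 = s 0 + s 1 + s 2 := by
  simp only [eig, cons_val]
  ring

/-- The hermitian matrix with eigenvalues `l` whose eigenvectors are the columns of `B`. -/
noncomputable def herm (B : SU3) (l : Fin 3 → ℝ) : Matrix (Fin 3) (Fin 3) ℂ := B.1 * diagR l * B.1ᴴ

/-- The second matrix of a point of the Cayley plane, for `g = (A, B)`: its singular values are the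
`rootProd l`, and its singular vectors are the columns of `B` and the conjugates of the columns of `A`. -/
noncomputable def mixed (g : SU3 × SU3) (l : Fin 3 → ℝ) : Matrix (Fin 3) (Fin 3) ℂ :=
  g.2.1 * diagR (rootProd l) * g.1.1ᵀ

lemma isPoint_herm_mixed {l : Fin 3 → ℝ} (hl : ∀ i, 0 ≤ l i) (hs : l 0 + l 1 + l 2 = 1)
    (g : SU3 × SU3) : IsPoint (herm g.2 l) (mixed g l) :=
  (isPoint_diagR hl hs).translate g.1 g.2

lemma diagR_eq (c : Fin 3 → ℝ) :
    diagR c = (c 1 : ℂ) • 1 + ((c 0 - c 1 : ℝ) : ℂ) • proj 0 + ((c 2 - c 1 : ℝ) : ℂ) • proj 2 := by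
  rw [diagR, proj, proj, smul_one_eq_diagonal, ← diagonal_smul, ← diagonal_smul, diagonal_add,
    diagonal_add, diagonal_eq_diagonal_iff]
  exact fun i => match i with
  | 0 => by simp
  | 1 => by simp
  | 2 => by simp

lemma transpose_inv_one (g : SU3 × SU3) : (inv 1 g)ᵀ = g.2.1 * proj 0 * g.1.1ᵀ := by
  change (g.1.1 * proj 0 * g.2.1ᵀ)ᵀ = _
  rw [transpose_mul, transpose_mul, transpose_transpose, show (proj 0)ᵀ = proj 0 from
    diagonal_transpose _, mul_assoc]

/-- The projector onto the first column of `B`, where `g = (A, B)`. -/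
noncomputable def firstProj (g : SU3 × SU3) : Matrix (Fin 3) (Fin 3) ℂ := g.2.1 * proj 0 * g.2.1ᴴ

lemma firstProj_eq (g : SU3 × SU3) : firstProj g = (inv 1 g)ᵀ * (inv 1 g)ᵀᴴ := by
  have h' : (proj 0 : Matrix (Fin 3) (Fin 3) ℂ)ᴴ = proj 0 := by
    rw [proj, diagonal_conjTranspose, diagonal_eq_diagonal_iff]
    exact fun i => match i with
    | 0 => by simp
    | 1 => by simp
    | 2 => by simp
  have h2 : (proj 0 : Matrix (Fin 3) (Fin 3) ℂ) * proj 0 = proj 0 := by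
    rw [proj, diagonal_mul_diagonal, diagonal_eq_diagonal_iff]
    exact fun i => match i with
    | 0 => by simp
    | 1 => by simp
    | 2 => by simp
  rw [transpose_inv_one, conjTranspose_mul, conjTranspose_mul, h']
  calc firstProj g = g.2.1 * (proj 0 * proj 0) * g.2.1ᴴ := by rw [h2]; rfl
    _ = g.2.1 * proj 0 * (g.1.1ᵀ * g.1.1ᴴᵀ) * (proj 0 * g.2.1ᴴ) := by
      rw [g.1.transpose_mul_conj, mul_one]
      simp only [mul_assoc]
    _ = _ := by simp only [mul_assoc]; rfl

lemma transpose_inv_two (g : SU3 × SU3) : (inv 2 g)ᵀ = g.2.1 * g.1.1ᵀ := by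
  change (g.1.1 * g.2.1ᵀ)ᵀ = _
  rw [transpose_mul, transpose_transpose]

lemma herm_eq (g : SU3 × SU3) (c : Fin 3 → ℝ) : herm g.2 c =
    (c 1 : ℂ) • 1 + ((c 0 - c 1 : ℝ) : ℂ) • firstProj g + ((c 2 - c 1 : ℝ) : ℂ) • inv 0 g := by
  rw [herm, diagR_eq]
  simp only [mul_add, add_mul, mul_smul_comm, smul_mul_assoc, mul_one,
    g.2.mul_conjTranspose_self]
  rfl

lemma mixed_eq_herm_mul (g : SU3 × SU3) (l : Fin 3 → ℝ) :
    mixed g l = herm g.2 (rootProd l) * (inv 2 g)ᵀ := by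
  rw [transpose_inv_two, mixed, herm]
  calc _ = g.2.1 * diagR (rootProd l) * (g.2.1ᴴ * g.2.1) * g.1.1ᵀ := by
        rw [g.2.conjTranspose_mul_self, mul_one]
    _ = _ := by simp only [mul_assoc]

lemma firstProj_mul_transpose_inv_two (g : SU3 × SU3) :
    firstProj g * (inv 2 g)ᵀ = (inv 1 g)ᵀ := by
  rw [transpose_inv_two, transpose_inv_one, firstProj]
  calc _ = g.2.1 * proj 0 * (g.2.1ᴴ * g.2.1) * g.1.1ᵀ := by simp only [mul_assoc]
    _ = _ := by rw [g.2.conjTranspose_mul_self, mul_one]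

lemma mixed_eq (g : SU3 × SU3) (l : Fin 3 → ℝ) : mixed g l =
    (rootProd l 1 : ℂ) • (inv 2 g)ᵀ + ((rootProd l 0 - rootProd l 1 : ℝ) : ℂ) • (inv 1 g)ᵀ +
      ((rootProd l 2 - rootProd l 1 : ℝ) : ℂ) • (inv 0 g * (inv 2 g)ᵀ) := by
  rw [mixed_eq_herm_mul, herm_eq, add_mul, add_mul, smul_mul_assoc, smul_mul_assoc, smul_mul_assoc,
    one_mul, firstProj_mul_transpose_inv_two]

lemma smul_congr_of_ne_zero {r : ℝ} {M N : Matrix (Fin 3) (Fin 3) ℂ} (h : r ≠ 0 → M = N) :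
    (r : ℂ) • M = (r : ℂ) • N := by
  by_cases hr : r = 0
  · rw [hr, Complex.ofReal_zero, zero_smul, zero_smul]
  · rw [h hr]

/-- The pair of matrices only depends on the vertices with nonzero barycentric coordinates. -/
lemma herm_mixed_congr {s : Fin 3 → ℝ} {g g' : SU3 × SU3}
    (h : ∀ i, s i ≠ 0 → inv i g = inv i g') :
    herm g.2 (eig s) = herm g'.2 (eig s) ∧ mixed g (eig s) = mixed g' (eig s) := by
  have e0 : s 2 = 0 → eig s 0 = 0 := fun h => by simp [eig, h]
  have e1 : s 1 = 0 → eig s 0 = eig s 1 := fun h => by simp [eig, h]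
  have e2 : s 0 = 0 → eig s 2 = eig s 1 := fun h => by simp [eig, h]
  have k1 : rootProd (eig s) 1 ≠ 0 → s 2 ≠ 0 := fun hk h2 => hk (by simp [rootProd, e0 h2])
  have k0 : rootProd (eig s) 0 - rootProd (eig s) 1 ≠ 0 → s 1 ≠ 0 := fun hk h1 =>
    hk (by simp [rootProd, e1 h1])
  have k2 : rootProd (eig s) 2 - rootProd (eig s) 1 ≠ 0 → s 0 ≠ 0 ∧ s 2 ≠ 0 := fun hk =>
    ⟨fun h0 => hk (by simp [rootProd, e2 h0]), fun h2 => hk (by simp [rootProd, e0 h2])⟩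
  constructor
  · rw [herm_eq, herm_eq, smul_congr_of_ne_zero (M := firstProj g) (N := firstProj g'),
      smul_congr_of_ne_zero (M := inv 0 g)]
    · exact fun hk => h 0 fun h0 => hk (sub_eq_zero.2 (e2 h0))
    · exact fun hk => by
        rw [firstProj_eq, firstProj_eq, h 1 fun h1 => hk (sub_eq_zero.2 (e1 h1))]
  · rw [mixed_eq, mixed_eq, smul_congr_of_ne_zero (M := (inv 2 g)ᵀ) (N := (inv 2 g')ᵀ),
      smul_congr_of_ne_zero (M := (inv 1 g)ᵀ) (N := (inv 1 g')ᵀ),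
      smul_congr_of_ne_zero (M := inv 0 g * (inv 2 g)ᵀ)]
    · exact fun hk => by rw [h 0 (k2 hk).1, h 2 (k2 hk).2]
    · exact fun hk => by rw [h 1 (k0 hk)]
    · exact fun hk => by rw [h 2 (k1 hk)]

lemma herm_mul_herm (B : SU3) (c d : Fin 3 → ℝ) : herm B c * herm B d = herm B (c * d) := by
  rw [herm, herm, herm, ← diagR_mul_diagR]
  calc _ = B.1 * diagR c * (B.1ᴴ * B.1) * diagR d * B.1ᴴ := by simp only [mul_assoc]
    _ = _ := by rw [B.conjTranspose_mul_self, mul_one]; simp only [mul_assoc]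

lemma herm_sub_smul_one (B : SU3) (c : Fin 3 → ℝ) (t : ℝ) :
    herm B c - (t : ℂ) • 1 = herm B fun i => c i - t := by
  have h : diagR (fun i => c i - t) = diagR c - (t : ℂ) • 1 := by
    rw [diagR, diagR, smul_one_eq_diagonal, diagonal_sub]
    simp
  rw [herm, herm, h, mul_sub, sub_mul, mul_smul_comm, smul_mul_assoc, mul_one,
    B.mul_conjTranspose_self]

lemma det_herm (B : SU3) (c : Fin 3 → ℝ) : (herm B c).det = (c 0 * c 1 * c 2 : ℝ) := by
  rw [herm, det_mul, det_mul, B.det_eq_one, det_conjTranspose, B.det_eq_one, diagR, det_diagonal,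
    Fin.prod_univ_three]
  simp

/-- Increasing eigenvalues are determined by the hermitian matrix. -/
lemma eigenvalues_eq_of_herm_eq {B B' : SU3} {l l' : Fin 3 → ℝ} (hl : Monotone l)
    (hl' : Monotone l') (hs : l 0 + l 1 + l 2 = l' 0 + l' 1 + l' 2) (h : herm B l = herm B' l') :
    l = l' := by
  have key : ∀ t : ℝ, (l 0 - t) * (l 1 - t) * (l 2 - t) = (l' 0 - t) * (l' 1 - t) * (l' 2 - t) :=
    fun t => by
    have := congrArg (fun M => (M - (t : ℂ) • 1).det) h
    simp only [herm_sub_smul_one, det_herm] at this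
    exact_mod_cast this
  have h01 : l 0 ≤ l 1 := hl (by decide)
  have h12 : l 1 ≤ l 2 := hl (by decide)
  have h01' : l' 0 ≤ l' 1 := hl' (by decide)
  have h12' : l' 1 ≤ l' 2 := hl' (by decide)
  have r : ∀ t, (l 0 - t = 0 ∨ l 1 - t = 0 ∨ l 2 - t = 0) ↔
      (l' 0 - t = 0 ∨ l' 1 - t = 0 ∨ l' 2 - t = 0) := fun t => by
    rw [← or_assoc, ← or_assoc, ← mul_eq_zero, ← mul_eq_zero, ← mul_eq_zero, ← mul_eq_zero, key]
  have a0 : l' 0 ≤ l 0 := by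
    rcases (r (l 0)).1 (Or.inl (sub_self _)) with h | h | h <;> linarith
  have b0 : l 0 ≤ l' 0 := by
    rcases (r (l' 0)).2 (Or.inl (sub_self _)) with h | h | h <;> linarith
  have a2 : l 2 ≤ l' 2 := by
    rcases (r (l 2)).1 (Or.inr (Or.inr (sub_self _))) with h | h | h <;> linarith
  have b2 : l' 2 ≤ l 2 := by
    rcases (r (l' 2)).2 (Or.inr (Or.inr (sub_self _))) with h | h | h <;> linarith
  funext i
  exact match i with
  | 0 => le_antisymm b0 a0
  | 1 => by linarith
  | 2 => le_antisymm a2 b2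

lemma monotone_eig {s : Fin 3 → ℝ} (hs : ∀ i, 0 ≤ s i) : Monotone (eig s) := by
  have h0 := hs 0
  have h1 := hs 1
  rw [Fin.monotone_iff_le_succ]
  intro i
  fin_cases i
  · change s 2 / 3 ≤ s 2 / 3 + s 1 / 2
    linarith
  · change s 2 / 3 + s 1 / 2 ≤ s 2 / 3 + s 1 / 2 + s 0
    linarith

lemma eig_injective : Function.Injective eig := fun s s' h => by
  have h0 : s 2 / 3 = s' 2 / 3 := congrFun h 0
  have h1 : s 2 / 3 + s 1 / 2 = s' 2 / 3 + s' 1 / 2 := congrFun h 1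
  have h2 : s 2 / 3 + s 1 / 2 + s 0 = s' 2 / 3 + s' 1 / 2 + s' 0 := congrFun h 2
  funext i
  exact match i with
  | 0 => by linarith
  | 1 => by linarith
  | 2 => by linarith

/-- Multiplying out the other eigenvalues isolates the projector onto an eigenspace. -/
lemma smul_inv_zero_eq (g : SU3 × SU3) (l : Fin 3 → ℝ) :
    (herm g.2 l - (l 0 : ℂ) • 1) * (herm g.2 l - (l 1 : ℂ) • 1) =
      (((l 2 - l 0) * (l 2 - l 1) : ℝ) : ℂ) • inv 0 g := by
  rw [herm_sub_smul_one, herm_sub_smul_one, herm_mul_herm, herm_eq]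
  simp

lemma smul_firstProj_eq (g : SU3 × SU3) (l : Fin 3 → ℝ) :
    (herm g.2 l - (l 1 : ℂ) • 1) * (herm g.2 l - (l 2 : ℂ) • 1) =
      (((l 0 - l 1) * (l 0 - l 2) : ℝ) : ℂ) • firstProj g := by
  rw [herm_sub_smul_one, herm_sub_smul_one, herm_mul_herm, herm_eq]
  simp

lemma firstProj_mul_mixed (g : SU3 × SU3) (l : Fin 3 → ℝ) :
    firstProj g * mixed g l = (rootProd l 0 : ℂ) • (inv 1 g)ᵀ := by
  have e : proj 0 * diagR (rootProd l) = (rootProd l 0 : ℂ) • proj 0 := by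
    rw [proj, diagR, diagonal_mul_diagonal, ← diagonal_smul, diagonal_eq_diagonal_iff]
    exact fun i => match i with
    | 0 => by simp
    | 1 => by simp
    | 2 => by simp
  rw [firstProj, mixed, transpose_inv_one]
  calc _ = g.2.1 * proj 0 * (g.2.1ᴴ * g.2.1) * diagR (rootProd l) * g.1.1ᵀ := by
        simp only [mul_assoc]
    _ = g.2.1 * (proj 0 * diagR (rootProd l)) * g.1.1ᵀ := by
        rw [g.2.conjTranspose_mul_self, mul_one, mul_assoc g.2.1]
    _ = _ := by rw [e, mul_smul_comm, smul_mul_assoc]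

lemma eq_of_smul_eq {r : ℝ} (hr : r ≠ 0) {M N : Matrix (Fin 3) (Fin 3) ℂ}
    (h : (r : ℂ) • M = (r : ℂ) • N) : M = N :=
  smul_right_injective _ (Complex.ofReal_ne_zero.2 hr) h

/-- The pair of matrices determines the point of the realization. -/
lemma eq_of_herm_mixed_eq {s s' : Fin 3 → ℝ} {g g' : SU3 × SU3} (hs : ∀ i, 0 ≤ s i)
    (hs' : ∀ i, 0 ≤ s' i) (h1 : s 0 + s 1 + s 2 = 1) (h1' : s' 0 + s' 1 + s' 2 = 1)
    (hH : herm g.2 (eig s) = herm g'.2 (eig s')) (hx : mixed g (eig s) = mixed g' (eig s')) :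
    s = s' ∧ ∀ i, s i ≠ 0 → inv i g = inv i g' := by
  have hl : eig s = eig s' := eigenvalues_eq_of_herm_eq (monotone_eig hs) (monotone_eig hs')
    (by rw [eig_sum, eig_sum, h1, h1']) hH
  obtain rfl := eig_injective hl
  refine ⟨rfl, ?_⟩
  have hpos : ∀ i, s i ≠ 0 → 0 < s i := fun i hi => (hs i).lt_of_ne' hi
  have p0 := hs 0
  have p1 := hs 1
  have p2 := hs 2
  have l0 : eig s 0 = s 2 / 3 := rfl
  have l1 : eig s 1 = s 2 / 3 + s 1 / 2 := rfl
  have l2 : eig s 2 = s 2 / 3 + s 1 / 2 + s 0 := rfl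
  have c0 : s 0 ≠ 0 → inv 0 g = inv 0 g' := fun h0 => by
    have h0' := hpos 0 h0
    refine eq_of_smul_eq (r := (eig s 2 - eig s 0) * (eig s 2 - eig s 1)) ?_ ?_
    · exact (mul_pos (by linarith) (by linarith)).ne'
    · rw [← smul_inv_zero_eq, ← smul_inv_zero_eq, hH]
  have cf : s 1 ≠ 0 → firstProj g = firstProj g' := fun h1 => by
    have h1' := hpos 1 h1
    refine eq_of_smul_eq (r := (eig s 0 - eig s 1) * (eig s 0 - eig s 2)) ?_ ?_
    · exact (mul_pos_of_neg_of_neg (by linarith) (by linarith)).ne'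
    · rw [← smul_firstProj_eq, ← smul_firstProj_eq, hH]
  have c1 : s 1 ≠ 0 → inv 1 g = inv 1 g' := fun h1 => by
    have h1' := hpos 1 h1
    apply transpose_injective
    refine eq_of_smul_eq (r := rootProd (eig s) 0) ?_ ?_
    · exact (Real.sqrt_pos.2 (mul_pos (by linarith) (by linarith))).ne'
    · rw [← firstProj_mul_mixed, ← firstProj_mul_mixed, hx, cf h1]
  have c2 : s 2 ≠ 0 → inv 2 g = inv 2 g' := fun h2 => by
    have h2' := hpos 2 h2
    have hM : herm g.2 (rootProd (eig s)) = herm g'.2 (rootProd (eig s)) := by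
      rw [herm_eq, herm_eq, smul_congr_of_ne_zero (M := firstProj g) (N := firstProj g'),
        smul_congr_of_ne_zero (M := inv 0 g)]
      · exact fun hk => c0 fun h0 => hk (by simp [rootProd, l2, l1, h0])
      · exact fun hk => cf fun h1 => hk (by simp [rootProd, l0, l1, h1])
    have hdet : IsUnit (herm g.2 (rootProd (eig s))).det := by
      rw [det_herm, isUnit_iff_ne_zero, Complex.ofReal_ne_zero]
      have q0 : 0 < eig s 0 := by linarith
      have q1 : 0 < eig s 1 := by linarith
      have q2 : 0 < eig s 2 := by linarith
      exact (mul_pos (mul_pos (Real.sqrt_pos.2 (mul_pos q1 q2)) (Real.sqrt_pos.2 (mul_pos q0 q2)))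
        (Real.sqrt_pos.2 (mul_pos q0 q1))).ne'
    apply transpose_injective
    rw [mixed_eq_herm_mul, mixed_eq_herm_mul, ← hM] at hx
    have := congrArg (fun M => (herm g.2 (rootProd (eig s)))⁻¹ * M) hx
    simpa only [← mul_assoc, nonsing_inv_mul _ hdet, one_mul] using this
  exact fun i => match i with
  | 0 => c0
  | 1 => c1
  | 2 => c2

/-- Every pair of matrices in the Cayley plane arises. -/
lemma exists_herm_mixed {H x : Matrix (Fin 3) (Fin 3) ℂ} (h : IsPoint H x) :
    ∃ (g : SU3 × SU3) (s : Fin 3 → ℝ), (∀ i, 0 ≤ s i) ∧ s 0 + s 1 + s 2 = 1 ∧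
      H = herm g.2 (eig s) ∧ x = mixed g (eig s) := by
  obtain ⟨B, l, hm, rfl⟩ := exists_diagR h.hermitian
  have h' := h.translate 1 B⁻¹
  have e1 : (B⁻¹).1 * (B.1 * diagR l * B.1ᴴ) * (B⁻¹).1ᴴ = diagR l := by
    rw [SU3.coe_inv, conjTranspose_conjTranspose]
    calc _ = (B.1ᴴ * B.1) * diagR l * (B.1ᴴ * B.1) := by simp only [mul_assoc]
      _ = _ := by rw [B.conjTranspose_mul_self, one_mul, mul_one]
  have e2 : (B⁻¹).1 * x * (1 : SU3).1ᵀ = B.1ᴴ * x := by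
    change B.1ᴴ * x * (1 : Matrix (Fin 3) (Fin 3) ℂ)ᵀ = _
    rw [transpose_one, mul_one]
  rw [e1, e2] at h'
  obtain ⟨hl, hs, A, hA⟩ := exists_of_isPoint_diagR hm h'
  let s : Fin 3 → ℝ := ![l 2 - l 1, 2 * (l 1 - l 0), 3 * l 0]
  have hls : eig s = l := funext fun i => match i with
    | 0 => by simp [eig, s]
    | 1 => by simp [eig, s]
    | 2 => by simp [eig, s]
  have h01 : l 0 ≤ l 1 := hm (by decide)
  have h12 : l 1 ≤ l 2 := hm (by decide)
  refine ⟨(A, B), s, fun i => ?_, ?_, ?_, ?_⟩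
  · exact match i with
    | 0 => sub_nonneg.2 h12
    | 1 => mul_nonneg zero_le_two (sub_nonneg.2 h01)
    | 2 => mul_nonneg zero_le_three (hl 0)
  · rw [← eig_sum, hls, hs]
  · rw [hls]; rfl
  · rw [hls, mixed, mul_assoc, ← hA, ← mul_assoc, B.mul_conjTranspose_self, one_mul]

end ExceptionalC3

namespace ExceptionalC3

/-- The chamber given by an element of `SU(3) × SU(3)`. -/
def chamber (g : SU3 × SU3) : Delta.chamberTuples vertexType := by
  classical
  exact ⟨fun i => vtx i g, fun _ => rfl, Finset.univ.image fun i => vtx i g,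
    mem_simplices_iff.2 ⟨g, fun v hv => by obtain ⟨i, -, rfl⟩ := Finset.mem_image.1 hv; rfl⟩,
    by simp⟩

lemma chamber_surjective : Function.Surjective chamber := by
  rintro ⟨f, hf, α, hα, hαf⟩
  obtain ⟨g, hg⟩ := mem_simplices_iff.1 hα
  refine ⟨g, Subtype.ext (funext fun i => ?_)⟩
  change vtx i g = f i
  rw [hg (f i) (hαf ▸ Set.mem_range_self i : f i ∈ (α : Set _)), hf]

lemma continuous_chamber : Continuous chamber :=
  (continuous_pi fun i => continuous_vtx i).subtype_mk _

/-- The point of the coarse realization given by a chamber and barycentric coordinates. -/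
noncomputable def toCoarse (x : (SU3 × SU3) × stdSimplex ℝ (Fin 3)) :
    Delta.CoarseRealization vertexType :=
  SComplex.coarseMap Delta vertexType (chamber x.1, x.2)

lemma toCoarse_apply (x : (SU3 × SU3) × stdSimplex ℝ (Fin 3)) (i : Fin 3) (g : SU3 × SU3) :
    (toCoarse x).1 (vtx i g) = if inv i x.1 = inv i g then x.2.1 i else 0 := by
  classical
  change (∑ j, Finsupp.single (vtx j x.1) (x.2.1 j)) (vtx i g) = _
  rw [Finsupp.finsetSum_apply, Finset.sum_eq_single i]
  · rw [Finsupp.single_apply]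
    simp only [vtx_eq_vtx_iff]
  · intro j _ hj
    exact Finsupp.single_eq_of_ne fun h => hj (congrArg vertexType h).symm
  · exact fun h => absurd (Finset.mem_univ i) h

lemma toCoarse_eq_iff {x y : (SU3 × SU3) × stdSimplex ℝ (Fin 3)} : toCoarse x = toCoarse y ↔
    x.2.1 = y.2.1 ∧ ∀ i, x.2.1 i ≠ 0 → inv i x.1 = inv i y.1 := by
  constructor
  · intro h
    have e : ∀ i g, (toCoarse x).1 (vtx i g) = (toCoarse y).1 (vtx i g) := fun i g => by rw [h]
    simp only [toCoarse_apply] at e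
    have key : ∀ i, x.2.1 i = y.2.1 i ∧ (x.2.1 i ≠ 0 → inv i x.1 = inv i y.1) := fun i => by
      have h1 := e i x.1
      have h2 := e i y.1
      rw [if_pos rfl] at h1 h2
      by_cases hi : inv i x.1 = inv i y.1
      · rw [if_pos hi.symm] at h1
        exact ⟨h1, fun _ => hi⟩
      · rw [if_neg (Ne.symm hi)] at h1
        rw [if_neg hi] at h2
        exact ⟨h1.trans h2, fun h => absurd h1 h⟩
    exact ⟨funext fun i => (key i).1, fun i => (key i).2⟩
  · rintro ⟨h1, h2⟩
    refine Subtype.ext (Finsupp.ext fun v => ?_)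
    obtain ⟨g, hg⟩ := exists_vtx v
    rw [hg, toCoarse_apply, toCoarse_apply, ← h1]
    by_cases h0 : x.2.1 (vertexType v) = 0
    · rw [h0, ite_self, ite_self]
    · rw [h2 _ h0]

lemma coarseMap_surjective : Function.Surjective (SComplex.coarseMap Delta vertexType) := by
  rintro ⟨ξ, hξ0, hξs, hξ1⟩
  obtain ⟨g, hg⟩ := mem_simplices_iff.1 hξs
  have e : ξ = ∑ i, Finsupp.single (vtx i g) (ξ (vtx i g)) := by
    classical
    ext v
    rw [Finsupp.finsetSum_apply]
    by_cases hv : v ∈ ξ.support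
    · rw [Finset.sum_eq_single (vertexType v), ← hg v hv, Finsupp.single_eq_same]
      · intro j _ hj
        exact Finsupp.single_eq_of_ne fun h => hj (congrArg vertexType h).symm
      · exact fun h => absurd (Finset.mem_univ _) h
    · rw [Finsupp.notMem_support_iff.1 hv]
      symm
      refine Finset.sum_eq_zero fun i _ => ?_
      rw [Finsupp.single_apply]
      split_ifs with h
      · rw [h, Finsupp.notMem_support_iff.1 hv]
      · rfl
  have hs : ∑ i, ξ (vtx i g) = 1 := by
    rw [← hξ1, e, ← Finsupp.sum_finsetSum_index (fun _ => rfl) (fun _ _ _ => rfl)]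
    refine Finset.sum_congr rfl fun i _ => ?_
    rw [Finsupp.sum_single_index rfl, ← e]
  exact ⟨(chamber g, ⟨fun i => ξ (vtx i g), fun i => hξ0 _, hs⟩), Subtype.ext e.symm⟩

lemma isQuotientMap_toCoarse : Topology.IsQuotientMap toCoarse := by
  have h1 : Topology.IsQuotientMap (SComplex.coarseMap Delta vertexType) :=
    ⟨⟨rfl⟩, coarseMap_surjective⟩
  have hc : Continuous (Prod.map chamber (id : stdSimplex ℝ (Fin 3) → _)) :=
    continuous_chamber.prodMap continuous_id
  have h2 : Topology.IsQuotientMap (Prod.map chamber (id : stdSimplex ℝ (Fin 3) → _)) :=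
    hc.isClosedMap.isQuotientMap hc (chamber_surjective.prodMap Function.surjective_id)
  exact h1.comp h2

lemma sum_eq_one (s : stdSimplex ℝ (Fin 3)) : s.1 0 + s.1 1 + s.1 2 = 1 := by
  rw [← Fin.sum_univ_three]
  exact s.2.2

/-- The point of the Cayley plane given by a chamber and barycentric coordinates. -/
noncomputable def toCayley (x : (SU3 × SU3) × stdSimplex ℝ (Fin 3)) : CayleyPlane :=
  ⟨Octonion.ofPair (herm x.1.2 (eig x.2.1)) (mixed x.1 (eig x.2.1)),
    (isPoint_herm_mixed (eig_nonneg x.2.2.1) ((eig_sum _).trans (sum_eq_one x.2)) x.1).ofPair_mem⟩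

lemma continuous_toCayley : Continuous toCayley := by
  have hs : ∀ i, Continuous fun x : (SU3 × SU3) × stdSimplex ℝ (Fin 3) => x.2.1 i := fun i =>
    (continuous_apply i).comp (continuous_subtype_val.comp continuous_snd)
  have hl : ∀ i, Continuous fun x : (SU3 × SU3) × stdSimplex ℝ (Fin 3) => eig x.2.1 i :=
    fun i => match i with
    | 0 => (hs 2).div_const 3
    | 1 => ((hs 2).div_const 3).add ((hs 1).div_const 2)
    | 2 => (((hs 2).div_const 3).add ((hs 1).div_const 2)).add (hs 0)
  have hr : ∀ i, Continuous fun x : (SU3 × SU3) × stdSimplex ℝ (Fin 3) => rootProd (eig x.2.1) i :=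
    fun i => match i with
    | 0 => ((hl 1).mul (hl 2)).sqrt
    | 1 => ((hl 0).mul (hl 2)).sqrt
    | 2 => ((hl 0).mul (hl 1)).sqrt
  have hA : Continuous fun x : (SU3 × SU3) × stdSimplex ℝ (Fin 3) => x.1.1.1 :=
    continuous_subtype_val.comp (continuous_fst.comp continuous_fst)
  have hB : Continuous fun x : (SU3 × SU3) × stdSimplex ℝ (Fin 3) => x.1.2.1 :=
    continuous_subtype_val.comp (continuous_snd.comp continuous_fst)
  have hd : ∀ {f : (SU3 × SU3) × stdSimplex ℝ (Fin 3) → Fin 3 → ℝ},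
      (∀ i, Continuous fun x => f x i) → Continuous fun x => diagR (f x) := fun hf =>
    (continuous_pi fun i => Complex.continuous_ofReal.comp (hf i)).matrix_diagonal
  exact (Octonion.continuous_ofPair ((hB.matrix_mul (hd hl)).matrix_mul hB.matrix_conjTranspose)
    ((hB.matrix_mul (hd hr)).matrix_mul hA.matrix_transpose)).subtype_mk _

instance : T2Space CayleyPlane :=
  inferInstanceAs (T2Space
    {X : Matrix (Fin 3) (Fin 3) Octonion // X.conjTranspose = X ∧ X * X = X ∧ X.trace = 1})

lemma toCayley_surjective : Function.Surjective toCayley := by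
  rintro ⟨X, hX⟩
  obtain ⟨H, x, h, rfl⟩ := exists_isPoint hX
  obtain ⟨g, s, hs, h1, rfl, rfl⟩ := exists_herm_mixed h
  exact ⟨(g, ⟨s, hs, (Fin.sum_univ_three s).trans h1⟩), rfl⟩

lemma isQuotientMap_toCayley : Topology.IsQuotientMap toCayley :=
  continuous_toCayley.isClosedMap.isQuotientMap continuous_toCayley toCayley_surjective

lemma toCayley_eq_iff {x y : (SU3 × SU3) × stdSimplex ℝ (Fin 3)} : toCayley x = toCayley y ↔
    x.2.1 = y.2.1 ∧ ∀ i, x.2.1 i ≠ 0 → inv i x.1 = inv i y.1 := by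
  constructor
  · intro h
    obtain ⟨h1, h2⟩ := Octonion.ofPair_injective (congrArg Subtype.val h)
    exact eq_of_herm_mixed_eq x.2.2.1 y.2.2.1 (sum_eq_one _) (sum_eq_one _) h1 h2
  · rintro ⟨h1, h2⟩
    obtain ⟨e1, e2⟩ := herm_mixed_congr h2
    refine Subtype.ext ?_
    change Octonion.ofPair _ _ = Octonion.ofPair _ _
    rw [e1, e2, h1]

/-- Both spaces are quotients of the same compact space by the same equivalence relation. -/
theorem nonempty_homeomorph_cayleyPlane :
    Nonempty (Delta.CoarseRealization vertexType ≃ₜ CayleyPlane) := by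
  let f : C((SU3 × SU3) × stdSimplex ℝ (Fin 3), Delta.CoarseRealization vertexType) :=
    ⟨toCoarse, isQuotientMap_toCoarse.continuous⟩
  let f' : C((SU3 × SU3) × stdSimplex ℝ (Fin 3), CayleyPlane) := ⟨toCayley, continuous_toCayley⟩
  have hf : Topology.IsQuotientMap f := isQuotientMap_toCoarse
  have hf' : Topology.IsQuotientMap f' := isQuotientMap_toCayley
  exact ⟨hf.homeomorph.symm.trans ((Homeomorph.Quotient.congrRight fun x y =>
    toCoarse_eq_iff.trans toCayley_eq_iff.symm).trans hf'.homeomorph)⟩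

end ExceptionalC3

theorem mainTheorem5 :
    SComplex.IsHomogeneousCompactGeometry ExceptionalC3.G ExceptionalC3.Delta ExceptionalC3.vertexType
      (CoxeterMatrix.B 3) ∧
    ¬ ExceptionalC3.Delta.IsBuilding ∧
    Nonempty (SComplex.CoarseRealization ExceptionalC3.Delta ExceptionalC3.vertexType ≃ₜ CayleyPlane) :=
  ⟨ExceptionalC3.isHomogeneousCompactGeometry, ExceptionalC3.isFlatC3.not_isBuilding,
    ExceptionalC3.nonempty_homeomorph_cayleyPlane⟩
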